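/- All objects are formal power series over $\mathbb R$ in the state variables $x,y$ and in parameters $\mu=(\mu_1,\dots,\mu_p)$. Put, for $-1\le l\le k+1$ (first family) and $0\le l\le k$ (second family), $$A^l_k=\tfrac{k-l+1}{k+2}x^{l+1}y^{k-l}\partial_x-\tfrac{l+1}{k+2}x^ly^{k-l+1}\partial_y,\qquad B^l_k=x^{l+1}y^{k-l}\partial_x+x^ly^{k-l+1}\partial_y ,$$ the Hamiltonian and Eulerian terms; in particular $A^1_0=-x\partial_y$, $A^{-1}_k=y^{k+1}\partial_x$ and $B^0_k=y^k(x\partial_x+y\partial_y)$. A change of state variables is $(x,y)=\Phi(X,Y,\mu)$ with $\Phi(0,0,0)=0$ and $D_{(X,Y)}\Phi(0,0,0)$ invertible; a time rescaling is $dt=T(X,Y,\mu)\,d\tau$ with $T(0,0,0)\ne0$; a reparametrization is $\mu=\psi(\nu)$ with $\psi(0)=0$ and $D\psi(0)$ invertible. For $s\ge1$ call $j$ resonant if $j=k(s+1)+2s$ for some $k\ge1$, $k\ne s$. Let $v=-x\partial_y+\text{h.o.t.}$ be a generalized saddle-node case of the Bogdanov–Takens singularity with indices $s\ge 1$ and $r_1>2s$: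 parameter-free changes of state variables and time rescaling transform $v$ into a classical normal form $A^1_0+\sum_{k\ge1} a_kA^{-1}_k+\sum_{k\ge1} b_kB^0_k$ in which $b_s\ne0$, $b_k=0$ for all $k\neq s$ with $k+s\le r_1$, $a_k=0$ for $k<r_1$, $a_{r_1}\ne0$, and $r_1$ is not resonant (i.e. $r_1$ is the index obtained after the eliminable terms up to $r_1$ have been removed). Assume one of the following, which defines $e$: * $r_1\ne s(s+1)+2s$, and $e=r_1+s^2+s$; * $r_1=s(s+1)+2s$, and there is $r_2$ with $r_1<r_2<2s^2+4s$, not resonant, such that $v$ can be transformed in the same way into a classical normal form with $b_s\neq 0$, $b_k=0$ for all $k\ne s$ with $k+s\le r_2$, $a_k=0$ for $k<r_2$, $k\ne r_1$, and $a_{r_1}\ne0\ne a_{r_2}$; and $e=r_2+s^2+s$. Let $N>r_1$, and let $J=\{j_1<\dots<j_n\}$ be the set of all $1\le j<N$ with $j\ne e$ and $j$ not resonant. (In the second case $r_1+s^2+s=2s^2+4s$ is itself resonant.) Let $w(x,y,\mu)$ be any parametric deformation of $v$ with $p$ parameters, i.e. $w(x,y,0)=v(x,y)$. "$N$-degree truncated"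 means truncated at degree $N$ in $(x,y)$. Then: 1. Invertible parametric changes of state variables and time rescaling transform $w$ into a system whose $N$-degree truncation is a parametric normal form $$w_N=A^1_0+\sum_{k=0}^{s-2}b_k(\mu)B^0_k+B^0_s+a_{-1}(\mu)A^{-1}_{-1}+a_0(\mu)A^{-1}_0+\sum_{j\in J}a_j(\mu)A^{-1}_j ,$$ with $b_k(0)=0$ for $0\le k\le s-2$, $a_j(0)=0$ for $j<r_1$, and $a_{r_1}(0)\ne0$. 2. Suppose $w$ is non-degenerate, i.e. it has such a truncated parametric normal form $w_N$ with $\operatorname{rank}\big(\partial w_N/\partial\mu|_{\mu=0}\big)=n+s+1$. Then $p\ge n+s+1$, and there are an invertible reparametrization, a parametric time rescaling and parametric changes of state variables that transform $w$ into a system whose $N$-degree truncation is $$\dot x=\mu_s+\mu_{s+1}y+\sum_{i=1}^n(\alpha_{j_i}+\mu_{i+s+1})y^{j_i+1}+xy^s+\sum_{k=0}^{s-2}\mu_{k+1}xy^k,\qquad \dot y=-x+y^{s+1}+\sum_{k=0}^{s-2}\mu_{k+1}y^{k+1},$$ where $\mu_i$ now denotes the new parameters, $\alpha_{j_i}=0$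 for all $j_i<r_1$, $r_1\in J$ and $\alpha_{r_1}\ne0$. This vector field is the sum of its Hamiltonian part $A^1_0+\mu_sA^{-1}_{-1}+\mu_{s+1}A^{-1}_0+\sum_i(\alpha_{j_i}+\mu_{i+s+1})A^{-1}_{j_i}$ and its Eulerian part $B^0_s+\sum_{k=0}^{s-2}\mu_{k+1}B^0_k$. 3. Statement 2 also holds with $J$ replaced by $J\setminus\{2s\}$ throughout (in $w_N$, in $n$, in the rank condition and in the conclusion). -/

import Mathlib

noncomputable section

/-- Formal power series over `ℝ` in the state variables `x = X (inl 0)`, `y = X (inl 1)` and the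
parameters `μ₁, …, μ_p`, where `μ_l = X (inr (l - 1))`. -/
abbrev StateSeries (p : ℕ) : Type := MvPowerSeries (Fin 2 ⊕ Fin p) ℝ

/-- Formal power series over `ℝ` in the parameters `μ₁, …, μ_p` only. -/
abbrev ParamSeries (p : ℕ) : Type := MvPowerSeries (Fin p) ℝ

/-- A formal planar vector field depending on `p` parameters, `![ẋ, ẏ]`.  For `p = 0` this is a
formal planar vector field (no parameters). -/
abbrev PVectorField (p : ℕ) : Type := Fin 2 → StateSeries p

namespace PNF

def x (p : ℕ) : StateSeries p := MvPowerSeries.X (Sum.inl 0)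

def y (p : ℕ) : StateSeries p := MvPowerSeries.X (Sum.inl 1)

/-- The parameter `μ_i` for `1 ≤ i ≤ p` (numbered from 1; `0` outside that range). -/
def par (p i : ℕ) : StateSeries p :=
  if h : 1 ≤ i ∧ i ≤ p then MvPowerSeries.X (Sum.inr ⟨i - 1, by omega⟩) else 0

/-- A real constant as a power series. -/
def const (p : ℕ) (c : ℝ) : StateSeries p := MvPowerSeries.C c

/-- A power series in the parameters, regarded as a series in the state variables and the
parameters. -/
def ofParam {p : ℕ} (f : ParamSeries p) : StateSeries p := MvPowerSeries.rename Sum.inr f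

/-- Setting all parameters equal to zero. -/
def atZero {p : ℕ} (f : StateSeries p) : StateSeries 0 :=
  MvPowerSeries.subst
    (Sum.elim (fun i => MvPowerSeries.X (Sum.inl i)) (fun _ => 0) :
      Fin 2 ⊕ Fin p → StateSeries 0) f

/-- The Hamiltonian term `A^l_k` (`-1 ≤ l ≤ k + 1`).  In this range a negative exponent occurs only
together with a zero coefficient. -/
def hamTerm (p : ℕ) (l k : ℤ) : PVectorField p :=
  ![const p (((k : ℝ) - l + 1) / (k + 2)) * x p ^ (l + 1).toNat * y p ^ (k - l).toNat,
    -(const p (((l : ℝ) + 1) / (k + 2)) * x p ^ l.toNat * y p ^ (k - l + 1).toNat)]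

/-- The Eulerian term `B^l_k` (`0 ≤ l ≤ k`). -/
def eulerTerm (p : ℕ) (l k : ℤ) : PVectorField p :=
  ![x p ^ (l + 1).toNat * y p ^ (k - l).toNat, x p ^ l.toNat * y p ^ (k - l + 1).toNat]

/-- `v = -x ∂/∂y + higher order terms`. -/
def IsBogdanovTakens (v : PVectorField 0) : Prop :=
  (∀ i, MvPowerSeries.constantCoeff (v i) = 0) ∧
    ∀ i j, MvPowerSeries.coeff (Finsupp.single (Sum.inl j) 1) (v i) =
      if i = 1 ∧ j = 0 then -1 else 0

/-- `w` is a parametric deformation of `v`: `w(x, y, 0) = v(x, y)`. -/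
def IsDeformation {p : ℕ} (w : PVectorField p) (v : PVectorField 0) : Prop :=
  ∀ i, atZero (w i) = v i

/-- An invertible (formal, parametric) change of the state variables `(x, y) = Φ(X, Y, μ)`
together with an invertible parametric time rescaling `dt = T(X, Y, μ) dτ`. -/
structure StateTimeChange (p : ℕ) where
  Φ : Fin 2 → StateSeries p
  T : StateSeries p
  Φ_zero : ∀ i, MvPowerSeries.constantCoeff (Φ i) = 0
  Φ_inv : (Matrix.of fun i j : Fin 2 =>
    MvPowerSeries.coeff (Finsupp.single (Sum.inl j) 1) (Φ i)).det ≠ 0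
  T_inv : MvPowerSeries.constantCoeff T ≠ 0

/-- The change `g` transforms the system `w` into the system `w'`, i.e.
`D_{(X,Y)}Φ(X, Y, μ) · w'(X, Y, μ) = T(X, Y, μ) · w(Φ(X, Y, μ), μ)`. -/
def StateTimeChange.Carries {p : ℕ} (g : StateTimeChange p) (w w' : PVectorField p) : Prop :=
  ∀ i, ∑ j, MvPowerSeries.pderiv ℝ (Sum.inl j) (g.Φ i) * w' j =
    g.T * MvPowerSeries.subst
      (Sum.elim g.Φ (fun l => MvPowerSeries.X (Sum.inr l)) : Fin 2 ⊕ Fin p → StateSeries p) (w i)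

/-- An invertible (formal) reparametrization `μ = ψ(ν)`. -/
structure Reparametrization (p : ℕ) where
  ψ : Fin p → ParamSeries p
  ψ_zero : ∀ i, MvPowerSeries.constantCoeff (ψ i) = 0
  ψ_inv : (Matrix.of fun i j : Fin p =>
    MvPowerSeries.coeff (Finsupp.single j 1) (ψ i)).det ≠ 0

/-- The family `w(x, y, ψ(ν))`. -/
def Reparametrization.apply {p : ℕ} (ρ : Reparametrization p) (w : PVectorField p) :
    PVectorField p := fun i =>
  MvPowerSeries.subst
    (Sum.elim (fun j => MvPowerSeries.X (Sum.inl j)) (fun l => ofParam (ρ.ψ l)) :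
      Fin 2 ⊕ Fin p → StateSeries p) (w i)

/-- Equality of the truncations at degree `N` in the state variables. -/
def TruncEq {p : ℕ} (N : ℕ) (w w' : PVectorField p) : Prop :=
  ∀ i (m : Fin 2 ⊕ Fin p →₀ ℕ), m (Sum.inl 0) + m (Sum.inl 1) ≤ N →
    MvPowerSeries.coeff m (w i) = MvPowerSeries.coeff m (w' i)

/-- `w` can be transformed, by invertible parametric changes of state variables and time rescaling,
into a system whose truncation at degree `N` in the state variables is that of `u`. -/
def TransformsTo {p : ℕ} (N : ℕ) (w u : PVectorField p) : Prop :=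
  ∃ (g : StateTimeChange p) (w' : PVectorField p), g.Carries w w' ∧ TruncEq N w' u

/-- The series `∑ f k * y ^ k`. -/
def inY (f : ℕ → ℝ) : StateSeries 0 := fun m =>
  if m (Sum.inl 0) = 0 then f (m (Sum.inl 1)) else 0

/-- The classical normal form `-x ∂/∂y + ∑ a k y^(k+1) ∂/∂x + ∑ b k y^k (x ∂/∂x + y ∂/∂y)`. -/
def classicalForm (a b : ℕ → ℝ) : PVectorField 0 :=
  ![y 0 * inY a + x 0 * inY b, -x 0 + y 0 * inY b]

/-- The indices `k (s + 1) + 2 s` with `k ≥ 1`, `k ≠ s`. -/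
def IsResonant (s j : ℕ) : Prop := ∃ k, 1 ≤ k ∧ k ≠ s ∧ j = k * (s + 1) + 2 * s

/-- The coefficients of a classical normal form with first Eulerian term `B^0_s` which is updated
up to the index `m`: the terms `B^0_{r-s}` (other than `B^0_s`) with `r ≤ m`, and the terms
`A^{-1}_r` with `r ≤ m` resonant, have been eliminated. -/
def IsUpdated (s m : ℕ) (a b : ℕ → ℝ) : Prop :=
  b s ≠ 0 ∧ (∀ k, k ≠ s → k + s ≤ m → b k = 0) ∧ ∀ k, k ≤ m → IsResonant s k → a k = 0

/-- `v` is a generalized saddle-node case with (updated) indices `s` and `r₁`: it is orbitally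
equivalent to a classical normal form, updated up to `r₁`, whose first Hamiltonian term (after
`A^1_0`) is `A^{-1}_{r₁}`, where `2 s < r₁`. -/
def IsGeneralizedSaddleNode (s r₁ : ℕ) (v : PVectorField 0) : Prop :=
  1 ≤ s ∧ 2 * s < r₁ ∧ ∃ (g : StateTimeChange 0) (a b : ℕ → ℝ),
    g.Carries v (classicalForm a b) ∧ IsUpdated s r₁ a b ∧
      (∀ k, k < r₁ → a k = 0) ∧ a r₁ ≠ 0

/-- As `IsGeneralizedSaddleNode`, where moreover `A^{-1}_{r₂}` is the next nonzero Hamiltonian term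
after `A^{-1}_{r₁}`, the classical normal form being updated up to `r₂`. -/
def IsGeneralizedSaddleNode₂ (s r₁ r₂ : ℕ) (v : PVectorField 0) : Prop :=
  1 ≤ s ∧ 2 * s < r₁ ∧ r₁ < r₂ ∧ ∃ (g : StateTimeChange 0) (a b : ℕ → ℝ),
    g.Carries v (classicalForm a b) ∧ IsUpdated s r₂ a b ∧
      (∀ k, k < r₂ → k ≠ r₁ → a k = 0) ∧ a r₁ ≠ 0 ∧ a r₂ ≠ 0

/-- `v` is a generalized saddle-node case with indices `s`, `r₁`, and `e` is the extra eliminated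
index: `e = r₁ + s² + s` if `r₁ ≠ s (s + 1) + 2 s`, and `e = r₂ + s² + s` if
`r₁ = s (s + 1) + 2 s` and `r₂ < 2 s² + 4 s`. -/
def HasIndices (s r₁ e : ℕ) (v : PVectorField 0) : Prop :=
  (r₁ ≠ s * (s + 1) + 2 * s ∧ IsGeneralizedSaddleNode s r₁ v ∧ e = r₁ + s ^ 2 + s) ∨
  (r₁ = s * (s + 1) + 2 * s ∧ ∃ r₂, r₂ < 2 * s ^ 2 + 4 * s ∧
    IsGeneralizedSaddleNode₂ s r₁ r₂ v ∧ e = r₂ + s ^ 2 + s)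

open Classical in
/-- The set `{j₁ < j₂ < ⋯ < jₙ}` of all `1 ≤ j < N` with `j ≠ e` and `j ≠ k (s + 1) + 2 s` for
all `k ≥ 1`, `k ≠ s`. -/
def unfoldingIndices (s e N : ℕ) : Finset ℕ :=
  (Finset.Ico 1 N).filter fun j => j ≠ e ∧ ¬ IsResonant s j

/-- `A^1_0 + ∑_{k=0}^{s-2} b_k(μ) B^0_k + B^0_s + a_{-1}(μ) A^{-1}_{-1} + a_0(μ) A^{-1}_0
+ ∑_{j ∈ J} a_j(μ) A^{-1}_j`. -/
def levelForm {p : ℕ} (s : ℕ) (J : Finset ℕ) (a : ℤ → ParamSeries p) (b : ℕ → ParamSeries p) :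
    PVectorField p :=
  hamTerm p 1 0 + ∑ k ∈ Finset.range (s - 1), ofParam (b k) • eulerTerm p 0 k + eulerTerm p 0 s +
    ofParam (a (-1)) • hamTerm p (-1) (-1) + ofParam (a 0) • hamTerm p (-1) 0 +
    ∑ j ∈ J, ofParam (a j) • hamTerm p (-1) j

/-- `u` is a truncated `(r₁ - s + 1)`-th level parametric normal form with unfolding indices `J`. -/
def IsLevelForm {p : ℕ} (s r₁ : ℕ) (J : Finset ℕ) (u : PVectorField p) : Prop :=
  ∃ (a : ℤ → ParamSeries p) (b : ℕ → ParamSeries p),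
    u = levelForm s J a b ∧
    (∀ k < s - 1, MvPowerSeries.constantCoeff (b k) = 0) ∧
    (∀ j : ℤ, -1 ≤ j → j < r₁ → MvPowerSeries.constantCoeff (a j) = 0) ∧
    MvPowerSeries.constantCoeff (a r₁) ≠ 0

/-- The rank of `∂u/∂μ` at `μ = 0`: the dimension of the span of the vector fields
`∂u/∂μ_l |_{μ = 0}`, `1 ≤ l ≤ p`. -/
def paramRank {p : ℕ} (u : PVectorField p) : ℕ :=
  Module.finrank ℝ (Submodule.span ℝ (Set.range fun l : Fin p =>
    (fun i => atZero (MvPowerSeries.pderiv ℝ (Sum.inr l) (u i)) : PVectorField 0)))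

/-- `w` is a non-degenerate perturbation: it has an `N`-degree truncated parametric normal form `u`
with `rank (∂u/∂μ |_{μ = 0}) = n + s + 1`, where `n = #J`. -/
def IsNonDegenerate {p : ℕ} (s r₁ N : ℕ) (J : Finset ℕ) (w : PVectorField p) : Prop :=
  ∃ u, IsLevelForm s r₁ J u ∧ TransformsTo N w u ∧ paramRank u = J.card + s + 1

/-- The truncated parametric normal form
`ẋ = μ_s + μ_{s+1} y + ∑_{i=1}^n (α_{j_i} + μ_{i+s+1}) y^{j_i+1} + x y^s + ∑_{k=0}^{s-2} μ_{k+1} x y^k`,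
`ẏ = -x + y^{s+1} + ∑_{k=0}^{s-2} μ_{k+1} y^{k+1}`,
where `J = {j₁ < ⋯ < jₙ}` (in the code `i` is numbered from `0`). -/
def parametricNormalForm (p s : ℕ) (J : Finset ℕ) (α : ℕ → ℝ) : PVectorField p :=
  ![par p s + par p (s + 1) * y p +
      ∑ i : Fin J.card, (const p (α (J.orderEmbOfFin rfl i)) + par p ((i + 1) + s + 1)) *
        y p ^ (J.orderEmbOfFin rfl i + 1) +
      x p * y p ^ s + ∑ k ∈ Finset.range (s - 1), par p (k + 1) * x p * y p ^ k,
    -x p + y p ^ (s + 1) + ∑ k ∈ Finset.range (s - 1), par p (k + 1) * y p ^ (k + 1)]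

/-- The Hamiltonian part of the parametric normal form. -/
def hamPart (p s : ℕ) (J : Finset ℕ) (α : ℕ → ℝ) : PVectorField p :=
  hamTerm p 1 0 + par p s • hamTerm p (-1) (-1) + par p (s + 1) • hamTerm p (-1) 0 +
    ∑ i : Fin J.card, (const p (α (J.orderEmbOfFin rfl i)) + par p ((i + 1) + s + 1)) •
      hamTerm p (-1) (J.orderEmbOfFin rfl i : ℕ)

/-- The Eulerian part of the parametric normal form. -/
def eulerPart (p s : ℕ) : PVectorField p :=
  eulerTerm p 0 s + ∑ k ∈ Finset.range (s - 1), par p (k + 1) • eulerTerm p 0 k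

end PNF

end

/-! Give `x` weight `s + 1`, `y` weight 1 and every parameter a large weight `W`. With `E = x ∂/∂x +
y ∂/∂y`, the leading field `-x ∂/∂y + y^s E` is quasi-homogeneous of degree `s`, and the normal form
is built degree by degree in this grading. A change `(Φ, T)` carries `w` to `w'` when `defect`
vanishes. The linearization of `defect` at the identity is `linDefect`, and `exists_normalField`
solves the nonlinear equation by successive approximation as soon as the linear one is solvable up
to higher order.

For the leading field the linear problem is explicit. The `ẏ` component can always be absorbed, so
only series `P` in `P ∂/∂x` matter, modulo the relations coming from time rescalings, Eulerian
changes and translations in `y`. These reduce every monomial to a power of `y`, or to `x y^b` with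
`b ≤ s - 2`. In the weight of `y^(k(s+1)+2s+1)`, `k ≥ 1`, the chain of relations closes up with one
more relation, and even the power of `y` disappears (`resonant_mem_leadImage`). The extra relation
carries the factor `k - s`, so it fails at `k = s`. This failure is the trace of a symmetry: `x^s E`
commutes with the leading field.

The symmetry produces the last elimination. Its bracket with the first Hamiltonian term `A^{-1}_r`
that matters is, modulo the image of the linear problem, a nonzero multiple of `A^{-1}_{r+s²+s}`
(`source_mem_leadImage`). If `r₁ = s(s+1)+2s`, that index is `2s²+4s`, which is resonant, so the
effect of `A^{-1}_{r₁}` can be cancelled and the next term `A^{-1}_{r₂}` decides. `NearSymmetry`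
records the symmetry together with its corrections.

Using the symmetry costs `r - 2s` orders at each step, so the iteration must start at a sufficiently
high order. The term at `μ = 0` is therefore removed first, by the exact flow of `x^s E`
(`exists_flow`, `exists_carries_extra`). What is left of the coefficient vanishes at `μ = 0` and has
weight at least `W`, high enough for the iteration with loss (`exists_carries_final`).

The unfolding is an inverse function argument. Non-degeneracy says that the linear parts, in the
parameters, of the normal form coefficients are independent. The formal inverse function theorem
`exists_subst_eq_X` then turns these coefficients, minus their constant terms, into coordinates. -/

open MvPowerSeries

namespace PNF

/-! ### The filtration of power series by weighted order. -/

section Order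

variable {σ τ : Type*}

/-- The ideal of power series all of whose monomials have weight at least `n`. -/
def ordIdeal (w : σ → ℕ) (n : ℕ) : Ideal (MvPowerSeries σ ℝ) where
  carrier := {f | (n : ℕ∞) ≤ f.weightedOrder w}
  zero_mem' := by simp
  add_mem' {f g} hf hg := (le_min hf hg).trans (min_weightedOrder_le_add w)
  smul_mem' c f hf := by
    refine le_trans ?_ (le_weightedOrder_mul w)
    exact le_add_left hf

theorem mem_ordIdeal {w : σ → ℕ} {n : ℕ} {f : MvPowerSeries σ ℝ} :
    f ∈ ordIdeal w n ↔ ∀ d, Finsupp.weight w d < n → coeff d f = 0 := by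
  constructor
  · intro h d hd
    exact coeff_eq_zero_of_lt_weightedOrder w (lt_of_lt_of_le (by exact_mod_cast hd) h)
  · intro h
    exact nat_le_weightedOrder w h

theorem ordIdeal_anti {w : σ → ℕ} {m n : ℕ} (h : m ≤ n) {f : MvPowerSeries σ ℝ}
    (hf : f ∈ ordIdeal w n) : f ∈ ordIdeal w m :=
  mem_ordIdeal.2 fun d hd => mem_ordIdeal.1 hf d (hd.trans_le h)

theorem mem_ordIdeal_zero {w : σ → ℕ} (f : MvPowerSeries σ ℝ) : f ∈ ordIdeal w 0 :=
  mem_ordIdeal.2 fun _ hd => absurd hd (Nat.not_lt_zero _)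

theorem mul_mem_ordIdeal {w : σ → ℕ} {m n : ℕ} {f g : MvPowerSeries σ ℝ}
    (hf : f ∈ ordIdeal w m) (hg : g ∈ ordIdeal w n) : f * g ∈ ordIdeal w (m + n) := by
  change ((m + n : ℕ) : ℕ∞) ≤ _
  push_cast
  exact (add_le_add hf hg).trans (le_weightedOrder_mul w)

theorem mul_mem_ordIdeal_of_le {w : σ → ℕ} {m n k : ℕ} {f g : MvPowerSeries σ ℝ}
    (hf : f ∈ ordIdeal w m) (hg : g ∈ ordIdeal w n) (h : k ≤ m + n) : f * g ∈ ordIdeal w k :=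
  ordIdeal_anti h (mul_mem_ordIdeal hf hg)

theorem pow_mem_ordIdeal {w : σ → ℕ} {m : ℕ} {f : MvPowerSeries σ ℝ}
    (hf : f ∈ ordIdeal w m) (k : ℕ) : f ^ k ∈ ordIdeal w (k * m) := by
  induction k with
  | zero => simpa using mem_ordIdeal_zero _
  | succ k ih =>
    rw [pow_succ]
    exact mul_mem_ordIdeal_of_le ih hf (by rw [Nat.succ_mul])

theorem X_mem_ordIdeal (w : σ → ℕ) (i : σ) :
    (X i : MvPowerSeries σ ℝ) ∈ ordIdeal w (w i) := by
  classical
  refine mem_ordIdeal.2 fun d hd => ?_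
  rw [coeff_X, if_neg]
  rintro rfl
  simp [Finsupp.weight_single] at hd

theorem eq_zero_of_mem_ordIdeal {w : σ → ℕ} {f : MvPowerSeries σ ℝ}
    (h : ∀ n, f ∈ ordIdeal w n) : f = 0 := by
  ext d
  exact mem_ordIdeal.1 (h (Finsupp.weight w d + 1)) d (Nat.lt_succ_self _)

theorem pderiv_mem_ordIdeal {w : σ → ℕ} {n m : ℕ} {f : MvPowerSeries σ ℝ} (i : σ)
    (hf : f ∈ ordIdeal w n) (h : m ≤ n - w i) : pderiv ℝ i f ∈ ordIdeal w m := by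
  refine mem_ordIdeal.2 fun d hd => ?_
  rw [coeff_pderiv, mem_ordIdeal.1 hf, zero_mul]
  rw [map_add, Finsupp.weight_single]
  simp only [one_smul]
  omega

theorem constantCoeff_eq_zero_of_mem {w : σ → ℕ} {f : MvPowerSeries σ ℝ}
    (hf : f ∈ ordIdeal w 1) : constantCoeff f = 0 := by
  rw [← coeff_zero_eq_constantCoeff_apply]
  exact mem_ordIdeal.1 hf 0 (by simp)

theorem mem_ordIdeal_one_of_constantCoeff {w : σ → ℕ} (hw : ∀ i, w i ≠ 0)
    {f : MvPowerSeries σ ℝ} (hf : constantCoeff f = 0) : f ∈ ordIdeal w 1 := by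
  refine mem_ordIdeal.2 fun d hd => ?_
  have : d = 0 := by
    ext i
    by_contra hi
    have := Finsupp.le_weight w (s := i) (hw i) d
    simp only [Finsupp.coe_zero, Pi.zero_apply] at hi
    omega
  rw [this, coeff_zero_eq_constantCoeff_apply, hf]

/-- Weighted truncation: a series is a finite sum of monomials up to high order. -/
theorem exists_sum_monomial_sub_mem [Finite σ] {w : σ → ℕ} (hw : ∀ i, w i ≠ 0)
    (f : MvPowerSeries σ ℝ) (n : ℕ) :
    ∃ S : Finset (σ →₀ ℕ), (∀ d ∈ S, Finsupp.weight w d < n) ∧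
      f - ∑ d ∈ S, monomial d (coeff d f) ∈ ordIdeal w n := by
  classical
  have hfin := Finsupp.finite_of_nat_weight_lt w hw n
  refine ⟨hfin.toFinset, fun d hd => by simpa using hd, mem_ordIdeal.2 fun e he => ?_⟩
  rw [map_sub, map_sum, Finset.sum_eq_single e]
  · simp
  · intro d _ hde
    rw [coeff_monomial_ne hde.symm]
  · intro h
    exact absurd (by simpa using he) h

end Order

/-! ### Substitution and the weighted order; the chain rule. -/

section Subst

variable {σ τ : Type*}

theorem finsuppProd_mem_ordIdeal {w : σ → ℕ} {w' : τ → ℕ} {a : σ → MvPowerSeries τ ℝ}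
    (ha : ∀ i, a i ∈ ordIdeal w' (w i)) (d : σ →₀ ℕ) :
    (d.prod fun i k => a i ^ k) ∈ ordIdeal w' (Finsupp.weight w d) := by
  induction d using Finsupp.induction with
  | zero => simpa using mem_ordIdeal_zero _
  | single_add i k d hi hk ih =>
    rw [Finsupp.prod_add_index_of_disjoint]
    · rw [Finsupp.prod_single_index (by simp), map_add, Finsupp.weight_single]
      exact mul_mem_ordIdeal (by simpa using pow_mem_ordIdeal (ha i) k) ih
    · rw [Finset.disjoint_left]
      intro j hj hj'
      have := Finsupp.support_single_subset hj
      simp only [Finset.mem_singleton] at this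
      exact hi (this ▸ hj')

/-- A monomial of `f` is either too light, and then has coefficient zero, or is sent to a product at
least as heavy as itself. -/
theorem subst_mem_ordIdeal {w : σ → ℕ} {w' : τ → ℕ} {a : σ → MvPowerSeries τ ℝ}
    (hs : HasSubst a) (ha : ∀ i, a i ∈ ordIdeal w' (w i)) {f : MvPowerSeries σ ℝ} {n : ℕ}
    (hf : f ∈ ordIdeal w n) : subst a f ∈ ordIdeal w' n := by
  refine mem_ordIdeal.2 fun e he => ?_
  rw [coeff_subst hs]
  refine finsum_eq_zero_of_forall_eq_zero fun d => ?_
  by_cases hd : Finsupp.weight w d < n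
  · rw [mem_ordIdeal.1 hf d hd, zero_smul]
  · rw [mem_ordIdeal.1 (finsuppProd_mem_ordIdeal ha d) e (by omega), smul_zero]

/-- Here `k` is the relative precision of the approximation. Products preserve it, and this is what
makes substitution Lipschitz. -/
theorem mul_sub_mul_mem {w : τ → ℕ} {m n k : ℕ} {f f' g g' : MvPowerSeries τ ℝ}
    (hf : f ∈ ordIdeal w m) (hff : f - f' ∈ ordIdeal w (m + k))
    (hg' : g' ∈ ordIdeal w n) (hgg : g - g' ∈ ordIdeal w (n + k)) :
    f * g - f' * g' ∈ ordIdeal w (m + n + k) := by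
  have : f * g - f' * g' = f * (g - g') + (f - f') * g' := by ring
  rw [this]
  exact add_mem (mul_mem_ordIdeal_of_le hf hgg (by omega))
    (mul_mem_ordIdeal_of_le hff hg' (by omega))

theorem pow_sub_pow_mem {w : τ → ℕ} {m k : ℕ} {f f' : MvPowerSeries τ ℝ}
    (hf : f ∈ ordIdeal w m) (hf' : f' ∈ ordIdeal w m) (hff : f - f' ∈ ordIdeal w (m + k))
    (r : ℕ) : f ^ r - f' ^ r ∈ ordIdeal w (r * m + k) := by
  induction r with
  | zero => simp
  | succ r ih =>
    rw [pow_succ, pow_succ, Nat.succ_mul]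
    exact mul_sub_mul_mem (pow_mem_ordIdeal hf r) ih hf' hff

theorem finsuppProd_sub_mem_ordIdeal {w : σ → ℕ} {w' : τ → ℕ} {a b : σ → MvPowerSeries τ ℝ}
    (ha : ∀ i, a i ∈ ordIdeal w' (w i)) (hb : ∀ i, b i ∈ ordIdeal w' (w i)) {k : ℕ}
    (hab : ∀ i, a i - b i ∈ ordIdeal w' (w i + k)) (d : σ →₀ ℕ) :
    (d.prod fun i k => a i ^ k) - (d.prod fun i k => b i ^ k) ∈
      ordIdeal w' (Finsupp.weight w d + k) := by
  induction d using Finsupp.induction with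
  | zero => simp
  | single_add i r d hi hr ih =>
    have hdis : Disjoint (Finsupp.single i r).support d.support := by
      rw [Finset.disjoint_left]
      intro j hj hj'
      have := Finsupp.support_single_subset hj
      simp only [Finset.mem_singleton] at this
      exact hi (this ▸ hj')
    rw [Finsupp.prod_add_index_of_disjoint hdis, Finsupp.prod_add_index_of_disjoint hdis,
      Finsupp.prod_single_index (by simp), Finsupp.prod_single_index (by simp), map_add,
      Finsupp.weight_single]
    exact mul_sub_mul_mem (by simpa using pow_mem_ordIdeal (ha i) r)
      (by simpa using pow_sub_pow_mem (ha i) (hb i) (hab i) r) (finsuppProd_mem_ordIdeal hb d) ih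

/-- Substitution is Lipschitz for the weighted order. -/
theorem subst_sub_subst_mem {w : σ → ℕ} {w' : τ → ℕ} {a b : σ → MvPowerSeries τ ℝ}
    (hsa : HasSubst a) (hsb : HasSubst b)
    (ha : ∀ i, a i ∈ ordIdeal w' (w i)) (hb : ∀ i, b i ∈ ordIdeal w' (w i)) {k : ℕ}
    (hab : ∀ i, a i - b i ∈ ordIdeal w' (w i + k)) {f : MvPowerSeries σ ℝ} {n : ℕ}
    (hf : f ∈ ordIdeal w n) : subst a f - subst b f ∈ ordIdeal w' (n + k) := by
  refine mem_ordIdeal.2 fun e he => ?_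
  rw [map_sub, coeff_subst hsa, coeff_subst hsb,
    ← finsum_sub_distrib (coeff_subst_finite hsa f e) (coeff_subst_finite hsb f e)]
  refine finsum_eq_zero_of_forall_eq_zero fun d => ?_
  rw [← smul_sub, ← map_sub]
  by_cases hd : Finsupp.weight w d < n
  · rw [mem_ordIdeal.1 hf d hd, zero_smul]
  · rw [mem_ordIdeal.1 (finsuppProd_sub_mem_ordIdeal ha hb hab d) e (by omega), smul_zero]

theorem subst_C_real {a : σ → MvPowerSeries τ ℝ} (ha : HasSubst a) (c : ℝ) :
    subst a (C c : MvPowerSeries σ ℝ) = C c := by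
  rw [← substAlgHom_apply ha]
  exact (substAlgHom ha).commutes c

theorem constantCoeff_subst_of_zero [Finite σ] {a : σ → MvPowerSeries τ ℝ}
    (ha : ∀ i, constantCoeff (a i) = 0) (f : MvPowerSeries σ ℝ) :
    constantCoeff (subst a f) = constantCoeff f := by
  have hs := hasSubst_of_constantCoeff_zero ha
  have h : constantCoeff (subst a (f - C (constantCoeff f))) = 0 :=
    constantCoeff_subst_eq_zero hs ha (by simp)
  rw [subst_sub hs, map_sub, subst_C_real hs] at h
  simpa [sub_eq_zero] using h

/-- The chain rule for formal power series. -/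
theorem pderiv_subst [Fintype σ] [Finite τ] {a : σ → MvPowerSeries τ ℝ}
    (ha : ∀ i, constantCoeff (a i) = 0) (i : τ) (f : MvPowerSeries σ ℝ) :
    pderiv ℝ i (subst a f) = ∑ j, pderiv ℝ i (a j) * subst a (pderiv ℝ j f) := by
  classical
  have hs := hasSubst_of_constantCoeff_zero ha
  have hmono : ∀ d : σ →₀ ℕ, ∀ c : ℝ, pderiv ℝ i (subst a (monomial d c)) =
      ∑ j, pderiv ℝ i (a j) * subst a (pderiv ℝ j (monomial d c)) := by
    intro d c
    -- Passing to polynomials makes induction over sums and products by a variable available.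
    suffices h : ∀ P : MvPolynomial σ ℝ, pderiv ℝ i (subst a (P : MvPowerSeries σ ℝ)) =
        ∑ j, pderiv ℝ i (a j) * subst a (pderiv ℝ j (P : MvPowerSeries σ ℝ)) by
      simpa using h (MvPolynomial.monomial d c)
    intro P
    induction P using MvPolynomial.induction_on with
    | C c =>
      have h0 : subst a (0 : MvPowerSeries σ ℝ) = 0 := by
        rw [← substAlgHom_apply hs, map_zero]
      simp [subst_C_real hs, h0]
    | add P Q hP hQ =>
      simp only [MvPolynomial.coe_add, subst_add hs, map_add, hP, hQ, mul_add,
        Finset.sum_add_distrib]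
    | mul_X P k hP =>
      simp only [MvPolynomial.coe_mul, MvPolynomial.coe_X, subst_mul hs, subst_X hs,
        Derivation.leibniz, smul_eq_mul, hP, subst_add hs, mul_add, Finset.sum_add_distrib,
        Finset.mul_sum]
      congr 1
      · rw [Finset.sum_eq_single k]
        · rw [pderiv_X_self, ← coe_substAlgHom hs, map_one]; ring
        · intro j _ hj
          rw [pderiv_X_of_ne hj.symm, ← coe_substAlgHom hs, map_zero]; ring
        · simp
      · exact Finset.sum_congr rfl fun j _ => by ring
  have hord : ∀ j, a j ∈ ordIdeal (fun _ : τ => 1) ((fun _ : σ => 1) j) := fun j =>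
    mem_ordIdeal_one_of_constantCoeff (by simp) (ha j)
  rw [← sub_eq_zero]
  refine eq_zero_of_mem_ordIdeal (w := fun _ : τ => 1) fun n => ?_
  -- Truncation is at `n + 1` because a partial derivative loses one order.
  obtain ⟨S, -, hS⟩ := exists_sum_monomial_sub_mem (w := fun _ : σ => 1) (by simp) f (n + 1)
  set t := ∑ d ∈ S, monomial d (coeff d f) with ht
  have htl : pderiv ℝ i (subst a t) = ∑ j, pderiv ℝ i (a j) * subst a (pderiv ℝ j t) := by
    rw [ht]
    simp only [← coe_substAlgHom hs, map_sum, Finset.mul_sum] at hmono ⊢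
    rw [Finset.sum_comm]
    exact Finset.sum_congr rfl fun d _ => hmono d _
  have key : pderiv ℝ i (subst a f) - ∑ j, pderiv ℝ i (a j) * subst a (pderiv ℝ j f) =
      pderiv ℝ i (subst a (f - t)) - ∑ j, pderiv ℝ i (a j) * subst a (pderiv ℝ j (f - t)) := by
    simp only [subst_sub hs, map_sub, mul_sub, Finset.sum_sub_distrib, htl]
    ring
  rw [key]
  refine sub_mem (pderiv_mem_ordIdeal i (subst_mem_ordIdeal hs hord hS) (by simp))
    (sum_mem fun j _ => Ideal.mul_mem_left _ _ (subst_mem_ordIdeal hs hord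
      (pderiv_mem_ordIdeal j hS (by simp))))

end Subst

end PNF

namespace PNF

/-! ### First order Taylor expansion with a graded error. -/

section Taylor

variable {σ : Type*}

/-- A vector field of degree `k` raises the order by `k`. If `n < w i`, the derivative loses only
`n` orders and the bound still holds. -/
theorem mul_pderiv_mem_ordIdeal {w : σ → ℕ} {k n : ℕ} {Y f : MvPowerSeries σ ℝ} {i : σ}
    (hY : Y ∈ ordIdeal w (w i + k)) (hf : f ∈ ordIdeal w n) :
    Y * pderiv ℝ i f ∈ ordIdeal w (n + k) :=
  mul_mem_ordIdeal_of_le hY (pderiv_mem_ordIdeal i hf le_rfl) (by omega)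

/-- First order Taylor expansion of a substitution close to the identity. -/
theorem taylor_mem_ordIdeal [Fintype σ] {w : σ → ℕ} (hw : ∀ i, w i ≠ 0)
    {a Y : σ → MvPowerSeries σ ℝ} {j k : ℕ} (hjk : j ≤ k)
    (ha : ∀ i, a i - X i ∈ ordIdeal w (w i + j)) (hY : ∀ i, Y i ∈ ordIdeal w (w i + k))
    {f : MvPowerSeries σ ℝ} {n : ℕ} (hf : f ∈ ordIdeal w n) :
    subst (a + Y) f - subst a f - ∑ i, Y i * pderiv ℝ i f ∈ ordIdeal w (n + k + j) := by
  classical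
  have hX : ∀ i, (X i : MvPowerSeries σ ℝ) ∈ ordIdeal w (w i) := X_mem_ordIdeal w
  have ha0 : ∀ i, a i ∈ ordIdeal w (w i) := fun i => by
    have := add_mem (ordIdeal_anti (Nat.le_add_right _ _) (ha i)) (hX i)
    simpa using this
  have haY : ∀ i, (a + Y) i ∈ ordIdeal w (w i) := fun i =>
    add_mem (ha0 i) (ordIdeal_anti (Nat.le_add_right _ _) (hY i))
  have haYX : ∀ i, (a + Y) i - X i ∈ ordIdeal w (w i + j) := fun i => by
    have := add_mem (ha i) (ordIdeal_anti (by omega) (hY i) : Y i ∈ ordIdeal w (w i + j))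
    rwa [sub_add_eq_add_sub] at this
  have hsa : HasSubst a := hasSubst_of_constantCoeff_zero fun i =>
    constantCoeff_eq_zero_of_mem (ordIdeal_anti (Nat.one_le_iff_ne_zero.2 (hw i)) (ha0 i))
  have hsb : HasSubst (a + Y) := hasSubst_of_constantCoeff_zero fun i =>
    constantCoeff_eq_zero_of_mem (ordIdeal_anti (Nat.one_le_iff_ne_zero.2 (hw i)) (haY i))
  have hself : ∀ f : MvPowerSeries σ ℝ, subst (X : σ → MvPowerSeries σ ℝ) f = f := fun f => by
    rw [subst_self]; rfl
  have hD : ∀ {f : MvPowerSeries σ ℝ} {n : ℕ}, f ∈ ordIdeal w n →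
      ∑ i, Y i * pderiv ℝ i f ∈ ordIdeal w (n + k) := fun hf =>
    sum_mem fun i _ => mul_pderiv_mem_ordIdeal (hY i) hf
  have hmul : ∀ {f g : MvPowerSeries σ ℝ} {m n : ℕ}, f ∈ ordIdeal w m → g ∈ ordIdeal w n →
      subst (a + Y) f - subst a f - ∑ i, Y i * pderiv ℝ i f ∈ ordIdeal w (m + k + j) →
      subst (a + Y) g - subst a g - ∑ i, Y i * pderiv ℝ i g ∈ ordIdeal w (n + k + j) →
      subst (a + Y) (f * g) - subst a (f * g) - ∑ i, Y i * pderiv ℝ i (f * g) ∈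
        ordIdeal w (m + n + k + j) := by
    intro f g m n hf hg h1 h2
    have hfb : subst (a + Y) f - f ∈ ordIdeal w (m + j) := by
      have := subst_sub_subst_mem hsb HasSubst.X haY hX haYX hf
      rwa [hself] at this
    have hga : subst a g - g ∈ ordIdeal w (n + j) := by
      have := subst_sub_subst_mem hsa HasSubst.X ha0 hX ha hg
      rwa [hself] at this
    have e : ∑ i, Y i * pderiv ℝ i (f * g) =
        f * (∑ i, Y i * pderiv ℝ i g) + g * ∑ i, Y i * pderiv ℝ i f := by
      simp only [Derivation.leibniz, smul_eq_mul, mul_add, Finset.sum_add_distrib, Finset.mul_sum]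
      congr 1 <;> exact Finset.sum_congr rfl fun i _ => by ring
    -- Each summand is either a Taylor error of one factor, or a derivative along `Y` (gain `k`)
    -- times a deviation of a substitution from the identity (gain `j`).
    have e2 : subst (a + Y) (f * g) - subst a (f * g) - ∑ i, Y i * pderiv ℝ i (f * g) =
        subst (a + Y) f * (subst (a + Y) g - subst a g - ∑ i, Y i * pderiv ℝ i g) +
        (subst (a + Y) f - f) * (∑ i, Y i * pderiv ℝ i g) +
        subst a g * (subst (a + Y) f - subst a f - ∑ i, Y i * pderiv ℝ i f) +
        (subst a g - g) * ∑ i, Y i * pderiv ℝ i f := by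
      rw [e, subst_mul hsa, subst_mul hsb]; ring
    rw [e2]
    refine add_mem (add_mem (add_mem ?_ ?_) ?_) ?_
    · exact mul_mem_ordIdeal_of_le (subst_mem_ordIdeal hsb haY hf) h2 (by omega)
    · exact mul_mem_ordIdeal_of_le hfb (hD hg) (by omega)
    · exact mul_mem_ordIdeal_of_le (subst_mem_ordIdeal hsa ha0 hg) h1 (by omega)
    · exact mul_mem_ordIdeal_of_le hga (hD hf) (by omega)
  have hC : ∀ c : ℝ, subst (a + Y) (C c) - subst a (C c) - ∑ i, Y i * pderiv ℝ i (C c) = 0 := by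
    intro c
    simp [subst_C_real hsa, subst_C_real hsb]
  have hXi : ∀ l : σ, subst (a + Y) (X l : MvPowerSeries σ ℝ) - subst a (X l : MvPowerSeries σ ℝ) -
      ∑ i, Y i * pderiv ℝ i (X l) = 0 := by
    intro l
    rw [subst_X hsa, subst_X hsb, Finset.sum_eq_single l]
    · simp
    · intro i _ hi
      rw [pderiv_X_of_ne hi.symm, mul_zero]
    · simp
  have hmono : ∀ (d : σ →₀ ℕ) (c : ℝ), (monomial d c : MvPowerSeries σ ℝ) ∈
      ordIdeal w (Finsupp.weight w d) ∧
      subst (a + Y) (monomial d c) - subst a (monomial d c) -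
        ∑ i, Y i * pderiv ℝ i (monomial d c) ∈ ordIdeal w (Finsupp.weight w d + k + j) := by
    intro d c
    induction d using Finsupp.induction_linear generalizing c with
    | zero =>
      rw [monomial_zero_eq_C_apply, hC]
      exact ⟨by simpa using mem_ordIdeal_zero _, zero_mem _⟩
    | add d e hd he =>
      have := monomial_mul_monomial d e c (1 : ℝ)
      rw [mul_one] at this
      rw [← this, map_add]
      exact ⟨mul_mem_ordIdeal (hd c).1 (he 1).1, hmul (hd c).1 (he 1).1 (hd c).2 (he 1).2⟩
    | single l r =>
      induction r generalizing c with
      | zero =>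
        rw [Finsupp.single_zero, monomial_zero_eq_C_apply, hC]
        exact ⟨by simpa using mem_ordIdeal_zero _, zero_mem _⟩
      | succ r ih =>
        have := monomial_mul_monomial (Finsupp.single l r) (Finsupp.single l 1) c (1 : ℝ)
        rw [mul_one] at this
        rw [Finsupp.single_add, ← this, map_add]
        have h1 : (monomial (Finsupp.single l 1) (1 : ℝ) : MvPowerSeries σ ℝ) = X l := rfl
        have hw1 : Finsupp.weight w (Finsupp.single l 1) = w l := by
          simp [Finsupp.weight_single]
        rw [h1, hw1]
        exact ⟨mul_mem_ordIdeal (ih c).1 (hX l), hmul (ih c).1 (hX l) (ih c).2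
          (by rw [hXi]; exact zero_mem _)⟩
  obtain ⟨S, -, hS⟩ := exists_sum_monomial_sub_mem hw f (n + k + j)
  set t := ∑ d ∈ S, monomial d (coeff d f) with ht
  have h1 : subst (a + Y) t - subst a t - ∑ i, Y i * pderiv ℝ i t ∈ ordIdeal w (n + k + j) := by
    have e : subst (a + Y) t - subst a t - ∑ i, Y i * pderiv ℝ i t = ∑ d ∈ S,
        (subst (a + Y) (monomial d (coeff d f)) - subst a (monomial d (coeff d f)) -
        ∑ i, Y i * pderiv ℝ i (monomial d (coeff d f))) := by
      simp only [ht, ← coe_substAlgHom hsa, ← coe_substAlgHom hsb, map_sum, Finset.mul_sum,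
        Finset.sum_sub_distrib]
      congr 1
      exact Finset.sum_comm
    rw [e]
    refine sum_mem fun d _ => ?_
    by_cases hd : Finsupp.weight w d < n
    · rw [mem_ordIdeal.1 hf d hd, map_zero, ← map_zero (C (σ := σ) (R := ℝ)), hC]
      exact zero_mem _
    · exact ordIdeal_anti (by omega) (hmono d _).2
  have h2 : subst (a + Y) (f - t) - subst a (f - t) - ∑ i, Y i * pderiv ℝ i (f - t) ∈
      ordIdeal w (n + k + j) :=
    sub_mem (sub_mem (subst_mem_ordIdeal hsb haY hS) (subst_mem_ordIdeal hsa ha0 hS))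
      (ordIdeal_anti (Nat.le_add_right _ _) (hD hS))
  have e : subst (a + Y) f - subst a f - ∑ i, Y i * pderiv ℝ i f =
      (subst (a + Y) t - subst a t - ∑ i, Y i * pderiv ℝ i t) +
      (subst (a + Y) (f - t) - subst a (f - t) - ∑ i, Y i * pderiv ℝ i (f - t)) := by
    simp only [subst_sub hsa, subst_sub hsb, map_sub, mul_sub, Finset.sum_sub_distrib]
    ring
  rw [e]
  exact add_mem h1 h2

end Taylor

/-! ### Limits and successive approximation. -/

section Newton

/-- Coefficientwise limits of sequences of power series. -/
theorem exists_limit {σ : Type*} {w : σ → ℕ} {l : ℕ} {φ : ℕ → ℕ} (hφm : Monotone φ)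
    (hφ : ∀ k, k ≤ φ k + l) (u : ℕ → MvPowerSeries σ ℝ)
    (hu : ∀ k, u (k + 1) - u k ∈ ordIdeal w (φ k)) :
    ∃ v : MvPowerSeries σ ℝ, (∀ k, v - u k ∈ ordIdeal w (φ k)) ∧
      ∀ d, (∀ k, coeff d (u (k + 1) - u k) = 0) → ∀ k, coeff d (v - u k) = 0 := by
  have hstab : ∀ k m, k ≤ m → u m - u k ∈ ordIdeal w (φ k) := by
    intro k m hkm
    induction m, hkm using Nat.le_induction with
    | base => simp
    | succ m hm ih =>
      have := add_mem (ordIdeal_anti (hφm hm) (hu m)) ih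
      simpa using this
  -- By this stage the coefficient at `d` has stopped changing, because `k ≤ φ k + l`.
  let v : MvPowerSeries σ ℝ := fun d => coeff d (u (Finsupp.weight w d + l + 1))
  have hv : ∀ d, coeff d v = coeff d (u (Finsupp.weight w d + l + 1)) := fun d => rfl
  refine ⟨v, fun k => mem_ordIdeal.2 fun d hd => ?_, fun d hd k => ?_⟩
  · rw [map_sub, hv, ← map_sub]
    rcases le_total k (Finsupp.weight w d + l + 1) with h | h
    · exact mem_ordIdeal.1 (hstab _ _ h) d hd
    · have := mem_ordIdeal.1 (hstab _ _ h) d (by have := hφ (Finsupp.weight w d + l + 1); omega)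
      rw [← neg_sub, map_neg, this, neg_zero]
  · have hc : ∀ m, coeff d (u m) = coeff d (u 0) := by
      intro m
      induction m with
      | zero => rfl
      | succ m ih =>
        rw [← ih, ← sub_eq_zero, ← map_sub, hd]
    rw [map_sub, hv, hc, hc k, sub_self]

/-- Successive approximation in a complete filtered group. -/
theorem exists_zero_of_step {U V : Type*} [AddCommGroup U] [AddCommGroup V]
    (FU : ℕ → AddSubgroup U) (FV GV : ℕ → AddSubgroup V) (F : U → V) (u₀ : U) (M : ℕ)
    (hU : Antitone FU)
    (hcomplete : ∀ u : ℕ → U, (∀ k, u (k + 1) - u k ∈ FU k) → ∃ v, ∀ k, v - u k ∈ FU k)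
    (hFG : ∀ k, FV k ≤ GV k) (hG : ∀ v, (∀ k, M ≤ k → v ∈ GV k) → v = 0)
    (hF : ∀ u, u - u₀ ∈ FU M → ∀ k, M ≤ k → ∀ δ ∈ FU k, F (u + δ) - F u ∈ GV k)
    (hstep : ∀ u, u - u₀ ∈ FU M → ∀ k, M ≤ k → F u ∈ FV k → ∃ δ ∈ FU k, F (u + δ) ∈ FV (k + 1))
    (h₀ : F u₀ ∈ FV M) : ∃ u, u - u₀ ∈ FU M ∧ F u = 0 := by
  have next : ∀ (k : ℕ) (u : U), ∃ u', u - u₀ ∈ FU M → F u ∈ FV (M + k) →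
      u' - u ∈ FU (M + k) ∧ F u' ∈ FV (M + k + 1) := by
    intro k u
    by_cases h : u - u₀ ∈ FU M ∧ F u ∈ FV (M + k)
    · obtain ⟨δ, hδ, h'⟩ := hstep u h.1 (M + k) (Nat.le_add_right _ _) h.2
      exact ⟨u + δ, fun _ _ => ⟨by simpa using hδ, h'⟩⟩
    · exact ⟨u, fun h1 h2 => absurd ⟨h1, h2⟩ h⟩
  choose nx hnx using next
  let t : ℕ → U := fun k => Nat.rec u₀ (fun k u => nx k u) k
  have ht0 : t 0 = u₀ := rfl
  have hts : ∀ k, t (k + 1) = nx k (t k) := fun k => rfl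
  have ht : ∀ k, t k - u₀ ∈ FU M ∧ F (t k) ∈ FV (M + k) := by
    intro k
    induction k with
    | zero => simpa [ht0] using h₀
    | succ k ih =>
      obtain ⟨h1, h2⟩ := hnx k (t k) ih.1 ih.2
      refine ⟨?_, by rw [hts]; exact h2⟩
      have := add_mem (hU (Nat.le_add_right M k) h1) ih.1
      rwa [sub_add_sub_cancel, ← hts] at this
  -- The sequence rests at `u₀` up to index `M`, so that its index agrees with the index of the
  -- filtration.
  let u : ℕ → U := fun k => t (k - M)
  have hu : ∀ k, u (k + 1) - u k ∈ FU k := by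
    intro k
    change t (k + 1 - M) - t (k - M) ∈ FU k
    rcases lt_or_ge k M with h | h
    · rw [show k + 1 - M = 0 by omega, show k - M = 0 by omega, sub_self]
      exact zero_mem _
    · rw [show k + 1 - M = (k - M) + 1 by omega, hts]
      have := (hnx (k - M) _ (ht (k - M)).1 (ht (k - M)).2).1
      rwa [show M + (k - M) = k by omega] at this
  obtain ⟨v, hv⟩ := hcomplete u hu
  have huM : u M = u₀ := by
    change t (M - M) = u₀
    rw [Nat.sub_self, ht0]
  refine ⟨v, by simpa [huM] using hv M, hG _ fun k hk => ?_⟩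
  have h2 := hF (u k) (ht (k - M)).1 k hk (v - u k) (hv k)
  have h3 : F (u k) ∈ FV k := by
    have := (ht (k - M)).2
    rwa [show M + (k - M) = k by omega] at this
  have := add_mem h2 (hFG k h3)
  simpa using this

end Newton

end PNF

namespace PNF

/-! ### Graded vector fields, the conjugacy defect and its linearization. -/

noncomputable section Fields

variable {p : ℕ}

/-- The weights of the state variables and the parameters. -/
def stateWeight (p s W : ℕ) : Fin 2 ⊕ Fin p → ℕ := Sum.elim ![s + 1, 1] fun _ => W

theorem stateWeight_ne_zero {s W : ℕ} (hW : W ≠ 0) (i : Fin 2 ⊕ Fin p) :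
    stateWeight p s W i ≠ 0 := by
  rcases i with i | i
  · fin_cases i <;> simp [stateWeight]
  · simpa [stateWeight] using hW

/-- Power series of weighted order at least `n`. -/
abbrev serOrd (p s W n : ℕ) : Ideal (StateSeries p) := ordIdeal (stateWeight p s W) n

/-- Vector fields of weighted order at least `n`, as derivations. -/
def fieldOrd (p s W n : ℕ) : Submodule (StateSeries p) (PVectorField p) where
  carrier := {V | ∀ i, V i ∈ serOrd p s W (stateWeight p s W (Sum.inl i) + n)}
  zero_mem' _ := zero_mem _
  add_mem' hV hV' i := add_mem (hV i) (hV' i)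
  smul_mem' c _ hV i := Ideal.mul_mem_left _ c (hV i)

theorem fieldOrd_anti {s W m n : ℕ} (h : m ≤ n) {V : PVectorField p}
    (hV : V ∈ fieldOrd p s W n) : V ∈ fieldOrd p s W m :=
  fun i => ordIdeal_anti (by omega) (hV i)

theorem eq_zero_of_mem_fieldOrd {s W : ℕ} {V : PVectorField p}
    (h : ∀ n, V ∈ fieldOrd p s W n) : V = 0 := by
  funext i
  exact eq_zero_of_mem_ordIdeal (w := stateWeight p s W) fun n =>
    ordIdeal_anti (by omega) (h n i)

theorem smul_mem_fieldOrd {s W m n k : ℕ} {c : StateSeries p} {V : PVectorField p}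
    (hc : c ∈ serOrd p s W m) (hV : V ∈ fieldOrd p s W n) (h : k ≤ m + n) :
    c • V ∈ fieldOrd p s W k :=
  fun i => mul_mem_ordIdeal_of_le hc (hV i) (by omega)

/-- The derivative of the components of `A` along `B`. -/
def dirDeriv (A B : PVectorField p) : PVectorField p :=
  fun i => ∑ j, pderiv ℝ (Sum.inl j) (A i) * B j

theorem dirDeriv_mem {s W m n k : ℕ} {A B : PVectorField p} (hA : A ∈ fieldOrd p s W m)
    (hB : B ∈ fieldOrd p s W n) (h : k ≤ m + n) : dirDeriv A B ∈ fieldOrd p s W k := fun i =>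
  sum_mem fun j _ => mul_mem_ordIdeal_of_le (pderiv_mem_ordIdeal _ (hA i) le_rfl) (hB j) (by omega)

theorem dirDeriv_add_left (A A' B : PVectorField p) :
    dirDeriv (A + A') B = dirDeriv A B + dirDeriv A' B := by
  funext i; simp [dirDeriv, add_mul, Finset.sum_add_distrib]

theorem dirDeriv_add_right (A B B' : PVectorField p) :
    dirDeriv A (B + B') = dirDeriv A B + dirDeriv A B' := by
  funext i; simp [dirDeriv, mul_add, Finset.sum_add_distrib]

theorem dirDeriv_sub_left (A A' B : PVectorField p) :
    dirDeriv (A - A') B = dirDeriv A B - dirDeriv A' B := by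
  funext i; simp [dirDeriv, sub_mul, Finset.sum_sub_distrib]

theorem dirDeriv_sub_right (A B B' : PVectorField p) :
    dirDeriv A (B - B') = dirDeriv A B - dirDeriv A B' := by
  funext i; simp [dirDeriv, mul_sub, Finset.sum_sub_distrib]

/-- The identity change of state variables. -/
def stateId (p : ℕ) : PVectorField p := fun i => X (Sum.inl i)

theorem dirDeriv_stateId (B : PVectorField p) : dirDeriv (stateId p) B = B := by
  funext i
  simp only [dirDeriv, stateId]
  rw [Finset.sum_eq_single i]
  · simp
  · intro j _ hj
    rw [pderiv_X_of_ne (by simpa using hj.symm), zero_mul]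
  · simp

theorem stateId_mem {s W : ℕ} : stateId p ∈ fieldOrd p s W 0 := fun i =>
  X_mem_ordIdeal (stateWeight p s W) (Sum.inl i)

/-- The substitution given by a change of state variables, which fixes the parameters. -/
def extendParam (Φ : PVectorField p) : Fin 2 ⊕ Fin p → StateSeries p :=
  Sum.elim Φ fun l => X (Sum.inr l)

/-- The change of state variables `Φ` applied to the components of a field. -/
def pull (Φ w : PVectorField p) : PVectorField p := fun i => subst (extendParam Φ) (w i)

/-- The failure of `(Φ, T)` to carry `w` to `w'`. -/
def defect (w Φ : PVectorField p) (T : StateSeries p) (w' : PVectorField p) : PVectorField p :=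
  dirDeriv Φ w' - T • pull Φ w

/-- The linearization of `defect` at the identity. -/
def linDefect (u Y : PVectorField p) (τ : StateSeries p) (ω : PVectorField p) : PVectorField p :=
  ω + dirDeriv Y u - dirDeriv u Y - τ • u

theorem linDefect_add (u Y Y' : PVectorField p) (τ τ' : StateSeries p) (ω ω' : PVectorField p) :
    linDefect u (Y + Y') (τ + τ') (ω + ω') = linDefect u Y τ ω + linDefect u Y' τ' ω' := by
  simp only [linDefect, dirDeriv_add_left, dirDeriv_add_right, add_smul]
  abel

theorem linDefect_mem {s W n k : ℕ} {u Y ω : PVectorField p} {τ : StateSeries p}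
    (hu : u ∈ fieldOrd p s W n) (hY : Y ∈ fieldOrd p s W k) (hτ : τ ∈ serOrd p s W k)
    (hω : ω ∈ fieldOrd p s W (n + k)) : linDefect u Y τ ω ∈ fieldOrd p s W (n + k) :=
  sub_mem (sub_mem (add_mem hω (dirDeriv_mem hY hu (by omega))) (dirDeriv_mem hu hY le_rfl))
    (smul_mem_fieldOrd hτ hu (by omega))

/-- `linDefect` depends linearly on the base field, apart from its inhomogeneous part. -/
theorem linDefect_base_add (u u' Y : PVectorField p) (τ : StateSeries p) (ω : PVectorField p) :
    linDefect (u + u') Y τ ω = linDefect u Y τ ω + linDefect u' Y τ 0 := by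
  simp only [linDefect, dirDeriv_add_left, dirDeriv_add_right, smul_add]
  abel

theorem extendParam_mem {s W : ℕ} {Φ : PVectorField p} (hΦ : Φ ∈ fieldOrd p s W 0)
    (i : Fin 2 ⊕ Fin p) : extendParam Φ i ∈ serOrd p s W (stateWeight p s W i) := by
  rcases i with i | i
  · exact hΦ i
  · exact X_mem_ordIdeal (stateWeight p s W) (Sum.inr i)

theorem hasSubst_extendParam {Φ : PVectorField p} (hΦ : ∀ i, constantCoeff (Φ i) = 0) :
    HasSubst (extendParam Φ) :=
  hasSubst_of_constantCoeff_zero fun i => by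
    rcases i with i | i
    · exact hΦ i
    · simp [extendParam]

theorem constantCoeff_of_mem_fieldOrd {s W : ℕ} {Φ : PVectorField p}
    (hΦ : Φ ∈ fieldOrd p s W 0) (i : Fin 2) : constantCoeff (Φ i) = 0 := by
  refine constantCoeff_eq_zero_of_mem (w := stateWeight p s W) (ordIdeal_anti ?_ (hΦ i))
  fin_cases i <;> simp [stateWeight]

theorem pull_add {Φ : PVectorField p} (hΦ : ∀ i, constantCoeff (Φ i) = 0) (w w' : PVectorField p) :
    pull Φ (w + w') = pull Φ w + pull Φ w' := by
  funext i
  exact subst_add (hasSubst_extendParam hΦ) _ _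

theorem pull_mem {s W n : ℕ} {Φ w : PVectorField p} (hΦ : Φ ∈ fieldOrd p s W 0)
    (hw : w ∈ fieldOrd p s W n) : pull Φ w ∈ fieldOrd p s W n := fun i =>
  subst_mem_ordIdeal (hasSubst_extendParam (constantCoeff_of_mem_fieldOrd hΦ))
    (extendParam_mem hΦ) (hw i)

theorem pull_sub_pull_mem {s W n k : ℕ} {Φ Φ' w : PVectorField p} (hΦ : Φ ∈ fieldOrd p s W 0)
    (hΦ' : Φ' ∈ fieldOrd p s W 0) (h : Φ - Φ' ∈ fieldOrd p s W k)
    (hw : w ∈ fieldOrd p s W n) : pull Φ w - pull Φ' w ∈ fieldOrd p s W (n + k) := fun i => by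
  rw [← add_assoc]
  refine subst_sub_subst_mem (hasSubst_extendParam (constantCoeff_of_mem_fieldOrd hΦ))
    (hasSubst_extendParam (constantCoeff_of_mem_fieldOrd hΦ'))
    (extendParam_mem hΦ) (extendParam_mem hΦ') ?_ (hw i)
  rintro (i | i)
  · exact h i
  · simp [extendParam]

theorem pull_stateId (w : PVectorField p) : pull (stateId p) w = w := by
  funext i
  have : extendParam (stateId p) = (X : Fin 2 ⊕ Fin p → StateSeries p) := by
    funext j
    rcases j with j | j <;> rfl
  simp only [pull]
  rw [this, subst_self]
  rfl

/-- The parameters are held fixed by the change, so the increment is extended by zero in their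
directions and only state derivatives remain. -/
theorem pull_taylor_mem {s W n j k : ℕ} (hW : W ≠ 0) (hjk : j ≤ k) {Φ Y w : PVectorField p}
    (hΦ : Φ - stateId p ∈ fieldOrd p s W j) (hY : Y ∈ fieldOrd p s W k)
    (hw : w ∈ fieldOrd p s W n) :
    pull (Φ + Y) w - pull Φ w - dirDeriv w Y ∈ fieldOrd p s W (n + k + j) := fun i => by
  have h := taylor_mem_ordIdeal (w := stateWeight p s W) (stateWeight_ne_zero hW)
    (a := extendParam Φ) (Y := Sum.elim Y 0) hjk (j := j) ?_ ?_ (hw i)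
  · have e : extendParam Φ + Sum.elim Y 0 = extendParam (Φ + Y) := by
      funext l
      rcases l with l | l <;> simp [extendParam]
    rw [e, Fintype.sum_sum_type] at h
    simp only [Sum.elim_inl, Sum.elim_inr, Pi.zero_apply, zero_mul, Finset.sum_const_zero,
      add_zero] at h
    have e2 : ∑ l, Y l * pderiv ℝ (Sum.inl l) (w i) = dirDeriv w Y i :=
      Finset.sum_congr rfl fun l _ => mul_comm _ _
    rw [e2] at h
    exact ordIdeal_anti (by omega) h
  · rintro (l | l)
    · exact hΦ l
    · simp [extendParam]
  · rintro (l | l)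
    · exact hY l
    · simp

/-- First order expansion of `defect`. -/
theorem defect_add_sub_mem {s W n j k : ℕ} (hW : W ≠ 0) (hjk : j ≤ k)
    {w u w' Φ Y ω : PVectorField p} {T τ : StateSeries p}
    (hu : u ∈ fieldOrd p s W n) (hw : w - u ∈ fieldOrd p s W (n + j))
    (hw' : w' - u ∈ fieldOrd p s W (n + j)) (hΦ : Φ - stateId p ∈ fieldOrd p s W j)
    (hT : T - 1 ∈ serOrd p s W j) (hY : Y ∈ fieldOrd p s W k) (hτ : τ ∈ serOrd p s W k)
    (hω : ω ∈ fieldOrd p s W (n + k)) :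
    defect w (Φ + Y) (T + τ) (w' + ω) - defect w Φ T w' - linDefect u Y τ ω ∈
      fieldOrd p s W (n + k + j) := by
  have hΦ0 : Φ ∈ fieldOrd p s W 0 := by
    have := add_mem (fieldOrd_anti (Nat.zero_le _) hΦ) (stateId_mem (s := s) (W := W))
    simpa using this
  have hΦY0 : Φ + Y ∈ fieldOrd p s W 0 := add_mem hΦ0 (fieldOrd_anti (Nat.zero_le _) hY)
  have hΦYid : Φ + Y - stateId p ∈ fieldOrd p s W j := by
    have := add_mem hΦ (fieldOrd_anti hjk hY)
    rwa [sub_add_eq_add_sub] at this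
  have hT0 : T ∈ serOrd p s W 0 := mem_ordIdeal_zero _
  have hc := constantCoeff_of_mem_fieldOrd hΦ0
  have hcY := constantCoeff_of_mem_fieldOrd hΦY0
  set ρ := w - u with hρ
  have hwe : w = u + ρ := by rw [hρ]; abel
  -- The linearization is frozen at `u` and the identity. Each error term pairs an increment of
  -- degree `k` with a deviation of degree at least `j` (of `Φ`, `T`, `w` or `w'`, or another
  -- increment), or is the Taylor remainder.
  have e : defect w (Φ + Y) (T + τ) (w' + ω) - defect w Φ T w' - linDefect u Y τ ω =
      dirDeriv (Φ - stateId p) ω + dirDeriv Y (w' - u) + dirDeriv Y ω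
      - T • (pull (Φ + Y) ρ - pull Φ ρ) - (T - 1) • (pull (Φ + Y) u - pull Φ u)
      - (pull (Φ + Y) u - pull Φ u - dirDeriv u Y)
      - τ • (pull (Φ + Y) ρ) - τ • (pull (Φ + Y) u - pull (stateId p) u) := by
    simp only [defect, linDefect, hwe, pull_add hc, pull_add hcY, dirDeriv_add_left,
      dirDeriv_add_right, dirDeriv_sub_left, dirDeriv_sub_right, dirDeriv_stateId, pull_stateId,
      smul_sub, smul_add, sub_smul, add_smul, one_smul]
    abel
  rw [e]
  have hdiff : (Φ + Y) - Φ ∈ fieldOrd p s W k := by simpa using hY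
  refine sub_mem (sub_mem (sub_mem (sub_mem (sub_mem (add_mem (add_mem ?_ ?_) ?_) ?_) ?_) ?_) ?_) ?_
  · exact dirDeriv_mem hΦ hω (by omega)
  · exact dirDeriv_mem hY hw' (by omega)
  · exact dirDeriv_mem hY hω (by omega)
  · exact smul_mem_fieldOrd hT0 (pull_sub_pull_mem hΦY0 hΦ0 hdiff hw) (by omega)
  · exact smul_mem_fieldOrd hT (pull_sub_pull_mem hΦY0 hΦ0 hdiff hu) (by omega)
  · exact pull_taylor_mem hW hjk hΦ hY hu
  · exact smul_mem_fieldOrd hτ (pull_mem hΦY0 hw) (by omega)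
  · exact smul_mem_fieldOrd hτ (pull_sub_pull_mem hΦY0 stateId_mem hΦYid hu) (by omega)

/-- Series in `y` (with coefficients depending on the parameters) with exponents in `A`. -/
def ySupported (p : ℕ) (A : Set ℕ) : AddSubgroup (StateSeries p) where
  carrier := {f | ∀ d, ¬(d (Sum.inl 0) = 0 ∧ d (Sum.inl 1) ∈ A) → coeff d f = 0}
  zero_mem' d _ := by simp
  add_mem' hf hg d hd := by rw [map_add, hf d hd, hg d hd, add_zero]
  neg_mem' hf d hd := by rw [map_neg, hf d hd, neg_zero]

/-- The field `-x ∂/∂y + α ∂/∂x + β (x ∂/∂x + y ∂/∂y)`. -/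
def normalField (α β : StateSeries p) : PVectorField p := ![x p * β + α, -x p + y p * β]

/-- The field `a ∂/∂x + b (x ∂/∂x + y ∂/∂y)`. -/
def normalDir (a b : StateSeries p) : PVectorField p := ![x p * b + a, y p * b]

theorem normalField_add (α β a b : StateSeries p) :
    normalField (α + a) (β + b) = normalField α β + normalDir a b := by
  funext i
  fin_cases i <;> simp [normalField, normalDir] <;> ring

theorem x_mem_serOrd {s W : ℕ} : x p ∈ serOrd p s W (s + 1) :=
  X_mem_ordIdeal (stateWeight p s W) (Sum.inl 0)

theorem y_mem_serOrd {s W : ℕ} : y p ∈ serOrd p s W 1 :=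
  X_mem_ordIdeal (stateWeight p s W) (Sum.inl 1)

theorem mem_fieldOrd_iff {s W n : ℕ} {V : PVectorField p} :
    V ∈ fieldOrd p s W n ↔ V 0 ∈ serOrd p s W (s + 1 + n) ∧ V 1 ∈ serOrd p s W (1 + n) := by
  constructor
  · intro h
    exact ⟨h 0, h 1⟩
  · rintro ⟨h0, h1⟩ i
    fin_cases i
    · exact h0
    · exact h1

theorem normalDir_mem {s W n : ℕ} {a b : StateSeries p} (ha : a ∈ serOrd p s W (s + 1 + n))
    (hb : b ∈ serOrd p s W n) : normalDir a b ∈ fieldOrd p s W n :=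
  mem_fieldOrd_iff.2 ⟨add_mem (mul_mem_ordIdeal x_mem_serOrd hb) ha,
    mul_mem_ordIdeal y_mem_serOrd hb⟩

/-- The exponents of the Eulerian terms of lower order. -/
def eulerExps (s : ℕ) : Set ℕ := {q | q + 2 ≤ s}

/-- Being supported on given powers of `y` is a condition on single coefficients, so it passes to
the limit together with the order estimates. -/
theorem exists_series_limit {s W l c : ℕ} {A : Set ℕ} (u : ℕ → StateSeries p)
    (hu : ∀ k, u (k + 1) - u k ∈ serOrd p s W (c + (k - l)))
    (hA : ∀ k, u (k + 1) - u k ∈ ySupported p A) :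
    ∃ v, ∀ k, v - u k ∈ serOrd p s W (c + (k - l)) ∧ v - u k ∈ ySupported p A := by
  obtain ⟨v, h1, h2⟩ := exists_limit (l := l) (φ := fun k => c + (k - l))
    (fun a b h => by dsimp only; omega) (fun k => by omega) u hu
  exact ⟨v, fun k => ⟨h1 k, fun d hd => h2 d (fun k => hA k d hd) k⟩⟩

/-- Solving the normal form equation by successive approximation. -/
theorem exists_normalField {s W l M : ℕ} (hW : W ≠ 0) (A : Set ℕ) (hM : 2 * l + 1 ≤ M)
    {w u Φ₀ : PVectorField p} {T₀ α₀ β₀ : StateSeries p}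
    (hu : u ∈ fieldOrd p s W s) (hwu : w - u ∈ fieldOrd p s W (s + (l + 1)))
    (hΦ₀ : Φ₀ - stateId p ∈ fieldOrd p s W (l + 1)) (hT₀ : T₀ - 1 ∈ serOrd p s W (l + 1))
    (hn₀ : normalField α₀ β₀ - u ∈ fieldOrd p s W (s + (l + 1)))
    (hdef : defect w Φ₀ T₀ (normalField α₀ β₀) ∈ fieldOrd p s W (s + M))
    (hstep : ∀ m, M ≤ m → ∀ V ∈ fieldOrd p s W (s + m), ∃ Y τ a b,
      Y ∈ fieldOrd p s W (m - l) ∧ τ ∈ serOrd p s W (m - l) ∧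
      a ∈ serOrd p s W (2 * s + 1 + (m - l)) ∧ b ∈ serOrd p s W (s + (m - l)) ∧
      a ∈ ySupported p A ∧ b ∈ ySupported p (eulerExps s) ∧
      linDefect u Y τ (normalDir a b) - V ∈ fieldOrd p s W (s + m + 1)) :
    ∃ Φ T α β, Φ - Φ₀ ∈ fieldOrd p s W (M - l) ∧ T - T₀ ∈ serOrd p s W (M - l) ∧
      α - α₀ ∈ serOrd p s W (2 * s + 1 + (M - l)) ∧ α - α₀ ∈ ySupported p A ∧
      β - β₀ ∈ serOrd p s W (s + (M - l)) ∧ β - β₀ ∈ ySupported p (eulerExps s) ∧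
      defect w Φ T (normalField α β) = 0 := by
  -- The unknown is `((Φ, T), (α, β))`. Index `k` stands for increments of order `k - l`: a residual
  -- of degree `s + k` is corrected at a loss of `l` orders.
  let FU : ℕ → AddSubgroup ((PVectorField p × StateSeries p) × (StateSeries p × StateSeries p)) :=
    fun k => ((fieldOrd p s W (k - l)).toAddSubgroup.prod
      (serOrd p s W (k - l)).toAddSubgroup).prod
      (((serOrd p s W (2 * s + 1 + (k - l))).toAddSubgroup ⊓ ySupported p A).prod
      ((serOrd p s W (s + (k - l))).toAddSubgroup ⊓ ySupported p (eulerExps s)))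
  let F : ((PVectorField p × StateSeries p) × (StateSeries p × StateSeries p)) → PVectorField p :=
    fun z => defect w z.1.1 z.1.2 (normalField z.2.1 z.2.2)
  have hmem : ∀ k z, z ∈ FU k ↔ (z.1.1 ∈ fieldOrd p s W (k - l) ∧ z.1.2 ∈ serOrd p s W (k - l)) ∧
      ((z.2.1 ∈ serOrd p s W (2 * s + 1 + (k - l)) ∧ z.2.1 ∈ ySupported p A) ∧
      (z.2.2 ∈ serOrd p s W (s + (k - l)) ∧ z.2.2 ∈ ySupported p (eulerExps s))) :=
    fun k z => Iff.rfl
  have hF : ∀ z, z - ((Φ₀, T₀), (α₀, β₀)) ∈ FU M → ∀ k, M ≤ k → ∀ δ ∈ FU k,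
      F (z + δ) - F z - linDefect u δ.1.1 δ.1.2 (normalDir δ.2.1 δ.2.2) ∈
        fieldOrd p s W (s + (k - l) + (l + 1)) ∧
      linDefect u δ.1.1 δ.1.2 (normalDir δ.2.1 δ.2.2) ∈ fieldOrd p s W (s + (k - l)) := by
    intro z hz k hk δ hδ
    obtain ⟨⟨z1, z2⟩, ⟨z3, -⟩, z4, -⟩ := (hmem _ _).1 hz
    obtain ⟨⟨d1, d2⟩, ⟨d3, -⟩, d4, -⟩ := (hmem _ _).1 hδ
    simp only [Prod.fst_sub, Prod.snd_sub] at z1 z2 z3 z4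
    have hω : normalDir δ.2.1 δ.2.2 ∈ fieldOrd p s W (s + (k - l)) :=
      normalDir_mem (ordIdeal_anti (by omega) d3) d4
    have hz' : normalField z.2.1 z.2.2 - u ∈ fieldOrd p s W (s + (l + 1)) := by
      have h1 : normalDir (z.2.1 - α₀) (z.2.2 - β₀) ∈ fieldOrd p s W (s + (l + 1)) :=
        normalDir_mem (ordIdeal_anti (by omega) z3) (ordIdeal_anti (by omega) z4)
      have h2 := normalField_add α₀ β₀ (z.2.1 - α₀) (z.2.2 - β₀)
      rw [add_sub_cancel, add_sub_cancel] at h2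
      rw [h2, add_sub_right_comm]
      exact add_mem hn₀ h1
    have hzΦ : z.1.1 - stateId p ∈ fieldOrd p s W (l + 1) := by
      have := add_mem (fieldOrd_anti (by omega) z1 : _ ∈ fieldOrd p s W (l + 1)) hΦ₀
      rwa [sub_add_sub_cancel] at this
    have hzT : z.1.2 - 1 ∈ serOrd p s W (l + 1) := by
      have := add_mem (ordIdeal_anti (by omega) z2 : _ ∈ serOrd p s W (l + 1)) hT₀
      rwa [sub_add_sub_cancel] at this
    refine ⟨?_, linDefect_mem hu d1 d2 hω⟩
    -- The data agree with the model to relative order `l + 1`, which repays the loss `l` and gains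
    -- one order. The condition `l + 1 ≤ k - l` is where `2 * l + 1 ≤ M` enters.
    have := defect_add_sub_mem hW (by omega : l + 1 ≤ k - l) hu hwu hz' hzΦ hzT d1 d2 hω
    rw [← normalField_add] at this
    exact this
  suffices h : ∃ z, z - ((Φ₀, T₀), (α₀, β₀)) ∈ FU M ∧ F z = 0 by
    obtain ⟨z, hz, hz0⟩ := h
    obtain ⟨⟨z1, z2⟩, ⟨z3, z3'⟩, z4, z4'⟩ := (hmem _ _).1 hz
    exact ⟨z.1.1, z.1.2, z.2.1, z.2.2, z1, z2, z3, z3', z4, z4', hz0⟩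
  refine exists_zero_of_step FU
    (fun k => (fieldOrd p s W (s + k)).toAddSubgroup)
    (fun k => (fieldOrd p s W (s + (k - l))).toAddSubgroup) F ((Φ₀, T₀), (α₀, β₀)) M ?_ ?_ ?_ ?_
    ?_ ?_ hdef
  · intro a b hab z hz
    obtain ⟨⟨z1, z2⟩, ⟨z3, z3'⟩, z4, z4'⟩ := (hmem _ _).1 hz
    exact (hmem _ _).2 ⟨⟨fieldOrd_anti (by omega) z1, ordIdeal_anti (by omega) z2⟩,
      ⟨ordIdeal_anti (by omega) z3, z3'⟩, ordIdeal_anti (by omega) z4, z4'⟩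
  · intro z hz
    have hz' := fun k => (hmem _ _).1 (hz k)
    have hlim : ∀ {c : ℕ} (f : ℕ → StateSeries p),
        (∀ k, f (k + 1) - f k ∈ serOrd p s W (c + (k - l))) →
        ∃ v, ∀ k, v - f k ∈ serOrd p s W (c + (k - l)) := by
      intro c f hf
      obtain ⟨v, hv, -⟩ := exists_limit (l := l) (φ := fun k => c + (k - l))
        (fun a b h => by dsimp only; omega) (fun k => by omega) f hf
      exact ⟨v, hv⟩
    choose v1 hv1 using fun i => hlim (fun k => (z k).1.1 i) fun k => (hz' k).1.1 i
    obtain ⟨v2, hv2⟩ := hlim (c := 0) (fun k => (z k).1.2) fun k => by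
      rw [zero_add]; exact (hz' k).1.2
    obtain ⟨v3, hv3⟩ := exists_series_limit (fun k => (z k).2.1)
      (fun k => (hz' k).2.1.1) (fun k => (hz' k).2.1.2)
    obtain ⟨v4, hv4⟩ := exists_series_limit (fun k => (z k).2.2)
      (fun k => (hz' k).2.2.1) (fun k => (hz' k).2.2.2)
    refine ⟨((v1, v2), (v3, v4)), fun k => (hmem _ _).2 ⟨⟨fun i => hv1 i k, ?_⟩, hv3 k, hv4 k⟩⟩
    have := hv2 k
    rwa [zero_add] at this
  · intro k
    exact fun V hV => fieldOrd_anti (by omega) hV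
  · intro V hV
    refine eq_zero_of_mem_fieldOrd (s := s) (W := W) fun n => fieldOrd_anti ?_ (hV (M + n + l) (by omega))
    omega
  · intro z hz k hk δ hδ
    obtain ⟨h1, h2⟩ := hF z hz k hk δ hδ
    have := add_mem (fieldOrd_anti (by omega) h1) h2
    rwa [sub_add_cancel] at this
  · intro z hz k hk hFz
    obtain ⟨Y, τ, a, b, h1, h2, h3, h4, h5, h6, h7⟩ := hstep k hk (-F z) (neg_mem hFz)
    have hδ : (((Y, τ), (a, b)) : (PVectorField p × StateSeries p) × (StateSeries p × StateSeries p))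
      ∈ FU k := (hmem _ _).2 ⟨⟨h1, h2⟩, ⟨h3, h5⟩, h4, h6⟩
    refine ⟨_, hδ, ?_⟩
    have h8 := (hF z hz k hk _ hδ).1
    have := add_mem (fieldOrd_anti (by omega) h8 : _ ∈ fieldOrd p s W (s + k + 1)) h7
    rwa [sub_neg_eq_add, sub_sub, sub_add_eq_add_sub, add_comm (linDefect _ _ _ _) (F z),
      add_sub_cancel_right] at this

end Fields

end PNF

namespace PNF

/-! ### The homological operator of the leading field and its basic relations. -/

noncomputable section Homological

variable {p : ℕ}

/-- The leading field `-x ∂/∂y + y^s (x ∂/∂x + y ∂/∂y)`. -/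
def leadField (p s : ℕ) : PVectorField p := normalField 0 (y p ^ s)

/-- The derivative along the leading field. -/
def leadDeriv (s : ℕ) (f : StateSeries p) : StateSeries p :=
  pderiv ℝ (Sum.inl 0) f * (x p * y p ^ s) + pderiv ℝ (Sum.inl 1) f * (-x p + y p ^ (s + 1))

/-- The weight `s + 1` of `x` is chosen so that `-x ∂/∂y` and `y^s (x ∂/∂x + y ∂/∂y)` both have
degree `s`. -/
theorem leadField_mem {s W : ℕ} : leadField p s ∈ fieldOrd p s W s := by
  refine mem_fieldOrd_iff.2 ⟨?_, ?_⟩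
  · have h := mul_mem_ordIdeal_of_le (x_mem_serOrd (p := p) (s := s) (W := W))
      (pow_mem_ordIdeal (y_mem_serOrd (s := s) (W := W)) s) (k := s + 1 + s) (by omega)
    simpa [leadField, normalField] using h
  · have h := mul_mem_ordIdeal_of_le (y_mem_serOrd (p := p) (s := s) (W := W))
      (pow_mem_ordIdeal (y_mem_serOrd (s := s) (W := W)) s) (k := 1 + s) (by omega)
    have h2 := ordIdeal_anti (by omega : 1 + s ≤ s + 1) (x_mem_serOrd (p := p) (s := s) (W := W))
    simpa [leadField, normalField] using add_mem (neg_mem h2) h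

@[simp] theorem pderiv_x_x : pderiv ℝ (Sum.inl 0) (x p) = 1 := pderiv_X_self
@[simp] theorem pderiv_y_y : pderiv ℝ (Sum.inl 1) (y p) = 1 := pderiv_X_self
@[simp] theorem pderiv_x_y : pderiv ℝ (Sum.inl 0) (y p) = 0 := pderiv_X_of_ne (by simp)
@[simp] theorem pderiv_y_x : pderiv ℝ (Sum.inl 1) (x p) = 0 := pderiv_X_of_ne (by simp)

theorem leadDeriv_add (s : ℕ) (f g : StateSeries p) :
    leadDeriv s (f + g) = leadDeriv s f + leadDeriv s g := by
  simp only [leadDeriv, map_add]; ring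

theorem leadDeriv_sub (s : ℕ) (f g : StateSeries p) :
    leadDeriv s (f - g) = leadDeriv s f - leadDeriv s g := by
  simp only [leadDeriv, map_sub]; ring

theorem leadDeriv_neg (s : ℕ) (f : StateSeries p) : leadDeriv s (-f) = -leadDeriv s f := by
  simp only [leadDeriv, map_neg]; ring

theorem leadDeriv_zero (s : ℕ) : leadDeriv s (0 : StateSeries p) = 0 := by
  simp [leadDeriv]

theorem leadDeriv_mul (s : ℕ) (f g : StateSeries p) :
    leadDeriv s (f * g) = leadDeriv s f * g + f * leadDeriv s g := by
  simp only [leadDeriv, Derivation.leibniz, smul_eq_mul]; ring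

theorem leadDeriv_natCast (s n : ℕ) : leadDeriv s (n : StateSeries p) = 0 := by
  simp [leadDeriv]

theorem leadDeriv_x (s : ℕ) : leadDeriv s (x p) = x p * y p ^ s := by
  simp [leadDeriv]

theorem leadDeriv_y (s : ℕ) : leadDeriv s (y p) = -x p + y p ^ (s + 1) := by
  simp [leadDeriv]

theorem leadDeriv_x_pow (s a : ℕ) : leadDeriv s (x p ^ a) = a * x p ^ a * y p ^ s := by
  induction a with
  | zero => simp [leadDeriv]
  | succ a ih => rw [pow_succ, leadDeriv_mul, ih, leadDeriv_x]; push_cast; ring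

theorem leadDeriv_y_pow (s b : ℕ) :
    leadDeriv s (y p ^ b) = b * y p ^ (b - 1) * (-x p + y p ^ (s + 1)) := by
  cases b with
  | zero => simp [leadDeriv]
  | succ b =>
    induction b with
    | zero => simp [leadDeriv_y]
    | succ b ih => rw [pow_succ, leadDeriv_mul, ih, leadDeriv_y]; simp; ring

/-- A series in the parameters only. -/
def IsParamSeries (q : StateSeries p) : Prop := ∀ j : Fin 2, pderiv ℝ (Sum.inl j) q = 0

theorem IsParamSeries.leadDeriv {q : StateSeries p} (hq : IsParamSeries q) (s : ℕ) :
    leadDeriv s q = 0 := by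
  simp [PNF.leadDeriv, hq 0, hq 1]

theorem dirDeriv_pair (A B : PVectorField p) (i : Fin 2) :
    dirDeriv A B i = pderiv ℝ (Sum.inl 0) (A i) * B 0 + pderiv ℝ (Sum.inl 1) (A i) * B 1 := by
  simp [dirDeriv]

/-- The `ẏ` row contains `f` undifferentiated, coming from `-x ∂/∂y`. Hence `f` can be chosen to
cancel that row, and the homological problem becomes scalar. -/
theorem linDefect_lead {s : ℕ} (hs : 1 ≤ s) (f g τ : StateSeries p) (ω : PVectorField p) :
    linDefect (leadField p s) ![f, g] τ ω =
      ![ω 0 + leadDeriv s f - y p ^ s * f - s * x p * y p ^ (s - 1) * g - τ * (x p * y p ^ s),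
        ω 1 + leadDeriv s g + f - (s + 1) * y p ^ s * g - τ * (-x p + y p ^ (s + 1))] := by
  obtain ⟨t, rfl⟩ : ∃ t, s = t + 1 := ⟨s - 1, by omega⟩
  funext i
  fin_cases i
  · simp [linDefect, dirDeriv_pair, leadField, normalField, leadDeriv, Derivation.leibniz,
      Derivation.leibniz_pow]
    ring
  · simp [linDefect, dirDeriv_pair, leadField, normalField, leadDeriv, Derivation.leibniz,
      Derivation.leibniz_pow]
    ring

theorem smul_mem_ySupported {A : Set ℕ} (c : ℝ) {f : StateSeries p} (hf : f ∈ ySupported p A) :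
    c • f ∈ ySupported p A := fun d hd => by
  rw [coeff_smul, hf d hd, mul_zero]

theorem smul_mem_serOrd {s W n : ℕ} (c : ℝ) {f : StateSeries p} (hf : f ∈ serOrd p s W n) :
    c • f ∈ serOrd p s W n := by
  rw [smul_eq_C_mul]
  exact Ideal.mul_mem_left _ _ hf

theorem real_smul_mem_fieldOrd {s W n : ℕ} (c : ℝ) {V : PVectorField p}
    (hV : V ∈ fieldOrd p s W n) : c • V ∈ fieldOrd p s W n := fun i => smul_mem_serOrd c (hV i)

theorem linDefect_smul (c : ℝ) (u Y : PVectorField p) (τ : StateSeries p) (ω : PVectorField p) :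
    linDefect u (c • Y) (c • τ) (c • ω) = c • linDefect u Y τ ω := by
  funext i
  simp only [linDefect, dirDeriv, Pi.add_apply, Pi.sub_apply, Pi.smul_apply, smul_eq_mul,
    Derivation.map_smul, smul_add, smul_sub, Finset.smul_sum, smul_mul_assoc, mul_smul_comm]

theorem normalDir_add (a b a' b' : StateSeries p) :
    normalDir (a + a') (b + b') = normalDir a b + normalDir a' b' := by
  funext i
  fin_cases i <;> simp [normalDir] <;> ring

theorem normalDir_smul (c : ℝ) (a b : StateSeries p) :
    normalDir (c • a) (c • b) = c • normalDir a b := by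
  funext i
  fin_cases i <;> simp [normalDir]

theorem normalDir_zero : normalDir (0 : StateSeries p) 0 = 0 := by
  funext i
  fin_cases i <;> simp [normalDir]

/-- The series `P` such that `P ∂/∂x` is reached by the linearization at the leading field with
data of order `m` and normal form directions supported in `A` and `B`. -/
def stepImage (p s W m : ℕ) (A B : Set ℕ) : Submodule ℝ (StateSeries p) where
  carrier := {P | ∃ Y τ a b, Y ∈ fieldOrd p s W m ∧ τ ∈ serOrd p s W m ∧
    a ∈ serOrd p s W (2 * s + 1 + m) ∧ b ∈ serOrd p s W (s + m) ∧
    a ∈ ySupported p A ∧ b ∈ ySupported p B ∧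
    linDefect (leadField p s) Y τ (normalDir a b) = ![P, 0]}
  zero_mem' := ⟨0, 0, 0, 0, zero_mem _, zero_mem _, zero_mem _, zero_mem _, zero_mem _,
    zero_mem _, by funext i; fin_cases i <;> simp [linDefect, dirDeriv, normalDir_zero]⟩
  add_mem' := by
    rintro P P' ⟨Y, τ, a, b, h1, h2, h3, h4, h5, h6, h7⟩ ⟨Y', τ', a', b', g1, g2, g3, g4, g5, g6, g7⟩
    refine ⟨Y + Y', τ + τ', a + a', b + b', add_mem h1 g1, add_mem h2 g2, add_mem h3 g3,
      add_mem h4 g4, add_mem h5 g5, add_mem h6 g6, ?_⟩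
    rw [normalDir_add, linDefect_add, h7, g7]
    simp
  smul_mem' := by
    rintro c P ⟨Y, τ, a, b, h1, h2, h3, h4, h5, h6, h7⟩
    refine ⟨c • Y, c • τ, c • a, c • b, real_smul_mem_fieldOrd c h1, smul_mem_serOrd c h2,
      smul_mem_serOrd c h3, smul_mem_serOrd c h4, smul_mem_ySupported c h5,
      smul_mem_ySupported c h6, ?_⟩
    rw [normalDir_smul, linDefect_smul, h7]
    simp

theorem ySupported_mono {A A' : Set ℕ} (h : A ⊆ A') {f : StateSeries p}
    (hf : f ∈ ySupported p A) : f ∈ ySupported p A' :=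
  fun d hd => hf d fun h' => hd ⟨h'.1, h h'.2⟩

theorem stepImage_mono {s W m : ℕ} {A A' B B' : Set ℕ} (hA : A ⊆ A') (hB : B ⊆ B') :
    stepImage p s W m A B ≤ stepImage p s W m A' B' := by
  rintro P ⟨Y, τ, a, b, h1, h2, h3, h4, h5, h6, h7⟩
  exact ⟨Y, τ, a, b, h1, h2, h3, h4, ySupported_mono hA h5, ySupported_mono hB h6, h7⟩

/-- The part of `stepImage` without normal form directions. -/
abbrev leadImage (p s W m : ℕ) : Submodule ℝ (StateSeries p) := stepImage p s W m ∅ ∅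

theorem mem_leadImage_of_eq {s W m : ℕ} {P : StateSeries p} (Y : PVectorField p)
    (τ : StateSeries p) (hY : Y ∈ fieldOrd p s W m) (hτ : τ ∈ serOrd p s W m)
    (h : linDefect (leadField p s) Y τ 0 = ![P, 0]) : P ∈ leadImage p s W m :=
  ⟨Y, τ, 0, 0, hY, hτ, zero_mem _, zero_mem _, zero_mem _, zero_mem _, by rwa [normalDir_zero]⟩

theorem eq_zero_of_mem_ySupported_empty {f : StateSeries p} (hf : f ∈ ySupported p ∅) : f = 0 := by
  ext d
  exact hf d (by simp)

theorem mem_leadImage {s W m : ℕ} {P : StateSeries p} :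
    P ∈ leadImage p s W m ↔ ∃ Y τ, Y ∈ fieldOrd p s W m ∧ τ ∈ serOrd p s W m ∧
      linDefect (leadField p s) Y τ 0 = ![P, 0] := by
  constructor
  · rintro ⟨Y, τ, a, b, h1, h2, -, -, h5, h6, h7⟩
    refine ⟨Y, τ, h1, h2, ?_⟩
    rwa [eq_zero_of_mem_ySupported_empty h5, eq_zero_of_mem_ySupported_empty h6,
      normalDir_zero] at h7
  · rintro ⟨Y, τ, h1, h2, h3⟩
    exact mem_leadImage_of_eq Y τ h1 h2 h3

theorem pair_mem_fieldOrd {s W n : ℕ} {f g : StateSeries p} (hf : f ∈ serOrd p s W (s + 1 + n))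
    (hg : g ∈ serOrd p s W (1 + n)) : ![f, g] ∈ fieldOrd p s W n :=
  mem_fieldOrd_iff.2 ⟨hf, hg⟩

theorem leadDeriv_mem {s W n : ℕ} {f : StateSeries p} (hf : f ∈ serOrd p s W n) :
    leadDeriv s f ∈ serOrd p s W (n + s) := by
  have hx := x_mem_serOrd (p := p) (s := s) (W := W)
  have hy := y_mem_serOrd (p := p) (s := s) (W := W)
  refine add_mem ?_ ?_
  · refine mul_mem_ordIdeal_of_le (pderiv_mem_ordIdeal _ hf le_rfl)
      (mul_mem_ordIdeal hx (pow_mem_ordIdeal hy s)) ?_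
    simp only [stateWeight, Sum.elim_inl, Matrix.cons_val_zero]
    omega
  · refine mul_mem_ordIdeal_of_le (pderiv_mem_ordIdeal _ hf le_rfl)
      (add_mem (neg_mem hx) (ordIdeal_anti (by omega) (pow_mem_ordIdeal hy (s + 1)))) ?_
    simp only [stateWeight, Sum.elim_inl, Matrix.cons_val_one]
    simp
    omega

/-- Time rescalings. -/
theorem time_mem_leadImage {s W m : ℕ} (hs : 1 ≤ s) {τ : StateSeries p}
    (hτ : τ ∈ serOrd p s W m) :
    leadDeriv s τ * (-x p + y p ^ (s + 1)) +
      τ * (s * y p ^ s * (-x p + y p ^ (s + 1)) - 2 * x p * y p ^ s) ∈ leadImage p s W m := by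
  have hx := x_mem_serOrd (p := p) (s := s) (W := W)
  have hy := y_mem_serOrd (p := p) (s := s) (W := W)
  -- The change cancels the `ẏ` part of the rescaled leading field.
  refine mem_leadImage_of_eq ![τ * (-x p + y p ^ (s + 1)), 0] τ
    (pair_mem_fieldOrd (mul_mem_ordIdeal_of_le hτ (add_mem (neg_mem hx)
      (ordIdeal_anti (by omega) (pow_mem_ordIdeal hy (s + 1)))) (by omega)) (zero_mem _)) hτ ?_
  rw [linDefect_lead hs, leadDeriv_mul, leadDeriv_add, leadDeriv_neg, leadDeriv_x, leadDeriv_y_pow,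
    leadDeriv_zero]
  funext i
  fin_cases i
  · simp; ring
  · simp

/-- Changes of state variables along the Eulerian direction. -/
theorem euler_mem_leadImage {s W m : ℕ} (hs : 1 ≤ s) {f h : StateSeries p}
    (hf : f ∈ serOrd p s W m) (hh : h = leadDeriv s f - s * y p ^ s * f) :
    2 * x p * h - y p * leadDeriv s h ∈ leadImage p s W m := by
  have hx := x_mem_serOrd (p := p) (s := s) (W := W)
  have hy := y_mem_serOrd (p := p) (s := s) (W := W)
  have hhm : h ∈ serOrd p s W (m + s) := by
    rw [hh]
    refine sub_mem (leadDeriv_mem hf) ?_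
    rw [mul_assoc]
    refine Ideal.mul_mem_left _ _ (mul_mem_ordIdeal_of_le (pow_mem_ordIdeal hy s) hf ?_)
    omega
  -- The Eulerian field with multiplier `f` moves the leading field by the Eulerian field with
  -- multiplier `h`. The term `-y h` then clears the `ẏ` row.
  refine mem_leadImage_of_eq ![f * x p - y p * h, f * y p] 0
    (pair_mem_fieldOrd (sub_mem (mul_mem_ordIdeal_of_le hf hx (by omega))
      (mul_mem_ordIdeal_of_le hy hhm (by omega))) (mul_mem_ordIdeal_of_le hf hy (by omega)))
    (zero_mem _) ?_
  rw [linDefect_lead hs, leadDeriv_sub, leadDeriv_mul, leadDeriv_mul, leadDeriv_mul, leadDeriv_x,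
    leadDeriv_y]
  have e : leadDeriv s f = h + s * y p ^ s * f := by rw [hh]; ring
  obtain ⟨t, rfl⟩ : ∃ t, s = t + 1 := ⟨s - 1, by omega⟩
  funext i
  fin_cases i
  · simp [e]; ring
  · simp [e]; ring

/-- The three-term relation between monomials. -/
theorem three_term_mem_leadImage {s W m w : ℕ} (hs : 1 ≤ s) {q : StateSeries p}
    (hq : IsParamSeries q) (hqw : q ∈ serOrd p s W w) (a b : ℕ) (hm : m ≤ w + a * (s + 1) + b) :
    (b : ℝ) • (q * x p ^ (a + 2) * y p ^ (b - 1)) -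
      (a + 2 * b + s + 2 : ℝ) • (q * x p ^ (a + 1) * y p ^ (b + s)) +
      (a + b + s : ℝ) • (q * x p ^ a * y p ^ (b + 2 * s + 1)) ∈ leadImage p s W m := by
  have hx := x_mem_serOrd (p := p) (s := s) (W := W)
  have hy := y_mem_serOrd (p := p) (s := s) (W := W)
  have h := time_mem_leadImage (W := W) (m := m) hs (τ := q * x p ^ a * y p ^ b)
    (mul_mem_ordIdeal_of_le (mul_mem_ordIdeal hqw (pow_mem_ordIdeal hx a))
      (pow_mem_ordIdeal hy b) (by omega))
  rw [leadDeriv_mul, leadDeriv_mul, hq.leadDeriv, leadDeriv_x_pow, leadDeriv_y_pow] at h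
  convert h using 1
  simp only [smul_eq_C_mul, map_add, map_mul, map_natCast, map_ofNat]
  cases b with
  | zero => simp; ring
  | succ b => simp; ring

/-- The two-term relation between monomials. -/
theorem two_term_mem_leadImage {s W m w : ℕ} (hs : 1 ≤ s) {q : StateSeries p}
    (hq : IsParamSeries q) (hqw : q ∈ serOrd p s W w) (a b : ℕ) (hb : 1 ≤ b)
    (hm : m ≤ w + a * (s + 1) + b) :
    (((a : ℝ) - s - 2) * (b + s + 1)) • (q * x p ^ (a + 1) * y p ^ (b + s)) -
      (((a : ℝ) - s - 1) * (a + b + s)) • (q * x p ^ a * y p ^ (b + 2 * s + 1)) ∈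
        leadImage p s W m := by
  have hx := x_mem_serOrd (p := p) (s := s) (W := W)
  have hy := y_mem_serOrd (p := p) (s := s) (W := W)
  have h3 := three_term_mem_leadImage hs hq hqw a b hm
  have h1 := euler_mem_leadImage (W := W) (m := m) hs (f := q * x p ^ a * y p ^ b)
    (mul_mem_ordIdeal_of_le (mul_mem_ordIdeal hqw (pow_mem_ordIdeal hx a))
      (pow_mem_ordIdeal hy b) (by omega)) rfl
  -- The factor `b + 1` cancels the monomial `x^(a+2) y^(b-1)` between the Eulerian and the time
  -- relation.
  have h := add_mem h1 (Submodule.smul_mem _ ((b : ℝ) + 1) h3)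
  obtain ⟨b, rfl⟩ : ∃ c, b = c + 1 := ⟨b - 1, by omega⟩
  simp only [leadDeriv_mul, leadDeriv_sub, leadDeriv_add, hq.leadDeriv, leadDeriv_x_pow,
    leadDeriv_y_pow, leadDeriv_natCast, leadDeriv_x, leadDeriv_neg, leadDeriv_zero] at h
  convert h using 1
  simp only [smul_eq_C_mul, map_add, map_sub, map_mul, map_natCast, map_ofNat, map_one,
    Nat.add_sub_cancel]
  cases b with
  | zero => cases s with
    | zero => omega
    | succ s => simp; ring
  | succ b => cases s with
    | zero => omega
    | succ s => simp; ring

/-- The relation at the end of a resonant chain. -/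
theorem end_mem_leadImage {s W m w : ℕ} (hs : 1 ≤ s) {q : StateSeries p}
    (hq : IsParamSeries q) (hqw : q ∈ serOrd p s W w) (a : ℕ)
    (hm : m ≤ w + a * (s + 1)) :
    ((a : ℝ) - s) • ((s + 2 : ℝ) • (q * x p ^ (a + 1) * y p ^ s) -
      (a + s : ℝ) • (q * x p ^ a * y p ^ (2 * s + 1))) ∈ leadImage p s W m := by
  have hx := x_mem_serOrd (p := p) (s := s) (W := W)
  -- For this `f` the multiplier `h` is `(a - s) q x^a y^s`, so the relation is lost exactly at `a =
  -- s`.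
  have h1 := euler_mem_leadImage (W := W) (m := m) hs (f := q * x p ^ a)
    (mul_mem_ordIdeal_of_le hqw (pow_mem_ordIdeal hx a) (by omega)) rfl
  simp only [leadDeriv_mul, leadDeriv_sub, leadDeriv_add, hq.leadDeriv, leadDeriv_x_pow,
    leadDeriv_y_pow, leadDeriv_natCast, leadDeriv_zero] at h1
  convert h1 using 1
  simp only [smul_eq_C_mul, map_add, map_sub, map_natCast, map_ofNat]
  obtain ⟨t, rfl⟩ : ∃ t, s = t + 1 := ⟨s - 1, by omega⟩
  simp
  ring

/-- The relation from translations in `y`. -/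
theorem translation_mem_leadImage {s W m w : ℕ} (hs : 1 ≤ s) {q : StateSeries p}
    (hq : IsParamSeries q) (hqw : q ∈ serOrd p s W w) (hm : m + 1 ≤ w) :
    ((s : ℝ) ^ 2 - 1) • (q * y p ^ (2 * s)) - (s * (s + 2) : ℝ) • (q * x p * y p ^ (s - 1)) ∈
      leadImage p s W m := by
  have hy := y_mem_serOrd (p := p) (s := s) (W := W)
  -- The translation `q ∂/∂y`, completed by the `∂/∂x` term that leaves `ẏ` unchanged.
  refine mem_leadImage_of_eq ![((s + 1 : ℕ) : StateSeries p) * (q * y p ^ s), q] 0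
    (pair_mem_fieldOrd (Ideal.mul_mem_left _ _ (mul_mem_ordIdeal_of_le hqw
      (pow_mem_ordIdeal hy s) (by omega))) (ordIdeal_anti (by omega) hqw)) (zero_mem _) ?_
  rw [linDefect_lead hs, leadDeriv_mul, leadDeriv_mul, leadDeriv_natCast, hq.leadDeriv,
    leadDeriv_y_pow]
  obtain ⟨t, rfl⟩ : ∃ t, s = t + 1 := ⟨s - 1, by omega⟩
  funext i
  fin_cases i
  · have h2 : (C 2 : StateSeries p) = 2 := map_ofNat _ 2
    simp [smul_eq_C_mul, h2]; ring
  · simp; ring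

/-- Normal form directions. -/
theorem normal_mem_stepImage {s W m : ℕ} (hs : 1 ≤ s) {A B : Set ℕ} {a b : StateSeries p}
    (ha : a ∈ serOrd p s W (2 * s + 1 + m)) (hb : b ∈ serOrd p s W (s + m))
    (hA : a ∈ ySupported p A) (hB : b ∈ ySupported p B) :
    2 * x p * b - y p * leadDeriv s b + a ∈ stepImage p s W m A B := by
  have hy := y_mem_serOrd (p := p) (s := s) (W := W)
  refine ⟨![-(y p * b), 0], 0, a, b, pair_mem_fieldOrd (neg_mem (mul_mem_ordIdeal_of_le hy hb
    (by omega))) (zero_mem _), zero_mem _, ha, hb, hA, hB, ?_⟩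
  rw [linDefect_lead hs, leadDeriv_neg, leadDeriv_mul, leadDeriv_y, leadDeriv_zero]
  funext i
  fin_cases i
  · simp [normalDir]; ring
  · simp [normalDir]

end Homological

end PNF

namespace PNF

/-! ### Reduction of monomials and solution of the homological equation. -/

noncomputable section Reduction

variable {p : ℕ}

/-- Every monomial of sufficient weight is equivalent to a multiple of a power of `y`. -/
theorem exists_sub_smul_mem_leadImage {s W m w : ℕ} (hs : 1 ≤ s) {q : StateSeries p}
    (hq : IsParamSeries q) (hqw : q ∈ serOrd p s W w) (a b : ℕ) (hb : 2 * s + 1 ≤ b + a * (s + 1))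
    (hm : m + 2 * s + 1 ≤ w + b + a * (s + 1)) :
    ∃ c : ℝ, q * x p ^ a * y p ^ b - c • (q * y p ^ (b + a * (s + 1))) ∈ leadImage p s W m := by
  induction a using Nat.twoStepInduction generalizing b with
  | zero => exact ⟨1, by simp⟩
  | one =>
    obtain ⟨b, rfl⟩ : ∃ c, b = c + s := ⟨b - s, by omega⟩
    have e : b + s + 1 * (s + 1) = b + 2 * s + 1 := by ring
    rw [e]
    rcases Nat.eq_zero_or_pos b with rfl | hb0
    -- The two-term relation needs a positive exponent. With exponent zero the first term of the
    -- three-term relation drops out, leaving two terms.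
    · have h := three_term_mem_leadImage (m := m) hs hq hqw 0 0 (by omega)
      refine ⟨(s : ℝ) / (s + 2), ?_⟩
      have h' := Submodule.smul_mem _ (-1 / (s + 2 : ℝ)) h
      convert h' using 1
      have : (s + 2 : ℝ) ≠ 0 := by positivity
      simp only [smul_add, smul_smul, Nat.cast_zero, zero_smul, pow_zero, mul_one,
        zero_sub, zero_add]
      match_scalars <;> field_simp <;> ring
    · have h := two_term_mem_leadImage (m := m) hs hq hqw 0 b hb0 (by omega)
      refine ⟨((s : ℝ) + 1) * (b + s) / ((s + 2) * (b + s + 1)), ?_⟩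
      have h' := Submodule.smul_mem _ (-1 / ((s + 2) * (b + s + 1)) : ℝ) h
      convert h' using 1
      simp only [smul_sub, smul_smul, Nat.cast_zero, pow_zero, mul_one, zero_add, zero_sub]
      have h1 : (s + 2 : ℝ) ≠ 0 := by positivity
      have h2 : (b + s + 1 : ℝ) ≠ 0 := by positivity
      match_scalars <;> field_simp <;> ring
  | more a ih0 ih1 =>
    have e1 : (a + 1) * (s + 1) = a * (s + 1) + (s + 1) := by ring
    have e2 : (a + 2) * (s + 1) = a * (s + 1) + (s + 1) + (s + 1) := by ring
    -- This expresses `x^(a+2) y^b` by the monomials of the same weight with exponents `a + 1` and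
    -- `a` of `x`.
    have h := three_term_mem_leadImage (m := m) hs hq hqw a (b + 1) (by omega)
    obtain ⟨c0, h0⟩ := ih0 (b + 1 + 2 * s + 1) (by omega) (by omega)
    obtain ⟨c1, h1⟩ := ih1 (b + 1 + s) (by omega) (by omega)
    rw [show b + 1 + 2 * s + 1 + a * (s + 1) = b + (a + 2) * (s + 1) by rw [e2]; ring] at h0
    rw [show b + 1 + s + (a + 1) * (s + 1) = b + (a + 2) * (s + 1) by rw [e2, e1]; ring] at h1
    simp only [Nat.add_sub_cancel] at h
    have hb0 : ((b + 1 : ℕ) : ℝ) ≠ 0 := by positivity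
    refine ⟨((a + 2 * (b + 1 : ℕ) + s + 2 : ℝ) * c1 - (a + (b + 1 : ℕ) + s : ℝ) * c0) /
      (b + 1 : ℕ), ?_⟩
    have h' := Submodule.smul_mem _ (1 / ((b + 1 : ℕ) : ℝ))
      (sub_mem (add_mem h (Submodule.smul_mem _ (a + 2 * (b + 1 : ℕ) + s + 2 : ℝ) h1))
        (Submodule.smul_mem _ (a + (b + 1 : ℕ) + s : ℝ) h0))
    convert h' using 1
    match_scalars <;> field_simp <;> ring

/-- A version of the reduction with nonzero factor. -/
theorem exists_ne_zero_sub_smul_mem_leadImage {s W m w : ℕ} (hs : 1 ≤ s) {q : StateSeries p}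
    (hq : IsParamSeries q) (hqw : q ∈ serOrd p s W w) (a b : ℕ) (ha : a ≤ s) (hb : s + 1 ≤ b)
    (hm : m + 2 * s + 1 ≤ w + b + a * (s + 1)) :
    ∃ c : ℝ, c ≠ 0 ∧
      q * x p ^ a * y p ^ b - c • (q * y p ^ (b + a * (s + 1))) ∈ leadImage p s W m := by
  induction a generalizing b with
  | zero => exact ⟨1, one_ne_zero, by simp⟩
  | succ a ih =>
    obtain ⟨b, rfl⟩ : ∃ c, b = c + s := ⟨b - s, by omega⟩
    have e1 : (a + 1) * (s + 1) = a * (s + 1) + (s + 1) := by ring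
    have h := two_term_mem_leadImage (m := m) hs hq hqw a b (by omega) (by omega)
    obtain ⟨c0, hc0, h0⟩ := ih (b + 2 * s + 1) (by omega) (by omega) (by omega)
    rw [show b + 2 * s + 1 + a * (s + 1) = b + s + (a + 1) * (s + 1) by rw [e1]; ring] at h0
    have has : (a : ℝ) + 1 ≤ s := by exact_mod_cast ha
    -- Nonvanishing of the two-term factors is the reason for the bound `s` on the exponent of `x`:
    -- only `a < s` is used here.
    have n1 : (a : ℝ) - s - 2 ≠ 0 := by linarith
    have n2 : (a : ℝ) - s - 1 ≠ 0 := by linarith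
    have n3 : (b + s + 1 : ℝ) ≠ 0 := by positivity
    have n4 : (a + b + s : ℝ) ≠ 0 := by
      have : (1 : ℝ) ≤ s := by exact_mod_cast hs
      positivity
    refine ⟨((a - s - 1) * (a + b + s)) * c0 / ((a - s - 2) * (b + s + 1)), ?_, ?_⟩
    · exact div_ne_zero (mul_ne_zero (mul_ne_zero n2 n4) hc0) (mul_ne_zero n1 n3)
    · have h' := Submodule.smul_mem _ (1 / ((a - s - 2) * (b + s + 1)) : ℝ)
        (add_mem h (Submodule.smul_mem _ (((a : ℝ) - s - 1) * (a + b + s)) h0))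
      convert h' using 1
      match_scalars <;> field_simp <;> ring

/-- In resonant weights every monomial is in the image of the linearization. -/
theorem resonant_mem_leadImage {s W m w k : ℕ} (hs : 1 ≤ s) {q : StateSeries p}
    (hq : IsParamSeries q) (hqw : q ∈ serOrd p s W w) (hk : 1 ≤ k) (hks : k ≠ s)
    (hm : m ≤ w + k * (s + 1)) :
    q * y p ^ (k * (s + 1) + 2 * s + 1) ∈ leadImage p s W m := by
  -- Neighbouring monomials are treated in pairs. The induction climbs from the bottom of the chain,
  -- `x^k y^(2s+1)` and `x^(k+1) y^s`, to the pure power of `y`.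
  suffices h : ∀ i a, a + i = k →
      q * x p ^ a * y p ^ (i * (s + 1) + 2 * s + 1) ∈ leadImage p s W m ∧
      q * x p ^ (a + 1) * y p ^ (i * (s + 1) + s) ∈ leadImage p s W m by
    simpa using (h k 0 (by omega)).1
  intro i
  induction i with
  | zero =>
    rintro a rfl
    have h1 := three_term_mem_leadImage (m := m) hs hq hqw a 0 (by simpa using hm)
    have h2 := end_mem_leadImage (m := m) hs hq hqw a (by simpa using hm)
    -- At the bottom there are two relations for two monomials. They are independent because `k ≠ s`
    -- and `k ≠ 0`.
    have n1 : (a : ℝ) - s ≠ 0 := sub_ne_zero.2 (by exact_mod_cast hks)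
    have h3 := Submodule.smul_mem _ ((a - s : ℝ)⁻¹) h2
    rw [smul_smul, inv_mul_cancel₀ n1, one_smul] at h3
    have ha : (a : ℝ) ≠ 0 := by
      have : a ≠ 0 := by omega
      exact_mod_cast this
    have n2 : (a + s : ℝ) ≠ 0 := by positivity
    have h4 : q * x p ^ (a + 1) * y p ^ s ∈ leadImage p s W m := by
      have := Submodule.smul_mem _ (-1 / a : ℝ) (add_mem h1 h3)
      convert this using 1
      simp only [zero_add, CharP.cast_eq_zero, zero_smul, add_zero, mul_zero, zero_sub]
      match_scalars <;> field_simp <;> ring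
    have h5 : q * x p ^ a * y p ^ (2 * s + 1) ∈ leadImage p s W m := by
      have := Submodule.smul_mem _ (1 / (a + s) : ℝ)
        (sub_mem (Submodule.smul_mem _ (s + 2 : ℝ) h4) h3)
      convert this using 1
      match_scalars <;> field_simp <;> ring
    simpa using ⟨h5, h4⟩
  | succ i ih =>
    intro a hak
    obtain ⟨h1, h2⟩ := ih (a + 1) (by omega)
    have e1 : (i + 1) * (s + 1) = i * (s + 1) + (s + 1) := by ring
    have e2 : k * (s + 1) = a * (s + 1) + (i + 1) * (s + 1) := by rw [← hak]; ring
    have h := three_term_mem_leadImage (m := m) hs hq hqw a ((i + 1) * (s + 1)) (by omega)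
    rw [show (i + 1) * (s + 1) - 1 = i * (s + 1) + s by omega] at h
    have h1' : q * x p ^ (a + 1) * y p ^ ((i + 1) * (s + 1) + s) ∈ leadImage p s W m := by
      rwa [show (i + 1) * (s + 1) + s = i * (s + 1) + 2 * s + 1 by rw [e1]; ring]
    refine ⟨?_, h1'⟩
    have n : (a + ((i + 1) * (s + 1) : ℕ) + s : ℝ) ≠ 0 := by positivity
    have h' := Submodule.smul_mem _ (1 / (a + ((i + 1) * (s + 1) : ℕ) + s) : ℝ)
      (add_mem (sub_mem h (Submodule.smul_mem _ (((i + 1) * (s + 1) : ℕ) : ℝ) h2))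
        (Submodule.smul_mem _ (a + 2 * ((i + 1) * (s + 1) : ℕ) + s + 2 : ℝ) h1'))
    convert h' using 1
    match_scalars <;> field_simp <;> ring

/-- The exponents `j + 1` with `j` not resonant. -/
def allowedExps (s : ℕ) : Set ℕ := {N | ¬∃ k, 1 ≤ k ∧ k ≠ s ∧ N = k * (s + 1) + 2 * s + 1}

theorem paramMonomial_mul_pow_mem_ySupported {A : Set ℕ} {d : Fin 2 ⊕ Fin p →₀ ℕ} {c : ℝ}
    (h0 : d (Sum.inl 0) = 0) (h1 : d (Sum.inl 1) = 0) {b : ℕ} (hb : b ∈ A) :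
    monomial d c * y p ^ b ∈ ySupported p A := by
  classical
  intro e he
  rw [y, X_pow_eq, monomial_mul_monomial, coeff_monomial, if_neg]
  rintro rfl
  exact he (by simpa [h0, h1] using hb)

theorem isParamSeries_monomial {d : Fin 2 ⊕ Fin p →₀ ℕ} {c : ℝ}
    (h0 : d (Sum.inl 0) = 0) (h1 : d (Sum.inl 1) = 0) :
    IsParamSeries (monomial d c : StateSeries p) := by
  classical
  intro j
  ext e
  rw [coeff_pderiv, coeff_monomial, if_neg, zero_mul, map_zero]
  rintro rfl
  fin_cases j
  · simp at h0
  · simp at h1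

theorem monomial_mem_serOrd {s W : ℕ} (d : Fin 2 ⊕ Fin p →₀ ℕ) (c : ℝ) :
    (monomial d c : StateSeries p) ∈ serOrd p s W (Finsupp.weight (stateWeight p s W) d) := by
  classical
  refine mem_ordIdeal.2 fun e he => ?_
  rw [coeff_monomial, if_neg]
  rintro rfl
  exact lt_irrefl _ he

/-- If the state part has weight at least `2s + 1`, the monomial reduces to a power of `y`, which is
a Hamiltonian direction unless its index is resonant. Below that weight the only monomials besides
powers of `y` are `x y^b` with `b < s`. An Eulerian direction takes care of `b ≤ s - 2`, a
parameter-dependent translation of `b = s - 1`, and for this reason no `B^0_{s-1}` occurs in the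
normal form. -/
theorem monomial_mul_mem_stepImage {s W m : ℕ} (hs : 1 ≤ s) {d : Fin 2 ⊕ Fin p →₀ ℕ} {c : ℝ}
    (h0 : d (Sum.inl 0) = 0) (h1 : d (Sum.inl 1) = 0) (a b : ℕ)
    (hm : Finsupp.weight (stateWeight p s W) d + b + a * (s + 1) = 2 * s + 1 + m) :
    monomial d c * x p ^ a * y p ^ b ∈
      stepImage p s W m (allowedExps s) (eulerExps s) := by
  have hy := y_mem_serOrd (p := p) (s := s) (W := W)
  have hq := isParamSeries_monomial (c := c) h0 h1
  have hqw := monomial_mem_serOrd (s := s) (W := W) d c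
  set w := Finsupp.weight (stateWeight p s W) d with hw
  set q : StateSeries p := monomial d c with hqd
  have hzero : (0 : StateSeries p) ∈ ySupported p (eulerExps s) := zero_mem _
  have hle : leadImage p s W m ≤ stepImage p s W m (allowedExps s) (eulerExps s) :=
    stepImage_mono (Set.empty_subset _) (Set.empty_subset _)
  have hpure : ∀ N, w + N = 2 * s + 1 + m → N ∈ allowedExps s →
      q * y p ^ N ∈ stepImage p s W m (allowedExps s) (eulerExps s) := by
    intro N hN hA
    have := normal_mem_stepImage (W := W) (m := m) hs (a := q * y p ^ N) (b := 0)
      (A := allowedExps s) (mul_mem_ordIdeal_of_le hqw (pow_mem_ordIdeal hy N) (by omega))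
      (zero_mem _) (paramMonomial_mul_pow_mem_ySupported h0 h1 hA) hzero
    simpa [leadDeriv_zero] using this
  rcases le_or_gt (2 * s + 1) (b + a * (s + 1)) with h | h
  · obtain ⟨t, ht⟩ := exists_sub_smul_mem_leadImage (m := m) hs hq hqw a b h (by omega)
    suffices h2 : q * y p ^ (b + a * (s + 1)) ∈
        stepImage p s W m (allowedExps s) (eulerExps s) by
      have := add_mem (hle ht) (Submodule.smul_mem _ t h2)
      rwa [sub_add_cancel] at this
    by_cases hA : b + a * (s + 1) ∈ allowedExps s
    · exact hpure _ (by omega) hA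
    · obtain ⟨k, hk, hks, hkN⟩ := not_not.1 hA
      rw [hkN]
      exact hle (resonant_mem_leadImage hs hq hqw hk hks (by omega))
  · have hsmall : ∀ N, N < 2 * s + 1 → N ∈ allowedExps s := by
      rintro N hN ⟨k, -, -, hkN⟩
      omega
    match a, hm, h with
    | 0, hm, h =>
      have := hpure b (by omega) (hsmall b (by omega))
      simpa using this
    | 1, hm, h =>
      have hbe : b + (s + 1) ∈ allowedExps s := hsmall _ (by omega)
      rcases lt_or_ge b (s - 1) with hb | hb
      · have h2 := normal_mem_stepImage (W := W) (m := m) hs (a := 0) (b := q * y p ^ b)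
          (A := allowedExps s) (B := eulerExps s) (zero_mem _)
          (mul_mem_ordIdeal_of_le hqw (pow_mem_ordIdeal hy b) (by omega)) (zero_mem _)
          (paramMonomial_mul_pow_mem_ySupported h0 h1
            (by change b + 2 ≤ s; omega))
        have h3 := hpure (b + (s + 1)) (by omega) hbe
        have hb2 : (b + 2 : ℝ) ≠ 0 := by positivity
        have h4 := Submodule.smul_mem _ (1 / (b + 2) : ℝ)
          (add_mem h2 (Submodule.smul_mem _ (b : ℝ) h3))
        have e : 2 * x p * (q * y p ^ b) - y p * leadDeriv s (q * y p ^ b) + 0 +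
            (b : ℝ) • (q * y p ^ (b + (s + 1))) = (b + 2 : ℝ) • (q * x p ^ 1 * y p ^ b) := by
          rw [leadDeriv_mul, hq.leadDeriv, leadDeriv_y_pow]
          simp only [smul_eq_C_mul, map_add, map_natCast, map_ofNat]
          cases b with
          | zero => simp; ring
          | succ b => simp; ring
        rw [e, smul_smul, one_div_mul_cancel hb2, one_smul] at h4
        exact h4
      · obtain rfl : b = s - 1 := by omega
        have h2 := hle (translation_mem_leadImage (m := m) hs hq hqw (by omega))
        have h3 := hpure (2 * s) (by omega) (hsmall _ (by omega))
        have hs0 : (s : ℝ) ≠ 0 := by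
          have : s ≠ 0 := by omega
          exact_mod_cast this
        have hs2 : (s + 2 : ℝ) ≠ 0 := by positivity
        have h4 := Submodule.smul_mem _ (1 / (s * (s + 2)) : ℝ)
          (sub_mem (Submodule.smul_mem _ ((s : ℝ) ^ 2 - 1) h3) h2)
        convert h4 using 1
        rw [pow_one]
        match_scalars <;> field_simp <;> ring
    | a + 2, hm, h =>
      exfalso
      have : (a + 2) * (s + 1) = a * (s + 1) + 2 * (s + 1) := by ring
      omega

/-- The homological equation can be solved up to higher order. -/
theorem exists_step {s W m : ℕ} (hs : 1 ≤ s) (hW : W ≠ 0) {V : PVectorField p}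
    (hV : V ∈ fieldOrd p s W (s + m)) : ∃ Y τ a b,
      Y ∈ fieldOrd p s W m ∧ τ ∈ serOrd p s W m ∧
      a ∈ serOrd p s W (2 * s + 1 + m) ∧ b ∈ serOrd p s W (s + m) ∧
      a ∈ ySupported p (allowedExps s) ∧ b ∈ ySupported p (eulerExps s) ∧
      linDefect (leadField p s) Y τ (normalDir a b) - V ∈ fieldOrd p s W (s + m + 1) := by
  classical
  obtain ⟨hV0, hV1⟩ := mem_fieldOrd_iff.1 hV
  have hy := y_mem_serOrd (p := p) (s := s) (W := W)
  -- What is left of the `ẋ` row after `V 1` has been absorbed by the first component of the change.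
  set P := V 0 - (leadDeriv s (V 1) - y p ^ s * V 1) with hP
  have hPm : P ∈ serOrd p s W (2 * s + 1 + m) := by
    refine sub_mem (ordIdeal_anti (by omega) hV0) (sub_mem
      (ordIdeal_anti (by omega) (leadDeriv_mem hV1))
      (mul_mem_ordIdeal_of_le (pow_mem_ordIdeal hy s) hV1 (by omega)))
  obtain ⟨S, hS1, hS2⟩ := exists_sum_monomial_sub_mem (stateWeight_ne_zero (p := p) (s := s) hW) P
    (2 * s + 1 + m + 1)
  have hmem : ∑ d ∈ S, monomial d (coeff d P) ∈
      stepImage p s W m (allowedExps s) (eulerExps s) := by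
    refine sum_mem fun d hd => ?_
    by_cases hdw : Finsupp.weight (stateWeight p s W) d < 2 * s + 1 + m
    · rw [mem_ordIdeal.1 hPm d hdw, map_zero]
      exact zero_mem _
    · have hdw' : Finsupp.weight (stateWeight p s W) d = 2 * s + 1 + m := by
        have := hS1 d hd
        omega
      set d' : Fin 2 ⊕ Fin p →₀ ℕ := (d.erase (Sum.inl 0)).erase (Sum.inl 1) with hd'
      have hdec : d = d' + Finsupp.single (Sum.inl 0) (d (Sum.inl 0)) +
          Finsupp.single (Sum.inl 1) (d (Sum.inl 1)) := by
        have e1 := Finsupp.erase_add_single (Sum.inl 0) d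
        have e2 := Finsupp.erase_add_single (Sum.inl 1) (d.erase (Sum.inl 0))
        rw [Finsupp.erase_ne (by simp)] at e2
        rw [← hd'] at e2
        conv_lhs => rw [← e1, ← e2]
        abel
      have hmono : (monomial d (coeff d P) : StateSeries p) =
          monomial d' (coeff d P) * x p ^ d (Sum.inl 0) * y p ^ d (Sum.inl 1) := by
        rw [x, y, X_pow_eq, X_pow_eq, monomial_mul_monomial, monomial_mul_monomial, mul_one,
          mul_one, ← hdec]
      rw [hmono]
      refine monomial_mul_mem_stepImage hs (by simp [hd']) (by simp [hd']) _ _ ?_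
      rw [← hdw']
      conv_rhs => rw [hdec]
      simp only [map_add, Finsupp.weight_single]
      simp [stateWeight]
      ring
  obtain ⟨Y, τ, a, b, h1, h2, h3, h4, h5, h6, h7⟩ := hmem
  refine ⟨Y + ![V 1, 0], τ + 0, a, b, add_mem h1 (pair_mem_fieldOrd (ordIdeal_anti (by omega) hV1)
    (zero_mem _)), add_mem h2 (zero_mem _), h3, h4, h5, h6, ?_⟩
  have e : linDefect (leadField p s) (Y + ![V 1, 0]) (τ + 0) (normalDir a b) - V =
      ![-(P - ∑ d ∈ S, monomial d (coeff d P)), 0] := by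
    have h8 := linDefect_add (leadField p s) Y ![V 1, 0] τ 0 (normalDir a b) 0
    rw [add_zero (normalDir a b)] at h8
    rw [h8, h7, linDefect_lead hs, leadDeriv_zero]
    funext i
    fin_cases i
    · simp [hP]
      ring
    · simp
  rw [e]
  exact pair_mem_fieldOrd (neg_mem (ordIdeal_anti (by omega) hS2)) (zero_mem _)

end Reduction

end PNF

namespace PNF

/-! ### Changes of variables: Jacobians, composition, invertibility. -/

noncomputable section Changes

variable {p : ℕ}

theorem carries_iff_defect {g : StateTimeChange p} {w w' : PVectorField p} :
    g.Carries w w' ↔ defect w g.Φ g.T w' = 0 := by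
  constructor
  · intro h
    funext i
    exact sub_eq_zero.2 (h i)
  · intro h i
    exact sub_eq_zero.1 (congrFun h i)

/-- The matrix of derivatives of a change of state variables. -/
def jacobian (Φ : PVectorField p) : Matrix (Fin 2) (Fin 2) (StateSeries p) :=
  Matrix.of fun i j => pderiv ℝ (Sum.inl j) (Φ i)

theorem constantCoeff_pderiv {σ : Type*} (i : σ) (f : MvPowerSeries σ ℝ) :
    constantCoeff (pderiv ℝ i f) = coeff (Finsupp.single i 1) f := by
  rw [← coeff_zero_eq_constantCoeff_apply, coeff_pderiv]
  simp

theorem constantCoeff_det_jacobian (Φ : PVectorField p) :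
    constantCoeff (jacobian Φ).det = (Matrix.of fun i j : Fin 2 =>
      coeff (Finsupp.single (Sum.inl j) 1) (Φ i)).det := by
  rw [RingHom.map_det]
  congr 1
  ext i j
  exact constantCoeff_pderiv _ _

theorem StateTimeChange.isUnit_det (g : StateTimeChange p) : IsUnit (jacobian g.Φ).det := by
  rw [isUnit_iff_constantCoeff, constantCoeff_det_jacobian]
  exact isUnit_iff_ne_zero.2 g.Φ_inv

theorem dirDeriv_eq_mulVec (Φ V : PVectorField p) : dirDeriv Φ V = (jacobian Φ).mulVec V := rfl

theorem StateTimeChange.dirDeriv_injective (g : StateTimeChange p) {V V' : PVectorField p}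
    (h : dirDeriv g.Φ V = dirDeriv g.Φ V') : V = V' := by
  rw [dirDeriv_eq_mulVec, dirDeriv_eq_mulVec] at h
  have := congrArg ((jacobian g.Φ)⁻¹.mulVec) h
  rwa [Matrix.mulVec_mulVec, Matrix.mulVec_mulVec, Matrix.nonsing_inv_mul _ g.isUnit_det,
    Matrix.one_mulVec, Matrix.one_mulVec] at this

/-- Every system is transformed by every change. -/
theorem StateTimeChange.exists_carries (g : StateTimeChange p) (w : PVectorField p) :
    ∃ w', g.Carries w w' := by
  refine ⟨(jacobian g.Φ)⁻¹.mulVec (g.T • pull g.Φ w), carries_iff_defect.2 ?_⟩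
  rw [defect, dirDeriv_eq_mulVec, Matrix.mulVec_mulVec, Matrix.mul_nonsing_inv _ g.isUnit_det,
    Matrix.one_mulVec, sub_self]

theorem constantCoeff_extendParam {Φ : PVectorField p} (hΦ : ∀ i, constantCoeff (Φ i) = 0)
    (i : Fin 2 ⊕ Fin p) : constantCoeff (extendParam Φ i) = 0 := by
  rcases i with i | i
  · exact hΦ i
  · simp [extendParam]

theorem pderiv_subst_extendParam {Φ : PVectorField p} (hΦ : ∀ i, constantCoeff (Φ i) = 0)
    (j : Fin 2) (f : StateSeries p) :
    pderiv ℝ (Sum.inl j) (subst (extendParam Φ) f) =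
      ∑ k, pderiv ℝ (Sum.inl j) (Φ k) * subst (extendParam Φ) (pderiv ℝ (Sum.inl k) f) := by
  rw [pderiv_subst (constantCoeff_extendParam hΦ), Fintype.sum_sum_type]
  simp [extendParam]

theorem dirDeriv_pull {Φ : PVectorField p} (hΦ : ∀ i, constantCoeff (Φ i) = 0)
    (A B : PVectorField p) (i : Fin 2) :
    dirDeriv (pull Φ A) B i =
      ∑ k, dirDeriv Φ B k * subst (extendParam Φ) (pderiv ℝ (Sum.inl k) (A i)) := by
  simp only [dirDeriv, pull, pderiv_subst_extendParam hΦ, Finset.sum_mul]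
  rw [Finset.sum_comm]
  exact Finset.sum_congr rfl fun k _ => Finset.sum_congr rfl fun j _ => by ring

theorem jacobian_pull {Φ : PVectorField p} (hΦ : ∀ i, constantCoeff (Φ i) = 0)
    (A : PVectorField p) :
    jacobian (pull Φ A) = (jacobian A).map (subst (extendParam Φ)) * jacobian Φ := by
  ext i j : 2
  simp only [jacobian, pull, Matrix.of_apply, Matrix.mul_apply, Matrix.map_apply,
    pderiv_subst_extendParam hΦ]
  simp only [mul_comm]

theorem pull_pull {Φ Φ' : PVectorField p} (hΦ : ∀ i, constantCoeff (Φ i) = 0)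
    (hΦ' : ∀ i, constantCoeff (Φ' i) = 0) (w : PVectorField p) :
    pull Φ' (pull Φ w) = pull (pull Φ' Φ) w := by
  funext i
  simp only [pull]
  rw [subst_comp_subst_apply (hasSubst_extendParam hΦ) (hasSubst_extendParam hΦ')]
  congr 1
  funext l
  rcases l with l | l
  · rfl
  · exact subst_X (hasSubst_extendParam hΦ') _

/-- Composition of changes of state variables and time. -/
def StateTimeChange.comp (g g' : StateTimeChange p) : StateTimeChange p where
  Φ := pull g'.Φ g.Φ
  T := subst (extendParam g'.Φ) g.T * g'.T
  Φ_zero i := by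
    rw [pull, constantCoeff_subst_of_zero (constantCoeff_extendParam g'.Φ_zero)]
    exact g.Φ_zero i
  Φ_inv := by
    rw [← constantCoeff_det_jacobian, jacobian_pull g'.Φ_zero, Matrix.det_mul, map_mul]
    refine mul_ne_zero ?_ ?_
    · have := g.Φ_inv
      rw [← constantCoeff_det_jacobian] at this
      rw [RingHom.map_det] at this ⊢
      convert this using 2
      ext i j
      exact constantCoeff_subst_of_zero (constantCoeff_extendParam g'.Φ_zero) _
    · rw [constantCoeff_det_jacobian]
      exact g'.Φ_inv
  T_inv := by
    rw [map_mul, constantCoeff_subst_of_zero (constantCoeff_extendParam g'.Φ_zero)]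
    exact mul_ne_zero g.T_inv g'.T_inv

theorem StateTimeChange.Carries.comp {g g' : StateTimeChange p} {w w' w'' : PVectorField p}
    (h : g.Carries w w') (h' : g'.Carries w' w'') : (g.comp g').Carries w w'' := by
  rw [carries_iff_defect, defect, sub_eq_zero] at h h' ⊢
  have hs := hasSubst_extendParam g'.Φ_zero
  funext i
  have e1 : subst (extendParam g'.Φ) (dirDeriv g.Φ w' i) =
      subst (extendParam g'.Φ) ((g.T • pull g.Φ w) i) := by rw [h]
  simp only [StateTimeChange.comp]
  rw [dirDeriv_pull g'.Φ_zero, h']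
  simp only [dirDeriv, Pi.smul_apply, smul_eq_mul, subst_mul hs] at e1 ⊢
  rw [← coe_substAlgHom hs, map_sum] at e1
  simp only [coe_substAlgHom hs, subst_mul hs] at e1
  rw [← pull_pull g.Φ_zero g'.Φ_zero]
  change _ = _ * subst (extendParam g'.Φ) (pull g.Φ w i)
  have e2 : ∑ k, g'.T * pull g'.Φ w' k * subst (extendParam g'.Φ) (pderiv ℝ (Sum.inl k) (g.Φ i)) =
      g'.T * ∑ k, subst (extendParam g'.Φ) (pderiv ℝ (Sum.inl k) (g.Φ i)) *
        subst (extendParam g'.Φ) (w' k) := by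
    rw [Finset.mul_sum]
    exact Finset.sum_congr rfl fun k _ => by rw [pull]; ring
  rw [e2, e1]
  ring

/-- Changes close to the identity are invertible. -/
theorem exists_stateTimeChange {s W : ℕ} {Φ : PVectorField p} {T : StateSeries p}
    (hΦ : Φ - stateId p ∈ fieldOrd p s W 1) (hT : T - 1 ∈ serOrd p s W 1) :
    ∃ g : StateTimeChange p, g.Φ = Φ ∧ g.T = T := by
  have hΦ0 : Φ ∈ fieldOrd p s W 0 := by
    have := add_mem (fieldOrd_anti (Nat.zero_le _) hΦ) (stateId_mem (s := s) (W := W))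
    simpa using this
  obtain ⟨h0, h1⟩ := mem_fieldOrd_iff.1 hΦ
  have hc : ∀ i j : Fin 2, coeff (Finsupp.single (Sum.inl j) 1) (stateId p i) =
      if j = i then (1 : ℝ) else 0 := by
    classical
    intro i j
    rw [stateId, coeff_X]
    by_cases h : j = i <;> simp [h, Finsupp.single_left_inj]
  -- The grading makes the Jacobian at the origin triangular with unit diagonal. The remaining
  -- entry, the coefficient of `x` in the second component, is not constrained.
  have h00 := mem_ordIdeal.1 h0 (Finsupp.single (Sum.inl 0) 1)
    (by simp [Finsupp.weight_single, stateWeight])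
  have h01 := mem_ordIdeal.1 h0 (Finsupp.single (Sum.inl 1) 1)
    (by simp [Finsupp.weight_single, stateWeight])
  have h11 := mem_ordIdeal.1 h1 (Finsupp.single (Sum.inl 1) 1)
    (by simp [Finsupp.weight_single, stateWeight])
  rw [Pi.sub_apply, map_sub, hc, sub_eq_zero] at h00 h01 h11
  refine ⟨⟨Φ, T, constantCoeff_of_mem_fieldOrd hΦ0, ?_, ?_⟩, rfl, rfl⟩
  · rw [Matrix.det_fin_two]
    simp [h00, h01, h11]
  · have := constantCoeff_eq_zero_of_mem hT
    rw [map_sub, map_one, sub_eq_zero] at this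
    rw [this]
    exact one_ne_zero

end Changes

/-! ### Restriction to zero parameters and extension to deformations. -/

noncomputable section Parameters

variable {p : ℕ}

/-- The substitution `μ = 0`. -/
def zeroParam (p : ℕ) : Fin 2 ⊕ Fin p → StateSeries 0 :=
  Sum.elim (fun i => X (Sum.inl i)) fun _ => 0

theorem constantCoeff_zeroParam (i : Fin 2 ⊕ Fin p) : constantCoeff (zeroParam p i) = 0 := by
  rcases i with i | i <;> simp [zeroParam]

theorem hasSubst_zeroParam : HasSubst (zeroParam p) :=
  hasSubst_of_constantCoeff_zero constantCoeff_zeroParam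

theorem atZero_eq (f : StateSeries p) : atZero f = subst (zeroParam p) f := rfl

/-- The substitution embedding series without parameters. -/
def addParam (p : ℕ) : Fin 2 ⊕ Fin 0 → StateSeries p :=
  Sum.elim (fun i => X (Sum.inl i)) Fin.elim0

theorem constantCoeff_addParam (i : Fin 2 ⊕ Fin 0) : constantCoeff (addParam p i) = 0 := by
  rcases i with i | i
  · simp [addParam]
  · exact i.elim0

theorem hasSubst_addParam : HasSubst (addParam p) :=
  hasSubst_of_constantCoeff_zero constantCoeff_addParam

theorem atZero_subst_addParam (f : StateSeries 0) : atZero (subst (addParam p) f) = f := by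
  rw [atZero_eq, subst_comp_subst_apply hasSubst_addParam hasSubst_zeroParam]
  have : (fun i => subst (zeroParam p) (addParam p i)) =
      (X : Fin 2 ⊕ Fin 0 → StateSeries 0) := by
    funext i
    rcases i with i | i
    · exact subst_X hasSubst_zeroParam _
    · exact i.elim0
  rw [this, subst_self]
  rfl

theorem atZero_pderiv (j : Fin 2) (f : StateSeries p) :
    atZero (pderiv ℝ (Sum.inl j) f) = pderiv ℝ (Sum.inl j) (atZero f) := by
  rw [atZero_eq, atZero_eq, pderiv_subst constantCoeff_zeroParam, Fintype.sum_sum_type]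
  simp only [zeroParam, Sum.elim_inl, Sum.elim_inr, map_zero, zero_mul, Finset.sum_const_zero,
    add_zero]
  rw [Finset.sum_eq_single j]
  · simp
  · intro k _ hk
    rw [pderiv_X_of_ne (by simpa using hk), zero_mul]
  · simp

theorem constantCoeff_atZero (f : StateSeries p) :
    constantCoeff (atZero f) = constantCoeff f :=
  constantCoeff_subst_of_zero constantCoeff_zeroParam f

theorem coeff_atZero (f : StateSeries p) (e : Fin 2 ⊕ Fin 0 →₀ ℕ) (d : Fin 2 ⊕ Fin p →₀ ℕ)
    (hd : ∀ i, d (Sum.inl i) = e (Sum.inl i)) (hd' : ∀ l, d (Sum.inr l) = 0) :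
    coeff e (atZero f) = coeff d f := by
  classical
  have hprod : ∀ c : Fin 2 ⊕ Fin p →₀ ℕ, (c.prod fun i k => zeroParam p i ^ k) =
      X (Sum.inl 0) ^ c (Sum.inl 0) * X (Sum.inl 1) ^ c (Sum.inl 1) *
        ∏ l : Fin p, (0 : StateSeries 0) ^ c (Sum.inr l) := by
    intro c
    rw [Finsupp.prod_fintype _ _ (by simp), Fintype.prod_sum_type, Fin.prod_univ_two]
    rfl
  rw [atZero_eq, coeff_subst hasSubst_zeroParam, finsum_eq_single _ d]
  · have h1 : (∏ l : Fin p, (0 : StateSeries 0) ^ d (Sum.inr l)) = 1 :=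
      Finset.prod_eq_one fun l _ => by rw [hd', pow_zero]
    rw [hprod, h1, mul_one, X_pow_eq, X_pow_eq, monomial_mul_monomial, coeff_monomial, if_pos]
    · simp
    · ext i
      rcases i with i | i
      · fin_cases i <;> simp [hd]
      · exact i.elim0
  · intro c hc
    rw [hprod]
    by_cases hl : ∃ l, c (Sum.inr l) ≠ 0
    · obtain ⟨l, hl⟩ := hl
      rw [Finset.prod_eq_zero (Finset.mem_univ l) (zero_pow hl)]
      simp
    · push Not at hl
      have h1 : (∏ l : Fin p, (0 : StateSeries 0) ^ c (Sum.inr l)) = 1 :=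
        Finset.prod_eq_one fun l _ => by rw [hl, pow_zero]
      rw [h1, mul_one, X_pow_eq, X_pow_eq, monomial_mul_monomial, coeff_monomial, if_neg, smul_zero]
      rintro rfl
      apply hc
      ext i
      rcases i with i | i
      · rw [hd]
        fin_cases i <;> simp
      · rw [hd', hl]

/-- The order of a series can be read off at `μ = 0` below the weight of the parameters. -/
theorem mem_serOrd_of_atZero {s W n : ℕ} (hn : n ≤ W) {f : StateSeries p}
    (hf : atZero f ∈ serOrd 0 s W n) : f ∈ serOrd p s W n := by
  classical
  refine mem_ordIdeal.2 fun d hd => ?_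
  -- A monomial containing a parameter already weighs at least `W ≥ n`.
  have hd' : ∀ l, d (Sum.inr l) = 0 := by
    intro l
    by_contra hl
    have h1 := Finsupp.weight_apply (w := stateWeight p s W) (f := d)
    have h2 : d (Sum.inr l) * W ≤ Finsupp.weight (stateWeight p s W) d := by
      rw [h1, Finsupp.sum_fintype _ _ (by simp)]
      exact Finset.single_le_sum (f := fun i => d i • stateWeight p s W i)
        (fun i _ => Nat.zero_le _) (Finset.mem_univ (Sum.inr l))
    have h3 : W ≤ d (Sum.inr l) * W := Nat.le_mul_of_pos_left _ (by omega)
    omega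
  set e : Fin 2 ⊕ Fin 0 →₀ ℕ := Finsupp.equivFunOnFinite.symm
    (Sum.elim (fun i => d (Sum.inl i)) Fin.elim0) with he
  rw [← coeff_atZero f e d (fun i => by simp [he]) hd']
  refine mem_ordIdeal.1 hf e ?_
  convert hd using 1
  rw [Finsupp.weight_apply, Finsupp.weight_apply, Finsupp.sum_fintype _ _ (by simp),
    Finsupp.sum_fintype _ _ (by simp), Fintype.sum_sum_type, Fintype.sum_sum_type]
  simp [he, hd', stateWeight]

/-- A transformation of the unperturbed system extends to its deformations. -/
theorem exists_carries_deformation (g : StateTimeChange 0) {v u : PVectorField 0}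
    (h : g.Carries v u) {w : PVectorField p} (hw : IsDeformation w v) :
    ∃ (g' : StateTimeChange p) (w' : PVectorField p), g'.Carries w w' ∧ IsDeformation w' u := by
  have hlin : ∀ (j : Fin 2) (f : StateSeries 0),
      constantCoeff (pderiv ℝ (Sum.inl j) (subst (addParam p) f)) =
        constantCoeff (pderiv ℝ (Sum.inl j) f) := by
    intro j f
    rw [← constantCoeff_atZero, atZero_pderiv, atZero_subst_addParam]
  let g' : StateTimeChange p :=
    { Φ := fun i => subst (addParam p) (g.Φ i)
      T := subst (addParam p) g.T
      Φ_zero := fun i => by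
        rw [constantCoeff_subst_of_zero constantCoeff_addParam]
        exact g.Φ_zero i
      Φ_inv := by
        have := g.Φ_inv
        simp only [← constantCoeff_pderiv, hlin] at this ⊢
        exact this
      T_inv := by
        rw [constantCoeff_subst_of_zero constantCoeff_addParam]
        exact g.T_inv }
  obtain ⟨w', hw'⟩ := g'.exists_carries w
  refine ⟨g', w', hw', fun i => ?_⟩
  -- At `μ = 0` the lifted change is `g` itself, so both fields satisfy one equation with invertible
  -- Jacobian.
  suffices h2 : (fun i => atZero (w' i)) = u from congrFun h2 i
  refine g.dirDeriv_injective ?_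
  rw [carries_iff_defect, defect, sub_eq_zero] at h
  rw [h]
  funext i
  have e := congrArg atZero (hw' i)
  have hs : HasSubst (zeroParam p) := hasSubst_zeroParam
  rw [atZero_eq, atZero_eq, subst_mul hs, ← coe_substAlgHom hs, map_sum] at e
  simp only [map_mul] at e
  simp only [coe_substAlgHom hs, ← atZero_eq, atZero_pderiv] at e
  have e1 : ∀ i, atZero (g'.Φ i) = g.Φ i := fun i => atZero_subst_addParam _
  have e2 : atZero g'.T = g.T := atZero_subst_addParam _
  simp only [e1, e2] at e
  refine e.trans ?_
  change _ = g.T * subst (extendParam g.Φ) (v i)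
  congr 1
  have hs' := hasSubst_extendParam g'.Φ_zero
  rw [← hw i, atZero_eq, atZero_eq]
  change subst (zeroParam p) (subst (extendParam g'.Φ) (w i)) = _
  rw [subst_comp_subst_apply hs' hs,
    subst_comp_subst_apply hs (hasSubst_extendParam g.Φ_zero)]
  congr 1
  funext l
  rcases l with l | l
  · change atZero (g'.Φ l) = subst (extendParam g.Φ) (X (Sum.inl l))
    rw [e1, subst_X (hasSubst_extendParam g.Φ_zero)]
    rfl
  · change subst (zeroParam p) (X (Sum.inr l)) = subst (extendParam g.Φ) 0
    rw [subst_X hs, ← coe_substAlgHom (hasSubst_extendParam g.Φ_zero), map_zero]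
    rfl

end Parameters

end PNF

namespace PNF

/-! ### The symmetry of the leading field, its flow and its effect on Hamiltonian terms. -/

noncomputable section Symmetry

variable {p : ℕ}

/-- A root of a series close to `1`. -/
theorem exists_root {σ : Type*} {w : σ → ℕ} {s M : ℕ} (hs : 1 ≤ s) (hM : 1 ≤ M)
    {U ν₀ : MvPowerSeries σ ℝ} (hU : U - 1 ∈ ordIdeal w 1) (hν₀ : ν₀ - 1 ∈ ordIdeal w 1)
    (h : ν₀ ^ s * U - 1 ∈ ordIdeal w M) :
    ∃ ν, ν - ν₀ ∈ ordIdeal w M ∧ ν ^ s * U = 1 := by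
  have hpow : ∀ (ν : MvPowerSeries σ ℝ) (k : ℕ), ν - 1 ∈ ordIdeal w 1 → ν ^ k - 1 ∈ ordIdeal w 1 :=
    fun ν k hν => Ideal.mem_of_dvd _ (by simpa using sub_dvd_pow_sub_pow ν 1 k) hν
  -- Near `1` the derivative of `ν ^ s * U` is `s` up to terms of positive order, so the iteration
  -- can divide by the constant `s`.
  have hexp : ∀ ν, ν - 1 ∈ ordIdeal w 1 → ∀ k, 1 ≤ k → ∀ δ ∈ ordIdeal w k,
      ((ν + δ) ^ s * U - 1) - (ν ^ s * U - 1) - (s : ℝ) • δ ∈ ordIdeal w (k + 1) := by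
    intro ν hν k hk δ hδ
    obtain ⟨R, hR⟩ := sq_dvd_add_pow_sub_sub δ ν s
    have e : ((ν + δ) ^ s * U - 1) - (ν ^ s * U - 1) - (s : ℝ) • δ =
        δ * δ * (R * U) + δ * ((ν ^ (s - 1) - 1) * (s * U)) + δ * ((U - 1) * s) := by
      rw [smul_eq_C_mul, map_natCast]
      have : (ν + δ) ^ s = δ ^ 2 * R + ν ^ (s - 1) * δ * s + ν ^ s := by rw [← hR]; ring
      rw [this]; ring
    rw [e]
    refine add_mem (add_mem ?_ ?_) ?_
    · exact Ideal.mul_mem_right _ _ (mul_mem_ordIdeal_of_le hδ hδ (by omega))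
    · exact mul_mem_ordIdeal_of_le hδ (Ideal.mul_mem_right _ _ (hpow ν _ hν)) le_rfl
    · exact mul_mem_ordIdeal_of_le hδ (Ideal.mul_mem_right _ _ hU) le_rfl
  have hsR : (s : ℝ) ≠ 0 := by
    have : s ≠ 0 := by omega
    exact_mod_cast this
  have hsmul : ∀ (c : ℝ) {f : MvPowerSeries σ ℝ} {k : ℕ}, f ∈ ordIdeal w k → c • f ∈ ordIdeal w k :=
    fun c f k hf => by
      rw [smul_eq_C_mul]
      exact Ideal.mul_mem_left _ _ hf
  have hnear : ∀ ν, ν - ν₀ ∈ ordIdeal w M → ν - 1 ∈ ordIdeal w 1 := fun ν hν => by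
    have := add_mem (ordIdeal_anti hM hν) hν₀
    rwa [sub_add_sub_cancel] at this
  suffices h' : ∃ ν, ν - ν₀ ∈ (ordIdeal w M).toAddSubgroup ∧ ν ^ s * U - 1 = 0 by
    obtain ⟨ν, h1, h2⟩ := h'
    exact ⟨ν, h1, sub_eq_zero.1 h2⟩
  refine exists_zero_of_step (fun k => (ordIdeal w k).toAddSubgroup)
    (fun k => (ordIdeal w k).toAddSubgroup) (fun k => (ordIdeal w k).toAddSubgroup)
    (fun ν => ν ^ s * U - 1) ν₀ M (fun a b hab f hf => ordIdeal_anti hab hf) ?_ (fun _ => le_rfl)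
    ?_ ?_ ?_ h
  · intro u hu
    obtain ⟨v, hv, -⟩ := exists_limit (l := 0) (φ := fun k => k) monotone_id (fun k => le_rfl) u hu
    exact ⟨v, hv⟩
  · intro v hv
    exact eq_zero_of_mem_ordIdeal fun n =>
      ordIdeal_anti (Nat.le_add_left n M) (hv (M + n) (Nat.le_add_right _ _))
  · intro ν hν k hk δ hδ
    have := add_mem (ordIdeal_anti (Nat.le_succ k) (hexp ν (hnear ν hν) k (by omega) δ hδ))
      (hsmul (s : ℝ) hδ)
    rwa [sub_add_cancel] at this
  · intro ν hν k hk hF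
    refine ⟨(-(s : ℝ)⁻¹) • (ν ^ s * U - 1), hsmul _ hF, ?_⟩
    have := hexp ν (hnear ν hν) k (by omega) _ (hsmul (-(s : ℝ)⁻¹) hF)
    rw [smul_smul, mul_neg, mul_inv_cancel₀ hsR] at this
    have e : (ν + (-(s : ℝ)⁻¹) • (ν ^ s * U - 1)) ^ s * U - 1 =
        (ν + (-(s : ℝ)⁻¹) • (ν ^ s * U - 1)) ^ s * U - 1 - (ν ^ s * U - 1) -
          (-1 : ℝ) • (ν ^ s * U - 1) := by
      module
    change _ ∈ ordIdeal w (k + 1)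
    rw [e]
    exact this

/-- The symmetry `x^s (x ∂/∂x + y ∂/∂y)` of the leading field. -/
def symField (p s : ℕ) : PVectorField p := ![x p ^ (s + 1), x p ^ s * y p]

theorem symField_mem {s W : ℕ} : symField p s ∈ fieldOrd p s W (s ^ 2 + s) := by
  have hx := x_mem_serOrd (p := p) (s := s) (W := W)
  have hy := y_mem_serOrd (p := p) (s := s) (W := W)
  refine pair_mem_fieldOrd (ordIdeal_anti ?_ (pow_mem_ordIdeal hx (s + 1)))
    (mul_mem_ordIdeal_of_le (pow_mem_ordIdeal hx s) hy ?_)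
  · exact le_of_eq (by ring)
  · exact le_of_eq (by ring)

/-- Since `leadDeriv` sends `x^s` to `s x^s y^s`, the Eulerian multiplier `leadDeriv s f - s y^s f`
vanishes for `f = x^s`. This is the degeneracy that excludes `k = s` from the resonances. -/
theorem linDefect_lead_symField {s : ℕ} (hs : 1 ≤ s) :
    linDefect (leadField p s) (symField p s) 0 0 = 0 := by
  rw [symField, linDefect_lead hs, leadDeriv_mul, leadDeriv_x_pow, leadDeriv_x_pow, leadDeriv_y]
  obtain ⟨t, rfl⟩ : ∃ t, s = t + 1 := ⟨s - 1, by omega⟩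
  funext i
  fin_cases i
  · simp; ring
  · simp; ring

/-- The flow of the symmetry preserves the leading field. -/
theorem exists_flow {s W : ℕ} (hs : 1 ≤ s) (c : ℝ) : ∃ Φ : PVectorField p,
    Φ - stateId p - c • symField p s ∈ fieldOrd p s W (2 * (s ^ 2 + s)) ∧
    dirDeriv Φ (leadField p s) = pull Φ (leadField p s) := by
  have hx := x_mem_serOrd (p := p) (s := s) (W := W)
  have hy := y_mem_serOrd (p := p) (s := s) (W := W)
  set z : StateSeries p := c • x p ^ s with hz
  have hzm : z ∈ serOrd p s W (s * (s + 1)) := smul_mem_serOrd c (pow_mem_ordIdeal hx s)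
  have h1 : 1 ≤ s * (s + 1) := Nat.mul_pos hs (Nat.succ_pos _)
  have hz1 : z ∈ serOrd p s W 1 := ordIdeal_anti h1 hzm
  -- The time `c` flow of `x^s (x ∂/∂x + y ∂/∂y)` multiplies both variables by `(1 - s c
  -- x^s)^(-1/s)`, which is `1 + c x^s` to first order.
  obtain ⟨ν, hν, hroot⟩ := exists_root (w := stateWeight p s W) (M := 2 * (s * (s + 1)))
    (U := 1 - s * z) (ν₀ := 1 + z) hs (by omega)
    (by simpa using neg_mem (Ideal.mul_mem_left _ (s : StateSeries p) hz1)) (by simpa using hz1) (by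
      obtain ⟨R, hR⟩ := sq_dvd_add_pow_sub_sub z 1 s
      have e : (1 + z) ^ s * (1 - s * z) - 1 = z * z * (R * (1 - s * z) - s * s) := by
        have : (1 + z) ^ s = z ^ 2 * R + z * s + 1 := by
          rw [← hR]; simp; ring
        rw [this]; ring
      rw [e]
      exact Ideal.mul_mem_right _ _ (mul_mem_ordIdeal_of_le hzm hzm (by omega)))
  have hν0 : ν ≠ 0 := by
    rintro rfl
    rw [zero_pow (by omega), zero_mul] at hroot
    exact zero_ne_one hroot
  have hsS : (s : StateSeries p) ≠ 0 := fun h => by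
    have := congrArg constantCoeff h
    simp only [map_natCast, map_zero, Nat.cast_eq_zero] at this
    omega
  have hD : leadDeriv s ν = y p ^ s * (ν ^ (s + 1) - ν) := by
    have h2 := congrArg (leadDeriv s) hroot
    have hpow : leadDeriv s (ν ^ s) = s * ν ^ (s - 1) * leadDeriv s ν := by
      simp only [leadDeriv, Derivation.leibniz_pow, nsmul_eq_mul, smul_eq_mul]; ring
    have hDz : leadDeriv s z = s * z * y p ^ s := by
      have : leadDeriv s z = c • leadDeriv s (x p ^ s) := by
        simp only [hz, leadDeriv, Derivation.map_smul, smul_mul_assoc, smul_add]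
      rw [this, leadDeriv_x_pow, hz, smul_eq_C_mul, smul_eq_C_mul]; ring
    have h1' : leadDeriv s (1 : StateSeries p) = 0 := by simpa using leadDeriv_natCast (p := p) s 1
    rw [leadDeriv_mul, leadDeriv_sub, leadDeriv_mul, leadDeriv_natCast, hpow, hDz, h1'] at h2
    obtain ⟨t, rfl⟩ : ∃ t, s = t + 1 := ⟨s - 1, by omega⟩
    simp only [Nat.add_sub_cancel] at h2
    have hmul : ((t + 1 : ℕ) : StateSeries p) * ν ^ t * (1 - (t + 1 : ℕ) * z) ≠ 0 := by
      refine mul_ne_zero (mul_ne_zero hsS (pow_ne_zero _ hν0)) fun h0 => ?_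
      rw [h0, mul_zero] at hroot
      exact zero_ne_one hroot
    refine mul_left_cancel₀ hmul ?_
    have e : ν ^ (t + 1 + 1) * (1 - (t + 1 : ℕ) * z) = ν := by
      rw [pow_succ, mul_right_comm, hroot, one_mul]
    linear_combination h2 - ((t + 1 : ℕ) : StateSeries p) * ν ^ t * y p ^ (t + 1) * e
  refine ⟨![x p * ν, y p * ν], ?_, ?_⟩
  · have hν' : ν - (1 + z) ∈ serOrd p s W (2 * (s ^ 2 + s)) := by
      rwa [show 2 * (s ^ 2 + s) = 2 * (s * (s + 1)) by ring]
    have e : ![x p * ν, y p * ν] - stateId p - c • symField p s =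
        ![x p * (ν - (1 + z)), y p * (ν - (1 + z))] := by
      funext i
      fin_cases i
      · change x p * ν - x p - c • x p ^ (s + 1) = x p * (ν - (1 + z))
        rw [hz, smul_eq_C_mul, smul_eq_C_mul]; ring
      · change y p * ν - y p - c • (x p ^ s * y p) = y p * (ν - (1 + z))
        rw [hz, smul_eq_C_mul, smul_eq_C_mul]; ring
    rw [e]
    exact pair_mem_fieldOrd (mul_mem_ordIdeal hx hν') (mul_mem_ordIdeal hy hν')
  · have hsub : HasSubst (extendParam ![x p * ν, y p * ν]) := by
      refine hasSubst_extendParam fun i => ?_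
      fin_cases i <;> simp [x, y]
    have hX : subst (extendParam ![x p * ν, y p * ν]) (x p) = x p * ν := subst_X hsub _
    have hY : subst (extendParam ![x p * ν, y p * ν]) (y p) = y p * ν := subst_X hsub _
    have hl0 : leadField p s 0 = x p * y p ^ s := by simp [leadField, normalField]
    have hl1 : leadField p s 1 = -x p + y p ^ (s + 1) := by
      simp only [leadField, normalField, Matrix.cons_val_one, Matrix.cons_val_fin_one]; ring
    have hld : ∀ (V : PVectorField p) (i : Fin 2),
        dirDeriv V (leadField p s) i = leadDeriv s (V i) := fun V i => by
      rw [dirDeriv_pair, hl0, hl1, leadDeriv]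
    funext i
    rw [hld]
    fin_cases i
    · change leadDeriv s (x p * ν) = subst (extendParam ![x p * ν, y p * ν]) (leadField p s 0)
      rw [hl0, leadDeriv_mul, leadDeriv_x, hD, ← coe_substAlgHom hsub, map_mul, map_pow,
        coe_substAlgHom hsub, hX, hY]
      ring
    · change leadDeriv s (y p * ν) = subst (extendParam ![x p * ν, y p * ν]) (leadField p s 1)
      rw [hl1, leadDeriv_mul, leadDeriv_y, hD, ← coe_substAlgHom hsub, map_add, map_neg, map_pow,
        coe_substAlgHom hsub, hX, hY]
      ring

theorem isParamSeries_one : IsParamSeries (1 : StateSeries p) := fun j => by simp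

/-- The first two terms are the effect of the symmetry on `y^(r+1) ∂/∂x` after its `ẏ` part has been
moved into `ẋ`. A two-term relation removes the monomial with `x^(s-1)`, and `x^s y^(r+1)` reduces
to a nonzero multiple of the power of `y`. -/
theorem source_mem_leadImage {s W r : ℕ} (hs : 1 ≤ s) (hr : 2 * s < r) :
    ∃ κ : ℝ, κ ≠ 0 ∧
      (s - r + s * (r + 2) : ℝ) • (x p ^ s * y p ^ (r + 1)) -
        (s * (s + r) : ℝ) • (x p ^ (s - 1) * y p ^ (r + s + 2)) -
        κ • y p ^ (r + s ^ 2 + s + 1) ∈ leadImage p s W (s ^ 2 + r - s) := by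
  have hone : (1 : StateSeries p) ∈ serOrd p s W 0 := mem_ordIdeal_zero _
  have hss : s ≤ s ^ 2 := Nat.le_self_pow two_ne_zero s
  have e1 : (s - 1) * (s + 1) + 1 = s ^ 2 := by
    obtain ⟨t, rfl⟩ : ∃ t, s = t + 1 := ⟨s - 1, by omega⟩
    simp only [Nat.add_sub_cancel]; ring
  have e2 : s * (s + 1) = s ^ 2 + s := by ring
  have h1 := two_term_mem_leadImage (m := s ^ 2 + r - s) hs isParamSeries_one hone (s - 1)
    (r - s + 1) (by omega) (by omega)
  obtain ⟨c, hc, h2⟩ := exists_ne_zero_sub_smul_mem_leadImage (m := s ^ 2 + r - s) hs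
    isParamSeries_one hone s (r + 1) le_rfl (by omega) (by omega)
  rw [show s - 1 + 1 = s by omega, show r - s + 1 + s = r + 1 by omega,
    show r - s + 1 + 2 * s + 1 = r + s + 2 by omega] at h1
  rw [show r + 1 + s * (s + 1) = r + s ^ 2 + s + 1 by ring] at h2
  have c1 : ((s - 1 : ℕ) : ℝ) = s - 1 := by rw [Nat.cast_sub hs]; simp
  have c2 : ((r - s + 1 : ℕ) : ℝ) = r - s + 1 := by
    rw [Nat.cast_add, Nat.cast_sub (by omega)]; simp
  have hr0 : (r : ℝ) ≠ 0 := by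
    have : r ≠ 0 := by omega
    exact_mod_cast this
  have hs2 : (s + 2 : ℝ) ≠ 0 := by positivity
  rw [c1, c2] at h1
  simp only [one_mul] at h1 h2
  -- Adding `s / 2` times the two-term relation leaves `x^s y^(r+1)` with the coefficient `-r (s +
  -- 2) / 2`.
  refine ⟨-(r / 2 * (s + 2)) * c, mul_ne_zero (neg_ne_zero.2
    (mul_ne_zero (div_ne_zero hr0 two_ne_zero) hs2)) hc, ?_⟩
  have h3 := sub_mem (Submodule.smul_mem _ (-(r / 2 * (s + 2)) : ℝ) h2)
    (Submodule.smul_mem _ (s / 2 : ℝ) h1)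
  convert h3 using 1
  module

/-- The first order effect of the symmetry on a Hamiltonian term. -/
theorem linDefect_symField {s r : ℕ} (hs : 1 ≤ s) :
    linDefect ![y p ^ (r + 1), 0] (symField p s) 0 0 =
      ![(s - r : ℝ) • (x p ^ s * y p ^ (r + 1)), (s : ℝ) • (x p ^ (s - 1) * y p ^ (r + 2))] := by
  obtain ⟨t, rfl⟩ : ∃ t, s = t + 1 := ⟨s - 1, by omega⟩
  funext i
  fin_cases i
  · simp [linDefect, dirDeriv_pair, symField, Derivation.leibniz_pow, smul_eq_C_mul]
    ring
  · simp [linDefect, dirDeriv_pair, symField, Derivation.leibniz, Derivation.leibniz_pow,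
      smul_eq_C_mul]
    ring

/-- The field `Q ∂/∂x`, with `Q` the `ẏ` part of the effect, moves that part into `ẋ`; the
hypothesis then solves the resulting scalar problem. -/
theorem exists_lead_of_source {s W r m : ℕ} (hs : 1 ≤ s) (hm : m + s = s ^ 2 + r) {κ : ℝ}
    (h : (s - r + s * (r + 2) : ℝ) • (x p ^ s * y p ^ (r + 1)) -
        (s * (s + r) : ℝ) • (x p ^ (s - 1) * y p ^ (r + s + 2)) -
        κ • y p ^ (r + s ^ 2 + s + 1) ∈ leadImage p s W m) :
    ∃ Y τ, Y ∈ fieldOrd p s W m ∧ τ ∈ serOrd p s W m ∧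
      linDefect (leadField p s) Y τ 0 = linDefect ![y p ^ (r + 1), 0] (symField p s) 0 0 -
        κ • ![y p ^ (r + s ^ 2 + s + 1), 0] := by
  have hx := x_mem_serOrd (p := p) (s := s) (W := W)
  have hy := y_mem_serOrd (p := p) (s := s) (W := W)
  obtain ⟨Y, τ, h1, h2, h3⟩ := mem_leadImage.1 h
  have e1 : (s - 1) * (s + 1) + 1 = s ^ 2 := by
    obtain ⟨t, rfl⟩ : ∃ t, s = t + 1 := ⟨s - 1, by omega⟩
    simp only [Nat.add_sub_cancel]; ring
  set Q : StateSeries p := (s : ℝ) • (x p ^ (s - 1) * y p ^ (r + 2)) with hQ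
  have hQm : Q ∈ serOrd p s W (s + 1 + m) := smul_mem_serOrd _
    (mul_mem_ordIdeal_of_le (pow_mem_ordIdeal hx _) (pow_mem_ordIdeal hy _) (by omega))
  refine ⟨Y + ![Q, 0], τ + 0, add_mem h1 (pair_mem_fieldOrd hQm (zero_mem _)),
    add_mem h2 (zero_mem _), ?_⟩
  have h4 := linDefect_add (leadField p s) Y ![Q, 0] τ 0 0 0
  rw [add_zero (0 : PVectorField p)] at h4
  rw [h4, h3, linDefect_lead hs, leadDeriv_zero, linDefect_symField hs]
  have hDQ : leadDeriv s Q = (s : StateSeries p) *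
      (leadDeriv s (x p ^ (s - 1)) * y p ^ (r + 2) + x p ^ (s - 1) * leadDeriv s (y p ^ (r + 2))) := by
    rw [hQ, smul_eq_C_mul, map_natCast, leadDeriv_mul, leadDeriv_mul, leadDeriv_natCast]; ring
  rw [leadDeriv_x_pow, leadDeriv_y_pow] at hDQ
  rw [hDQ]
  obtain ⟨t, rfl⟩ : ∃ t, s = t + 1 := ⟨s - 1, by omega⟩
  have h2' : (C 2 : StateSeries p) = 2 := map_ofNat _ 2
  funext i
  fin_cases i
  · simp [hQ, smul_eq_C_mul, h2']
    ring
  · simp [hQ]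

end Symmetry

end PNF

namespace PNF

/-! ### The near symmetry and the coefficient to be eliminated. -/

noncomputable section Elimination

variable {p : ℕ}

theorem normalField_eq (α β : StateSeries p) :
    normalField α β = normalField 0 β + ![α, 0] := by
  funext i
  fin_cases i <;> simp [normalField]

/-- A field whose leading order effect, as a transformation, is on the term `A^{-1}_{r + s² + s}`. -/
structure NearSymmetry (p s W r : ℕ) (α : StateSeries p) where
  -- Here `a` is the order of the Hamiltonian terms and `d` that of the corrections `Y`, `τ`. A
  -- field agreeing with the model up to degree `s + j` lets the corrections act accurately past
  -- degree `r + s²`, the degree of the extra term.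
  a : ℕ
  d : ℕ
  j : ℕ
  κ : ℝ
  Y : PVectorField p
  τ : StateSeries p
  α_mem : ![α, 0] ∈ fieldOrd p s W a
  lt_a : s + 1 ≤ a
  le_a : r + s ^ 2 + 1 ≤ a + 2 * (s ^ 2 + s)
  one_le_j : 1 ≤ j
  j_le : j ≤ s ^ 2 + s
  j_le' : j + 2 * s ≤ r + 1
  le_d : s ^ 2 + s ≤ d
  d_le : s + d ≤ r + s ^ 2
  le_d_add_j : r + s ^ 2 + 1 ≤ s + d + j
  κ_ne_zero : κ ≠ 0
  Y_mem : Y ∈ fieldOrd p s W d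
  τ_mem : τ ∈ serOrd p s W d
  linDefect_mem : linDefect (normalField α (y p ^ s)) (symField p s + Y) τ 0 -
    κ • ![y p ^ (r + s ^ 2 + s + 1), 0] ∈ fieldOrd p s W (r + s ^ 2 + 1)

/-- The Hamiltonian terms of index at most `r`. -/
def initialTerms (p s r : ℕ) (c₁ c₂ : ℝ) : StateSeries p :=
  c₁ • y p ^ (s ^ 2 + 3 * s + 1) + c₂ • y p ^ (r + 1)

theorem linDefect_base_smul (c : ℝ) (u Y : PVectorField p) :
    linDefect (c • u) Y 0 0 = c • linDefect u Y 0 0 := by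
  funext i
  simp only [linDefect, dirDeriv, Pi.sub_apply, Pi.smul_apply, Pi.zero_apply, zero_add, zero_smul,
    sub_zero, Fin.sum_univ_two, Derivation.map_smul]
  simp only [smul_eq_C_mul]
  ring

theorem y_pow_mem {s W : ℕ} (n : ℕ) : y p ^ n ∈ serOrd p s W n := by
  simpa using pow_mem_ordIdeal (y_mem_serOrd (p := p) (s := s) (W := W)) n

/-- As the symmetry annihilates the leading field, its effect starts with the Hamiltonian terms. The
part due to `c₂` is corrected to a nonzero multiple of the extra term. The part due to `c₁` lands on
the index `2s² + 4s`, resonant with `k = 2s`, and can be cancelled completely. -/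
theorem nonempty_nearSymmetry {s W r : ℕ} (hs : 1 ≤ s) (hr : 2 * s < r) {c₁ c₂ : ℝ} (hc₂ : c₂ ≠ 0)
    (h : c₁ = 0 ∨ (s ^ 2 + 3 * s < r ∧ r < 2 * s ^ 2 + 4 * s)) :
    Nonempty (NearSymmetry p s W r (initialTerms p s r c₁ c₂)) := by
  have hss : s ≤ s ^ 2 := Nat.le_self_pow two_ne_zero s
  obtain ⟨κ, hκ, hsrc⟩ := source_mem_leadImage (p := p) (W := W) hs hr
  obtain ⟨Y₂, τ₂, hY₂, hτ₂, hL₂⟩ := exists_lead_of_source hs (by omega) hsrc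
  obtain ⟨κ', -, hsrc'⟩ := source_mem_leadImage (p := p) (W := W) (r := s ^ 2 + 3 * s) hs (by omega)
  have hres := resonant_mem_leadImage (p := p) (W := W) (k := 2 * s) (m := s ^ 2 + (s ^ 2 + 3 * s) - s)
    hs isParamSeries_one (mem_ordIdeal_zero _) (by omega) (by omega)
    (le_of_eq (by rw [show s ^ 2 + (s ^ 2 + 3 * s) - s = 2 * s ^ 2 + 2 * s by omega]; ring))
  rw [one_mul, show 2 * s * (s + 1) + 2 * s + 1 = s ^ 2 + 3 * s + s ^ 2 + s + 1 by ring] at hres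
  obtain ⟨Y₁, τ₁, hY₁, hτ₁, hL₁⟩ := exists_lead_of_source (p := p) (W := W)
    (r := s ^ 2 + 3 * s) (κ := 0) hs
    (by omega : (s ^ 2 + (s ^ 2 + 3 * s) - s) + s = s ^ 2 + (s ^ 2 + 3 * s)) (by
      have := add_mem hsrc' (Submodule.smul_mem _ κ' hres)
      rwa [sub_add_cancel, ← sub_zero (_ - _ : StateSeries p),
        ← zero_smul ℝ (y p ^ (s ^ 2 + 3 * s + s ^ 2 + s + 1))] at this)
  set A : PVectorField p := ![initialTerms p s r c₁ c₂, 0] with hA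
  have hAe : A = c₁ • ![y p ^ (s ^ 2 + 3 * s + 1), 0] + c₂ • ![y p ^ (r + 1), 0] := by
    funext i
    fin_cases i <;> simp [hA, initialTerms]
  have hA₁ : ![y p ^ (s ^ 2 + 3 * s + 1), 0] ∈ fieldOrd p s W (s ^ 2 + 2 * s) :=
    pair_mem_fieldOrd (ordIdeal_anti (by omega) (y_pow_mem _)) (zero_mem _)
  have hA₂ : ![y p ^ (r + 1), 0] ∈ fieldOrd p s W (r - s) :=
    pair_mem_fieldOrd (ordIdeal_anti (by omega) (y_pow_mem _)) (zero_mem _)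
  set Y₀ : PVectorField p := (-c₁) • Y₁ + (-c₂) • Y₂ with hY₀
  set τ₀ : StateSeries p := (-c₁) • τ₁ + (-c₂) • τ₂ with hτ₀
  have hlin : linDefect (normalField (initialTerms p s r c₁ c₂) (y p ^ s)) (symField p s + Y₀) τ₀ 0 -
      (c₂ * κ) • ![y p ^ (r + s ^ 2 + s + 1), 0] = linDefect A Y₀ τ₀ 0 := by
    have e1 := linDefect_add (normalField (initialTerms p s r c₁ c₂) (y p ^ s)) (symField p s) Y₀ 0 τ₀
      0 0
    have e2 := linDefect_add (leadField p s) ((-c₁) • Y₁) ((-c₂) • Y₂) ((-c₁) • τ₁) ((-c₂) • τ₂)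
      ((-c₁) • 0) ((-c₂) • 0)
    rw [linDefect_smul, linDefect_smul, hL₁, hL₂] at e2
    simp only [smul_zero, add_zero, zero_add] at e1 e2
    rw [e1, normalField_eq, ← hA]
    change linDefect (leadField p s + A) _ _ _ + linDefect (leadField p s + A) _ _ _ - _ = _
    rw [linDefect_base_add, linDefect_base_add, linDefect_lead_symField hs, e2, hAe,
      linDefect_base_add (c₁ • _), linDefect_base_smul, linDefect_base_smul]
    module
  have hlead : ∀ a d, A ∈ fieldOrd p s W a → Y₀ ∈ fieldOrd p s W d → τ₀ ∈ serOrd p s W d →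
      linDefect A Y₀ τ₀ 0 ∈ fieldOrd p s W (a + d) :=
    fun a d h1 h2 h3 => PNF.linDefect_mem h1 h2 h3 (zero_mem _)
  have hκ' : c₂ * κ ≠ 0 := mul_ne_zero hc₂ hκ
  rcases h with h | ⟨h, h'⟩
  -- The remainder has order `(r - s) + (s² + r - s)`, beyond `r + s²` because `2s < r`.
  · have m1 : A ∈ fieldOrd p s W (r - s) := by
      rw [hAe, h, zero_smul, zero_add]
      exact real_smul_mem_fieldOrd _ hA₂
    have m2 : Y₀ ∈ fieldOrd p s W (s ^ 2 + r - s) := by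
      rw [hY₀, h, neg_zero, zero_smul, zero_add]
      exact real_smul_mem_fieldOrd _ hY₂
    have m3 : τ₀ ∈ serOrd p s W (s ^ 2 + r - s) := by
      rw [hτ₀, h, neg_zero, zero_smul, zero_add]
      exact smul_mem_serOrd _ hτ₂
    exact ⟨{ a := r - s, d := s ^ 2 + r - s, j := 1, κ := c₂ * κ, Y := Y₀, τ := τ₀
             α_mem := m1, lt_a := by omega, le_a := by omega, one_le_j := le_rfl, j_le := by omega
             j_le' := by omega, le_d := by omega, d_le := by omega, le_d_add_j := by omega
             κ_ne_zero := hκ', Y_mem := m2, τ_mem := m3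
             linDefect_mem := by
              rw [hlin]
              exact fieldOrd_anti (by omega) (hlead _ _ m1 m2 m3) }⟩
  -- The remainder has order `(s² + 2s) + (2s² + 2s)`, which exceeds `r + s²` precisely because `r <
  -- 2s² + 4s`.
  · have m1 : A ∈ fieldOrd p s W (s ^ 2 + 2 * s) := by
      rw [hAe]
      exact add_mem (real_smul_mem_fieldOrd _ hA₁)
        (real_smul_mem_fieldOrd _ (fieldOrd_anti (by omega) hA₂))
    have m2 : Y₀ ∈ fieldOrd p s W (2 * s ^ 2 + 2 * s) :=
      add_mem (real_smul_mem_fieldOrd _ (fieldOrd_anti (by omega) hY₁))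
        (real_smul_mem_fieldOrd _ (fieldOrd_anti (by omega) hY₂))
    have m3 : τ₀ ∈ serOrd p s W (2 * s ^ 2 + 2 * s) :=
      add_mem (smul_mem_serOrd _ (ordIdeal_anti (by omega) hτ₁))
        (smul_mem_serOrd _ (ordIdeal_anti (by omega) hτ₂))
    exact ⟨{ a := s ^ 2 + 2 * s, d := 2 * s ^ 2 + 2 * s, j := s ^ 2 + s, κ := c₂ * κ, Y := Y₀, τ := τ₀
             α_mem := m1, lt_a := by omega, le_a := by omega, one_le_j := by omega, j_le := by omega
             j_le' := by omega, le_d := by omega, d_le := by omega, le_d_add_j := by omega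
             κ_ne_zero := hκ', Y_mem := m2, τ_mem := m3
             linDefect_mem := by
              rw [hlin]
              exact fieldOrd_anti (by omega) (hlead _ _ m1 m2 m3) }⟩

/-- The coefficient of `y ^ n` in the part of `f` free of `x`, a series in the parameters. -/
def yCoeff (n : ℕ) (f : StateSeries p) : StateSeries p := fun d =>
  if d (Sum.inl 0) = 0 ∧ d (Sum.inl 1) = 0 then coeff (d + Finsupp.single (Sum.inl 1) n) f else 0

theorem coeff_yCoeff (n : ℕ) (f : StateSeries p) (d : Fin 2 ⊕ Fin p →₀ ℕ) :
    coeff d (yCoeff n f) = if d (Sum.inl 0) = 0 ∧ d (Sum.inl 1) = 0 then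
      coeff (d + Finsupp.single (Sum.inl 1) n) f else 0 := rfl

theorem isParamSeries_yCoeff (n : ℕ) (f : StateSeries p) : IsParamSeries (yCoeff n f) := fun j => by
  ext d
  rw [coeff_pderiv, coeff_yCoeff, if_neg, zero_mul, map_zero]
  fin_cases j <;> simp

theorem coeff_mul_y_pow (n : ℕ) (f : StateSeries p) (d : Fin 2 ⊕ Fin p →₀ ℕ) :
    coeff d (f * y p ^ n) =
      if n ≤ d (Sum.inl 1) then coeff (d - Finsupp.single (Sum.inl 1) n) f else 0 := by
  rw [y, X_pow_eq, coeff_mul_monomial, mul_one]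
  simp only [Finsupp.single_le_iff]

theorem sub_yCoeff_mem {A : Set ℕ} (n : ℕ) {f : StateSeries p} (hf : f ∈ ySupported p A) :
    f - yCoeff n f * y p ^ n ∈ ySupported p (A \ {n}) := by
  intro d hd
  rw [map_sub, coeff_mul_y_pow, coeff_yCoeff]
  by_cases h0 : d (Sum.inl 0) = 0
  · by_cases h1 : d (Sum.inl 1) = n
    · have e : d - Finsupp.single (Sum.inl 1) n + Finsupp.single (Sum.inl 1) n = d :=
        tsub_add_cancel_of_le (by simp [h1])
      rw [if_pos h1.ge, if_pos (by simp [h0, h1]), e, sub_self]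
    · have h2 : coeff d f = 0 := hf d fun h => hd ⟨h0, h.2, h1⟩
      rw [h2]
      by_cases h3 : n ≤ d (Sum.inl 1)
      · rw [if_pos h3, if_neg, sub_zero]
        simp; omega
      · rw [if_neg h3, sub_zero]
  · have h2 : coeff d f = 0 := hf d fun h => h0 h.1
    rw [h2]
    split_ifs with h3 h4
    · exact absurd (by simpa using h4.1) h0
    all_goals simp

theorem yCoeff_mem {s W k n m : ℕ} (hk : k ≤ m - n) {f : StateSeries p}
    (hf : f ∈ serOrd p s W m) : yCoeff n f ∈ serOrd p s W k := by
  rw [mem_ordIdeal]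
  intro d hd
  rw [coeff_yCoeff]
  split_ifs
  · refine mem_ordIdeal.1 hf _ ?_
    have : Finsupp.weight (stateWeight p s W) (Finsupp.single (Sum.inl 1) n) = n := by
      simp [Finsupp.weight_single, stateWeight]
    rw [map_add, this]
    omega
  · rfl

end Elimination

end PNF

namespace PNF

/-! ### Removal of the higher order terms and of the extra term. -/

noncomputable section NormalForm

variable {p : ℕ}

/-- Parameter series are constants for the state derivatives. So the near symmetry may be multiplied
by any coefficient depending on the parameters only. -/
theorem IsParamSeries.linDefect_smul {q : StateSeries p} (hq : IsParamSeries q)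
    (u Y : PVectorField p) (τ : StateSeries p) :
    linDefect u (q • Y) (q * τ) 0 = q • linDefect u Y τ 0 := by
  funext i
  have h0 := hq 0
  have h1 := hq 1
  simp only [linDefect, dirDeriv, Pi.sub_apply, Pi.smul_apply, zero_add, smul_eq_mul, Fin.sum_univ_two, Derivation.leibniz, h0, h1]
  ring

/-- The iteration based on the leading field has no loss. Approximate data with defect of order `s +
M` are changed only from relative order `M` on, so lower terms arranged beforehand survive. -/
theorem exists_carries_normalField {s W M : ℕ} (hs : 1 ≤ s) (hW : W ≠ 0) (hM : 1 ≤ M)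
    {w Φ₀ : PVectorField p} {T₀ α₀ β₀ : StateSeries p}
    (hw : w - leadField p s ∈ fieldOrd p s W (s + 1))
    (hΦ₀ : Φ₀ - stateId p ∈ fieldOrd p s W 1) (hT₀ : T₀ - 1 ∈ serOrd p s W 1)
    (hn₀ : normalField α₀ β₀ - leadField p s ∈ fieldOrd p s W (s + 1))
    (hdef : defect w Φ₀ T₀ (normalField α₀ β₀) ∈ fieldOrd p s W (s + M)) :
    ∃ (g : StateTimeChange p) (α β : StateSeries p), g.Carries w (normalField α β) ∧
      α - α₀ ∈ serOrd p s W (2 * s + 1 + M) ∧ α - α₀ ∈ ySupported p (allowedExps s) ∧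
      β - β₀ ∈ serOrd p s W (s + M) ∧ β - β₀ ∈ ySupported p (eulerExps s) := by
  obtain ⟨Φ, T, α, β, h1, h2, h3, h4, h5, h6, h7⟩ := exists_normalField (l := 0) hW (allowedExps s)
    (by omega) leadField_mem hw hΦ₀ hT₀ hn₀ hdef (fun m _ V hV => exists_step hs hW hV)
  obtain ⟨g, rfl, rfl⟩ := exists_stateTimeChange (s := s) (W := W) (Φ := Φ) (T := T)
    (by
      have := add_mem (fieldOrd_anti hM h1) hΦ₀
      rwa [sub_add_sub_cancel] at this)
    (by
      have := add_mem (ordIdeal_anti hM h2) hT₀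
      rwa [sub_add_sub_cancel] at this)
  exact ⟨g, α, β, carries_iff_defect.2 h7, h3, h4, h5, h6⟩

theorem normalField_sub (α β α' β' : StateSeries p) :
    normalField α β - normalField α' β' = normalDir (α - α') (β - β') := by
  have := normalField_add α' β' (α - α') (β - β')
  rw [add_sub_cancel, add_sub_cancel] at this
  rw [this, add_sub_cancel_left]

theorem normalField_sub_leadField_mem {s W a : ℕ} {α : StateSeries p} (ha : s + 1 ≤ a)
    (hα : ![α, 0] ∈ fieldOrd p s W a) :
    normalField α (y p ^ s) - leadField p s ∈ fieldOrd p s W (s + 1) := by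
  rw [normalField_eq, leadField, add_sub_cancel_left]
  exact fieldOrd_anti ha hα

/-- The higher order terms outside the normal form are removed. -/
theorem exists_carries_initial {s W r : ℕ} (hs : 1 ≤ s) (hW : W ≠ 0) (hr : 2 * s < r)
    {α₀ : StateSeries p} (S : NearSymmetry p s W r α₀) {w : PVectorField p}
    (hw : w - normalField α₀ (y p ^ s) ∈ fieldOrd p s W (r - s + 1)) :
    ∃ (g : StateTimeChange p) (α β : StateSeries p), g.Carries w (normalField α β) ∧
      α - α₀ ∈ serOrd p s W (r + 2) ∧ α - α₀ ∈ ySupported p (allowedExps s) ∧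
      β - y p ^ s ∈ serOrd p s W (r - s + 1) ∧ β - y p ^ s ∈ ySupported p (eulerExps s) := by
  have h1 := normalField_sub_leadField_mem S.lt_a S.α_mem
  -- With this `M`, `s + M = r - s + 1` is the first degree beyond that of `A^{-1}_r`.
  obtain ⟨g, α, β, h2, h3, h4, h5, h6⟩ := exists_carries_normalField (M := r - 2 * s + 1)
    (w := w) (Φ₀ := stateId p) (T₀ := 1) hs hW (by omega) (by
      have := add_mem (fieldOrd_anti (by omega) hw) h1
      rwa [sub_add_sub_cancel] at this) (by simp) (by simp) h1 (by
      rw [defect, dirDeriv_stateId, pull_stateId, one_smul, ← neg_sub w]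
      exact neg_mem (fieldOrd_anti (by omega) hw))
  exact ⟨g, α, β, h2, ordIdeal_anti (by omega) h3, h4, ordIdeal_anti (by omega) h5, h6⟩

/-- The effect of the flow of the symmetry. -/
theorem defect_flow_sub_mem {s W r : ℕ} (hs : 1 ≤ s) (hW : W ≠ 0) {α₀ : StateSeries p}
    (S : NearSymmetry p s W r α₀) {w Φ : PVectorField p} {c : ℝ}
    (hw : w - normalField α₀ (y p ^ s) ∈ fieldOrd p s W (r - s + 1)) (hsr : s ≤ r)
    (hΦ : Φ - stateId p - c • symField p s ∈ fieldOrd p s W (2 * (s ^ 2 + s)))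
    (hflow : dirDeriv Φ (leadField p s) = pull Φ (leadField p s)) :
    defect w Φ 1 w - c • linDefect (normalField α₀ (y p ^ s)) (symField p s) 0 0 ∈
      fieldOrd p s W (r + s ^ 2 + 1) := by
  set A : PVectorField p := ![α₀, 0] with hA
  have hAm := S.α_mem
  rw [← hA] at hAm
  have hale := S.le_a
  set ρ := w - normalField α₀ (y p ^ s) with hρ
  set Q := Φ - stateId p - c • symField p s with hQ
  set P := Φ - stateId p with hP
  have hΦe : Φ = stateId p + P := by rw [hP]; abel
  have hPe : P = c • symField p s + Q := by rw [hQ]; abel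
  have hPm : P ∈ fieldOrd p s W (s ^ 2 + s) := by
    rw [hPe]
    exact add_mem (real_smul_mem_fieldOrd c symField_mem) (fieldOrd_anti (by omega) hΦ)
  have hΦ0 : Φ ∈ fieldOrd p s W 0 := by
    rw [hΦe]
    exact add_mem stateId_mem (fieldOrd_anti (Nat.zero_le _) hPm)
  have hc := constantCoeff_of_mem_fieldOrd hΦ0
  have hwe : w = leadField p s + (A + ρ) := by
    rw [hρ, normalField_eq]
    change w = leadField p s + (A + (w - (leadField p s + A)))
    abel
  have hZ : c • linDefect (normalField α₀ (y p ^ s)) (symField p s) 0 0 =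
      dirDeriv (c • symField p s) A - dirDeriv A (c • symField p s) := by
    rw [normalField_eq]
    change c • linDefect (leadField p s + A) _ _ _ = _
    rw [linDefect_base_add, linDefect_lead_symField hs, zero_add]
    have := linDefect_smul c A (symField p s) 0 0
    rw [← this]
    simp [linDefect]
  -- The leading field drops out because `Φ` preserves it exactly. There remain the higher part of
  -- the flow acting on `A`, the flow acting on `ρ`, and a Taylor remainder.
  have e : defect w Φ 1 w - c • linDefect (normalField α₀ (y p ^ s)) (symField p s) 0 0 =
      dirDeriv Q A + dirDeriv P ρ - (pull Φ ρ - pull (stateId p) ρ) -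
      (pull (stateId p + P) A - pull (stateId p) A - dirDeriv A P) - dirDeriv A Q := by
    rw [hZ, ← hΦe]
    have e1 : defect w Φ 1 w = dirDeriv Φ (A + ρ) - pull Φ (A + ρ) := by
      simp only [defect, one_smul]
      rw [hwe, dirDeriv_add_right, pull_add hc, hflow]
      abel
    rw [e1, pull_add hc, pull_stateId, pull_stateId]
    conv_lhs => enter [1, 1]; rw [hΦe]
    simp only [dirDeriv_add_left, dirDeriv_add_right, dirDeriv_stateId]
    conv_lhs => rw [hPe]
    simp only [dirDeriv_add_left]
    rw [show dirDeriv A P = dirDeriv A (c • symField p s) + dirDeriv A Q by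
      rw [← dirDeriv_add_right, ← hPe]]
    rw [show dirDeriv P ρ = dirDeriv (c • symField p s) ρ + dirDeriv Q ρ by
      rw [← dirDeriv_add_left, ← hPe]]
    abel
  rw [e]
  refine sub_mem (sub_mem (sub_mem (add_mem ?_ ?_) ?_) ?_) ?_
  · exact dirDeriv_mem hΦ hAm (by omega)
  · exact dirDeriv_mem hPm hw (by omega)
  · exact fieldOrd_anti (by omega) (pull_sub_pull_mem hΦ0 stateId_mem hPm hw)
  · refine fieldOrd_anti ?_ (pull_taylor_mem (j := s ^ 2 + s) hW le_rfl (by simp) hPm hAm)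
    omega
  · exact dirDeriv_mem hAm hΦ (by omega)

/-- The extra term is removed at the origin of the parameter space. -/
theorem exists_carries_extra {s W r : ℕ} (hs : 1 ≤ s) (hW : W ≠ 0) (hr : 2 * s < r)
    {α₀ α β : StateSeries p} (S : NearSymmetry p s W r α₀)
    (hα : α - α₀ ∈ serOrd p s W (r + 2)) (hβ : β - y p ^ s ∈ serOrd p s W (r - s + 1)) :
    ∃ (g : StateTimeChange p) (α' β' : StateSeries p) (t : ℝ),
      (t = coeff (Finsupp.single (Sum.inl 1) (r + s ^ 2 + s + 1)) α) ∧
      g.Carries (normalField α β) (normalField α' β') ∧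
      α' - (α - t • y p ^ (r + s ^ 2 + s + 1)) ∈ serOrd p s W (r + s ^ 2 + s + 2) ∧
      α' - (α - t • y p ^ (r + s ^ 2 + s + 1)) ∈ ySupported p (allowedExps s) ∧
      β' - β ∈ serOrd p s W (r - s + 1) ∧ β' - β ∈ ySupported p (eulerExps s) := by
  have hss : s ≤ s ^ 2 := Nat.le_self_pow two_ne_zero s
  obtain ⟨t, ht⟩ : ∃ t, t = coeff (Finsupp.single (Sum.inl 1) (r + s ^ 2 + s + 1)) α := ⟨_, rfl⟩
  set c : ℝ := t / S.κ with hc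
  -- The exact flow is needed: with only the first order part of the flow, the quadratic error on
  -- the leading field has order `s + 2(s² + s)`, which need not exceed `r + s²`.
  obtain ⟨Φ, hΦ, hflow⟩ := exists_flow (p := p) (W := W) hs c
  have hj := S.j_le
  have hj' := S.j_le'
  have hj1 := S.one_le_j
  have hd := S.le_d
  have hd' := S.d_le
  have hdj := S.le_d_add_j
  have hu := normalField_sub_leadField_mem S.lt_a S.α_mem
  have hum : normalField α₀ (y p ^ s) ∈ fieldOrd p s W s := by
    have := add_mem (fieldOrd_anti (Nat.le_succ s) hu) leadField_mem
    rwa [sub_add_cancel] at this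
  have hw : normalField α β - normalField α₀ (y p ^ s) ∈ fieldOrd p s W (r - s + 1) := by
    rw [normalField_sub]
    exact normalDir_mem (ordIdeal_anti (by omega) hα) hβ
  have hwj := fieldOrd_anti (by omega : s + S.j ≤ r - s + 1) hw
  have hΦm : Φ - stateId p ∈ fieldOrd p s W (s ^ 2 + s) := by
    have := add_mem (fieldOrd_anti (by omega) hΦ)
      (real_smul_mem_fieldOrd c (symField_mem (p := p) (s := s) (W := W)))
    rwa [sub_add_cancel] at this
  set ω : PVectorField p := normalDir (-(t • y p ^ (r + s ^ 2 + s + 1))) 0 with hω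
  have hωm : ω ∈ fieldOrd p s W (s + S.d) :=
    normalDir_mem (neg_mem (smul_mem_serOrd _ (ordIdeal_anti (by omega) (y_pow_mem _)))) (zero_mem _)
  have hnf : normalField (α - t • y p ^ (r + s ^ 2 + s + 1)) β = normalField α β + ω := by
    rw [hω, ← normalField_add, add_zero, sub_eq_add_neg]
  have hwl : normalField α β - leadField p s ∈ fieldOrd p s W (s + 1) := by
    have := add_mem (fieldOrd_anti (by omega) hw) hu
    rwa [sub_add_sub_cancel] at this
  -- The starting data are the flow plus `c` times the corrections, and the target lacks the extra
  -- term. Here `s + M = r + s² + 1` is one past its degree, so the remaining iteration cannot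
  -- recreate it.
  obtain ⟨g, α', β', h2, h3, h4, h5, h6⟩ := exists_carries_normalField
    (M := r + s ^ 2 - s + 1) (w := normalField α β) (Φ₀ := Φ + c • S.Y) (T₀ := 1 + c • S.τ)
    (α₀ := α - t • y p ^ (r + s ^ 2 + s + 1)) (β₀ := β) hs hW (by omega) hwl (by
      rw [add_sub_right_comm]
      exact add_mem (fieldOrd_anti (by omega) hΦm)
        (real_smul_mem_fieldOrd c (fieldOrd_anti (by omega) S.Y_mem))) (by
      rw [add_sub_cancel_left]
      exact smul_mem_serOrd c (ordIdeal_anti (by omega) S.τ_mem)) (by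
      rw [hnf, add_sub_right_comm]
      exact add_mem hwl (fieldOrd_anti (by omega) hωm)) (by
      rw [hnf]
      have h1 := defect_add_sub_mem hW (by omega : S.j ≤ S.d) hum hwj hwj
        (fieldOrd_anti hj hΦm) (by simp : (1 : StateSeries p) - 1 ∈ serOrd p s W S.j)
        (real_smul_mem_fieldOrd c S.Y_mem) (smul_mem_serOrd c S.τ_mem) hωm
      have h2 := defect_flow_sub_mem hs hW S hw (by omega) hΦ hflow
      have h3 := real_smul_mem_fieldOrd c S.linDefect_mem
      have h4 := add_mem (add_mem (fieldOrd_anti (by omega :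
        s + (r + s ^ 2 - s + 1) ≤ s + S.d + S.j) h1)
        (fieldOrd_anti (by omega : s + (r + s ^ 2 - s + 1) ≤ r + s ^ 2 + 1) h2))
        (fieldOrd_anti (by omega : s + (r + s ^ 2 - s + 1) ≤ r + s ^ 2 + 1) h3)
      have e1 := linDefect_add (normalField α₀ (y p ^ s)) (symField p s) S.Y 0 S.τ 0 0
      have e2 := linDefect_smul c (normalField α₀ (y p ^ s)) S.Y S.τ 0
      have e3 := linDefect_add (normalField α₀ (y p ^ s)) (c • S.Y) 0 (c • S.τ) 0 0 ω
      have e4 : linDefect (normalField α₀ (y p ^ s)) 0 0 ω = ω := by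
        funext i
        simp [linDefect, dirDeriv]
      have e5 : ω = -((c * S.κ) • ![y p ^ (r + s ^ 2 + s + 1), 0]) := by
        rw [hc, div_mul_cancel₀ _ S.κ_ne_zero]
        funext i
        fin_cases i <;> simp [hω, normalDir]
      simp only [zero_add, add_zero, smul_zero] at e1 e2 e3
      rw [e1, e3, e2, e4] at h4
      generalize defect (normalField α β) (Φ + c • S.Y) (1 + c • S.τ) (normalField α β + ω) = D
        at h4 ⊢
      convert h4 using 1
      rw [e5]
      module)
  exact ⟨g, α', β', t, ht, h2, ordIdeal_anti (by omega) h3, h4, ordIdeal_anti (by omega) h5, h6⟩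

/-- The homological equation, with the extra term removed by the near symmetry. -/
theorem NearSymmetry.exists_step {s W r m : ℕ} (hs : 1 ≤ s) (hW : W ≠ 0) (hr : 2 * s < r)
    {α₀ : StateSeries p} (S : NearSymmetry p s W r α₀) (hm : r + s ^ 2 ≤ m + s) {V : PVectorField p}
    (hV : V ∈ fieldOrd p s W (s + m)) : ∃ Y τ a b,
      Y ∈ fieldOrd p s W (m - (r - 2 * s)) ∧ τ ∈ serOrd p s W (m - (r - 2 * s)) ∧
      a ∈ serOrd p s W (2 * s + 1 + m) ∧ b ∈ serOrd p s W (s + m) ∧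
      a ∈ ySupported p (allowedExps s \ {r + s ^ 2 + s + 1}) ∧ b ∈ ySupported p (eulerExps s) ∧
      linDefect (normalField α₀ (y p ^ s)) Y τ (normalDir a b) - V ∈
        fieldOrd p s W (s + m + 1) := by
  have hss : s ≤ s ^ 2 := Nat.le_self_pow two_ne_zero s
  obtain ⟨Y, τ, a, b, hY, hτ, ha, hb, ha', hb', h⟩ := PNF.exists_step hs hW hV
  set E := r + s ^ 2 + s + 1 with hE
  set η := yCoeff E a with hη
  have hηm : η ∈ serOrd p s W (m + s - (r + s ^ 2)) := yCoeff_mem (by omega) ha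
  have hηy : η * y p ^ E ∈ serOrd p s W (2 * s + 1 + m) :=
    mul_mem_ordIdeal_of_le hηm (y_pow_mem _) (by omega)
  -- The coefficient of `y^E` in the normal form direction is traded for `q` times the near
  -- symmetry. Since `q` has order `m + s - (r + s²)` and the symmetry degree `s² + s`, the step
  -- loses `r - 2s` orders.
  set q : StateSeries p := (S.κ)⁻¹ • η with hq
  have hqm : q ∈ serOrd p s W (m + s - (r + s ^ 2)) := smul_mem_serOrd _ hηm
  have hqp : IsParamSeries q := fun j => by
    rw [hq, Derivation.map_smul, isParamSeries_yCoeff, smul_zero]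
  have hd := S.le_d
  have hd' := S.d_le
  have hlt := S.lt_a
  refine ⟨Y + q • (symField p s + S.Y), τ + q * S.τ, a - η * y p ^ E, b,
    add_mem (fieldOrd_anti (by omega) hY) (smul_mem_fieldOrd hqm
      (add_mem symField_mem (fieldOrd_anti hd S.Y_mem)) (by omega)),
    add_mem (ordIdeal_anti (by omega) hτ) (mul_mem_ordIdeal_of_le hqm S.τ_mem (by omega)),
    sub_mem ha hηy, hb, sub_yCoeff_mem E ha', hb', ?_⟩
  have e1 := linDefect_add (normalField α₀ (y p ^ s)) Y (q • (symField p s + S.Y)) τ (q * S.τ)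
    (normalDir (a - η * y p ^ E) b) 0
  rw [add_zero, hqp.linDefect_smul] at e1
  have e2 : linDefect (normalField α₀ (y p ^ s)) Y τ (normalDir (a - η * y p ^ E) b) =
      linDefect (leadField p s) Y τ (normalDir a b) - ![η * y p ^ E, 0] +
        linDefect ![α₀, 0] Y τ 0 := by
    have e3 : normalDir (a - η * y p ^ E) b = normalDir a b - ![η * y p ^ E, 0] := by
      funext i
      fin_cases i <;> simp [normalDir]; ring
    rw [normalField_eq]
    change linDefect (leadField p s + _) _ _ _ = _
    rw [linDefect_base_add, e3]
    simp only [linDefect]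
    abel
  have e4 : q • (S.κ • ![y p ^ E, 0] : PVectorField p) = ![η * y p ^ E, 0] := by
    have : C (S.κ)⁻¹ * C S.κ = (1 : StateSeries p) := by
      rw [← map_mul, inv_mul_cancel₀ S.κ_ne_zero, map_one]
    funext i
    fin_cases i
    · simp only [hq, smul_eq_C_mul, Pi.smul_apply, smul_eq_mul, Fin.zero_eta, Matrix.cons_val_zero]
      linear_combination η * y p ^ E * this
    · simp
  have h1 : linDefect ![α₀, 0] Y τ 0 ∈ fieldOrd p s W (S.a + m) :=
    PNF.linDefect_mem S.α_mem hY hτ (zero_mem _)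
  have h2 := smul_mem_fieldOrd hqm S.linDefect_mem (by omega : s + m + 1 ≤ _)
  rw [smul_sub, e4] at h2
  have h3 := add_mem (add_mem h (fieldOrd_anti (by omega) h1)) h2
  rw [e1, e2]
  convert h3 using 1
  abel

theorem atZero_eq_C {f : StateSeries p}
    (hf : ∀ d, ¬(d (Sum.inl 0) = 0 ∧ d (Sum.inl 1) = 0) → coeff d f = 0) :
    atZero f = C (constantCoeff f) := by
  classical
  ext d
  by_cases hd : d = 0
  · rw [hd, coeff_zero_eq_constantCoeff_apply, constantCoeff_atZero, coeff_zero_C]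
  · rw [coeff_atZero f d (Finsupp.equivFunOnFinite.symm (Sum.elim (fun i => d (Sum.inl i)) 0))
      (fun i => by simp) (fun l => by simp), coeff_C, if_neg hd, hf]
    rintro ⟨h0, h1⟩
    refine hd (Finsupp.ext ?_)
    rintro (i | i)
    · fin_cases i
      · simpa using h0
      · simpa using h1
    · exact i.elim0

/-- The parameter dependent extra term is removed. -/
theorem exists_carries_final {s W r : ℕ} (hs : 1 ≤ s) (hr : 2 * s < r) (hWr : 2 * r ≤ W)
    {α₀ α β : StateSeries p} (S : NearSymmetry p s W r α₀)
    (hα : α - α₀ ∈ serOrd p s W (r + 2)) (hα' : α ∈ ySupported p (allowedExps s))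
    (hα0 : coeff (Finsupp.single (Sum.inl 1) (r + s ^ 2 + s + 1)) α = 0)
    (hβ : β - y p ^ s ∈ serOrd p s W (r - s + 1)) (hβ' : β - y p ^ s ∈ ySupported p (eulerExps s)) :
    ∃ (g : StateTimeChange p) (α' β' : StateSeries p),
      g.Carries (normalField α β) (normalField α' β') ∧
      α' - α₀ ∈ serOrd p s W (r + 2) ∧
      α' ∈ ySupported p (allowedExps s \ {r + s ^ 2 + s + 1}) ∧
      β' - y p ^ s ∈ serOrd p s W (r - s + 1) ∧ β' - y p ^ s ∈ ySupported p (eulerExps s) := by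
  have hss : s ≤ s ^ 2 := Nat.le_self_pow two_ne_zero s
  have hW : W ≠ 0 := by omega
  set E := r + s ^ 2 + s + 1 with hE
  set η := yCoeff E α with hη
  have hη0 : constantCoeff η = 0 := by
    rw [← coeff_zero_eq_constantCoeff_apply, hη, coeff_yCoeff]
    simpa using hα0
  -- Every monomial of `η` contains a parameter, so the heavy weight `W` places the defect high
  -- enough for an iteration with loss.
  have hηm : η ∈ serOrd p s W W := by
    refine mem_serOrd_of_atZero le_rfl ?_
    have : atZero η = 0 := by
      rw [atZero_eq_C fun d hd => by rw [hη, coeff_yCoeff, if_neg hd], hη0, map_zero]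
    rw [this]
    exact zero_mem _
  have hηy : η * y p ^ E ∈ serOrd p s W (W + E) := mul_mem_ordIdeal hηm (y_pow_mem _)
  have hu := normalField_sub_leadField_mem S.lt_a S.α_mem
  have hum : normalField α₀ (y p ^ s) ∈ fieldOrd p s W s := by
    have := add_mem (fieldOrd_anti (Nat.le_succ s) hu) leadField_mem
    rwa [sub_add_cancel] at this
  have hα1 : α - η * y p ^ E - α₀ ∈ serOrd p s W (r + 2) := by
    rw [sub_right_comm]
    exact sub_mem hα (ordIdeal_anti (by omega) hηy)
  have hw : ∀ α', α' - α₀ ∈ serOrd p s W (r + 2) →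
      normalField α' β - normalField α₀ (y p ^ s) ∈ fieldOrd p s W (s + (r - 2 * s + 1)) := by
    intro α' h
    rw [normalField_sub]
    exact normalDir_mem (ordIdeal_anti (by omega) h) (ordIdeal_anti (by omega) hβ)
  obtain ⟨Φ, T, α', β', h1, h2, h3, h4, h5, h6, h7⟩ := exists_normalField
    -- Here `s + M` is the order of `η y^E ∂/∂x`, the whole defect of the initial guess.
    (l := r - 2 * s) (M := W + r + s ^ 2 - s) (w := normalField α β) (Φ₀ := stateId p) (T₀ := 1)
    (α₀ := α - η * y p ^ E) (β₀ := β) hW (allowedExps s \ {E}) (by omega) hum (hw α hα)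
    (by simp) (by simp) (hw _ hα1) (by
      rw [defect, dirDeriv_stateId, pull_stateId, one_smul, normalField_sub, sub_self]
      refine normalDir_mem ?_ (zero_mem _)
      rw [sub_sub_cancel_left]
      exact neg_mem (ordIdeal_anti (by omega) hηy))
    (fun m hm V hV => by
      obtain ⟨Y, τ, a, b, h1, h2, h3, h4, h5, h6, h7⟩ := S.exists_step hs hW hr (by omega) hV
      exact ⟨Y, τ, a, b, h1, h2, ordIdeal_anti (by omega) h3, ordIdeal_anti (by omega) h4, h5, h6,
        h7⟩)
  obtain ⟨g, rfl, rfl⟩ := exists_stateTimeChange (fieldOrd_anti (by omega) h1)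
    (ordIdeal_anti (by omega) h2)
  refine ⟨g, α', β', carries_iff_defect.2 h7, ?_, ?_, ?_, ?_⟩
  · have := add_mem (ordIdeal_anti (by omega) h3) hα1
    rwa [sub_add_sub_cancel] at this
  · have := add_mem h4 (sub_yCoeff_mem E hα')
    rwa [sub_add_cancel] at this
  · have := add_mem (ordIdeal_anti (by omega) h5) hβ
    rwa [sub_add_sub_cancel] at this
  · have := add_mem h6 hβ'
    rwa [sub_add_sub_cancel] at this

end NormalForm

end PNF

namespace PNF

/-! ### From the classical form to the complete parametric normal form. -/

noncomputable section Existence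

variable {p : ℕ}

theorem coeff_inY (f : ℕ → ℝ) (d : Fin 2 ⊕ Fin 0 →₀ ℕ) :
    coeff d (inY f) = if d (Sum.inl 0) = 0 then f (d (Sum.inl 1)) else 0 := rfl

theorem inY_mem {s W n : ℕ} {f : ℕ → ℝ} (hf : ∀ k, k < n → f k = 0) : inY f ∈ serOrd 0 s W n := by
  rw [mem_ordIdeal]
  intro d hd
  rw [coeff_inY]
  split_ifs with h
  · refine hf _ (lt_of_le_of_lt ?_ hd)
    exact Finsupp.le_weight (stateWeight 0 s W) (s := Sum.inl 1) (by simp [stateWeight]) d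
  · rfl

theorem inY_sub (f g : ℕ → ℝ) : inY (f - g) = inY f - inY g := by
  ext d
  rw [map_sub, coeff_inY, coeff_inY, coeff_inY]
  split_ifs <;> simp

theorem inY_add (f g : ℕ → ℝ) : inY (f + g) = inY f + inY g := by
  ext d
  rw [map_add, coeff_inY, coeff_inY, coeff_inY]
  split_ifs <;> simp

theorem inY_smul (c : ℝ) (f : ℕ → ℝ) : inY (c • f) = c • inY f := by
  ext d
  rw [coeff_smul, coeff_inY, coeff_inY]
  split_ifs <;> simp

theorem inY_single (k : ℕ) : inY (Pi.single k 1) = y 0 ^ k := by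
  classical
  ext d
  rw [y, X_pow_eq, coeff_monomial]
  rw [coeff_inY]
  by_cases h : d = Finsupp.single (Sum.inl 1) k
  · simp [h]
  · rw [if_neg h]
    split_ifs with h0
    · refine Pi.single_eq_of_ne ?_ _
      intro h1
      refine h (Finsupp.ext ?_)
      rintro (i | i)
      · fin_cases i
        · simpa using h0
        · simpa using h1
      · exact i.elim0
    · rfl

/-- Normalization of the first Eulerian coefficient. -/
theorem exists_carries_scale {c : ℝ} (hc : c ≠ 0) (a b : ℕ → ℝ) :
    ∃ g : StateTimeChange 0, g.Carries (classicalForm a b)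
      (classicalForm ((c ^ 2)⁻¹ • a) (c⁻¹ • b)) := by
  -- Scaling `x` by `c` and time by `c⁻¹` fixes `-x ∂/∂y`, divides Eulerian coefficients by `c` and
  -- Hamiltonian ones by `c²`.
  refine ⟨{ Φ := ![c • x 0, y 0], T := C c⁻¹, Φ_zero := fun i => ?_, Φ_inv := ?_, T_inv := ?_ }, ?_⟩
  · fin_cases i <;> simp [x, y]
  · classical
    simp [Matrix.det_fin_two, x, y, coeff_X, hc, Finsupp.single_left_inj]
  · simpa using hc
  · rw [carries_iff_defect]
    have hsub : HasSubst (extendParam ![c • x 0, y 0]) := by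
      refine hasSubst_extendParam fun i => ?_
      fin_cases i <;> simp [x, y]
    have hX : subst (extendParam ![c • x 0, y 0]) (x 0) = c • x 0 := subst_X hsub _
    have hY : subst (extendParam ![c • x 0, y 0]) (y 0) = y 0 := subst_X hsub _
    have hinY : ∀ f, subst (extendParam ![c • x 0, y 0]) (inY f) = inY f := by
      intro f
      have e : extendParam ![c • x 0, y 0] =
          (Sum.elim ![c, 1] 1 : Fin 2 ⊕ Fin 0 → ℝ) • (X : Fin 2 ⊕ Fin 0 → StateSeries 0) := by
        funext i
        rcases i with i | i
        · fin_cases i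
          · simp [extendParam, x]
          · simp [extendParam, y]
        · exact i.elim0
      rw [e, ← rescale_eq_subst]
      ext d
      rw [coeff_rescale]
      change _ * (if _ then _ else _) = (if _ then _ else _)
      split_ifs with h
      · rw [Finsupp.prod_fintype _ _ (by simp), Fintype.prod_sum_type, Fin.prod_univ_two]
        simp [h]
      · simp
    have h1 : C c⁻¹ * C c = (1 : StateSeries 0) := by rw [← map_mul, inv_mul_cancel₀ hc, map_one]
    have h2 : (C (c ^ 2)⁻¹ : StateSeries 0) = C c⁻¹ * C c⁻¹ := by
      rw [← map_mul, ← mul_inv, sq]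
    funext i
    rw [defect, Pi.sub_apply, Pi.smul_apply, dirDeriv_pair, pull]
    fin_cases i
    · change pderiv ℝ (Sum.inl 0) (c • x 0) * _ + pderiv ℝ (Sum.inl 1) (c • x 0) * _ -
        C c⁻¹ * subst (extendParam ![c • x 0, y 0]) (y 0 * inY a + x 0 * inY b) = 0
      rw [← coe_substAlgHom hsub, map_add, map_mul, map_mul, coe_substAlgHom hsub, hX, hY, hinY,
        hinY]
      rw [Derivation.map_smul, Derivation.map_smul, pderiv_x_x, pderiv_y_x]
      simp only [classicalForm, smul_eq_C_mul, h2, Matrix.cons_val_zero, inY_smul]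
      linear_combination (C c⁻¹ * y 0 * inY a) * h1
    · change pderiv ℝ (Sum.inl 0) (y 0) * _ + pderiv ℝ (Sum.inl 1) (y 0) * _ -
        C c⁻¹ * subst (extendParam ![c • x 0, y 0]) (-x 0 + y 0 * inY b) = 0
      rw [← coe_substAlgHom hsub, map_add, map_neg, map_mul, coe_substAlgHom hsub, hX, hY, hinY]
      simp only [classicalForm, pderiv_x_y, pderiv_y_y, smul_eq_C_mul, inY_smul,
        Matrix.cons_val_one, Matrix.cons_val_fin_one]
      linear_combination x 0 * h1

theorem atZero_add (f g : StateSeries p) : atZero (f + g) = atZero f + atZero g := by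
  simp only [atZero_eq, ← coe_substAlgHom (hasSubst_zeroParam (p := p)), map_add]

theorem atZero_sub (f g : StateSeries p) : atZero (f - g) = atZero f - atZero g := by
  simp only [atZero_eq, ← coe_substAlgHom (hasSubst_zeroParam (p := p)), map_sub]

theorem atZero_neg (f : StateSeries p) : atZero (-f) = -atZero f := by
  simp only [atZero_eq, ← coe_substAlgHom (hasSubst_zeroParam (p := p)), map_neg]

theorem atZero_mul (f g : StateSeries p) : atZero (f * g) = atZero f * atZero g := by
  simp only [atZero_eq, ← coe_substAlgHom (hasSubst_zeroParam (p := p)), map_mul]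

theorem atZero_pow (f : StateSeries p) (n : ℕ) : atZero (f ^ n) = atZero f ^ n := by
  simp only [atZero_eq, ← coe_substAlgHom (hasSubst_zeroParam (p := p)), map_pow]

theorem atZero_smul (c : ℝ) (f : StateSeries p) : atZero (c • f) = c • atZero f := by
  simp only [atZero_eq, ← coe_substAlgHom (hasSubst_zeroParam (p := p)), map_smul]

theorem atZero_x : atZero (x p) = x 0 := subst_X hasSubst_zeroParam _

theorem atZero_y : atZero (y p) = y 0 := subst_X hasSubst_zeroParam _

theorem atZero_normalField (α β : StateSeries p) (i : Fin 2) :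
    atZero (normalField α β i) = normalField (atZero α) (atZero β) i := by
  fin_cases i
  · change atZero (x p * β + α) = x 0 * atZero β + atZero α
    rw [atZero_add, atZero_mul, atZero_x]
  · change atZero (-x p + y p * β) = -x 0 + y 0 * atZero β
    rw [atZero_add, atZero_neg, atZero_mul, atZero_x, atZero_y]

theorem atZero_initialTerms (s r : ℕ) (c₁ c₂ : ℝ) :
    atZero (initialTerms p s r c₁ c₂) = initialTerms 0 s r c₁ c₂ := by
  rw [initialTerms, atZero_add, atZero_smul, atZero_smul, atZero_pow, atZero_pow, atZero_y]
  rfl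

theorem classicalForm_sub_mem {s W r : ℕ} (hsr : s ≤ r) {c₁ c₂ : ℝ} {a b : ℕ → ℝ}
    (ha : ∀ k, k < r + 1 →
      a k = c₁ * (Pi.single (s ^ 2 + 3 * s) 1 : ℕ → ℝ) k + c₂ * (Pi.single r 1 : ℕ → ℝ) k)
    (hb : ∀ k, k < r - s + 1 → b k = (Pi.single s 1 : ℕ → ℝ) k) :
    classicalForm a b - normalField (initialTerms 0 s r c₁ c₂) (y 0 ^ s) ∈
      fieldOrd 0 s W (r - s + 1) := by
  have h1 : classicalForm a b = normalField (y 0 * inY a) (inY b) := by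
    funext i
    fin_cases i <;> simp [classicalForm, normalField]; ring
  rw [h1, normalField_sub]
  refine normalDir_mem ?_ ?_
  · have e : y 0 * inY a - initialTerms 0 s r c₁ c₂ = y 0 *
        inY (a - (c₁ • Pi.single (s ^ 2 + 3 * s) 1 + c₂ • Pi.single r 1)) := by
      rw [inY_sub, inY_add, inY_smul, inY_smul, inY_single, inY_single, initialTerms]
      simp only [smul_eq_C_mul]
      ring
    rw [e]
    refine mul_mem_ordIdeal_of_le y_mem_serOrd (inY_mem (n := r + 1) fun k hk => ?_) (by omega)
    simp [ha k hk]
  · rw [← inY_single, ← inY_sub]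
    exact inY_mem fun k hk => by simp [hb k hk]

theorem coeff_y_pow (n k : ℕ) :
    coeff (Finsupp.single (Sum.inl 1) k) (y p ^ n) = if k = n then 1 else 0 := by
  classical
  rw [y, X_pow_eq, coeff_monomial]
  by_cases h : k = n
  · rw [if_pos h, if_pos (by rw [h])]
  · rw [if_neg h, if_neg fun h' => h (Finsupp.single_injective _ h')]

theorem y_pow_mem_ySupported {A : Set ℕ} {n : ℕ} (hn : n ∈ A) : y p ^ n ∈ ySupported p A := by
  classical
  intro d hd
  rw [y, X_pow_eq, coeff_monomial, if_neg]
  rintro rfl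
  exact hd (by simpa using hn)

theorem coeff_single_eq_zero {s W n k : ℕ} {f : StateSeries p} (hf : f ∈ serOrd p s W n)
    (hk : k < n) : coeff (Finsupp.single (Sum.inl 1) k) f = 0 := by
  refine mem_ordIdeal.1 hf _ ?_
  simpa [Finsupp.weight_single, stateWeight] using hk

/-- The complete normal form. -/
theorem exists_carries_completeForm {s r : ℕ} (hs : 1 ≤ s) (hr : 2 * s < r) {c₁ c₂ : ℝ}
    (hc₂ : c₂ ≠ 0) (hc : c₁ = 0 ∨ (s ^ 2 + 3 * s < r ∧ r < 2 * s ^ 2 + 4 * s))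
    (hres : ¬IsResonant s r) {v : PVectorField 0} {g₀ : StateTimeChange 0} {a b : ℕ → ℝ}
    (hv : g₀.Carries v (classicalForm a b)) (hbs : b s ≠ 0)
    (hb : ∀ k, k ≠ s → k + s ≤ r → b k = 0)
    (ha : ∀ k, k ≤ r → a k = (b s) ^ 2 *
      (c₁ * (Pi.single (s ^ 2 + 3 * s) 1 : ℕ → ℝ) k + c₂ * (Pi.single r 1 : ℕ → ℝ) k))
    {w : PVectorField p} (hw : IsDeformation w v) :
    ∃ (g : StateTimeChange p) (α β : StateSeries p), g.Carries w (normalField α β) ∧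
      α ∈ ySupported p (allowedExps s \ {r + s ^ 2 + s + 1}) ∧
      β - y p ^ s ∈ ySupported p (eulerExps s) ∧
      (∀ k, k ≤ r + 1 → coeff (Finsupp.single (Sum.inl 1) k) α =
        coeff (Finsupp.single (Sum.inl 1) k) (initialTerms p s r c₁ c₂)) ∧
      ∀ k, k ≤ s → coeff (Finsupp.single (Sum.inl 1) k) (β - y p ^ s) = 0 := by
  obtain ⟨g₁, hg₁⟩ := exists_carries_scale hbs a b
  obtain ⟨g₂, w₁, hg₂, hw₁⟩ := exists_carries_deformation _ (hv.comp hg₁) hw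
  -- The parameters are made heavy enough that the orders needed, up to `r + 2`, can be read off at
  -- `μ = 0`.
  set W := 2 * r with hW
  obtain ⟨S⟩ := nonempty_nearSymmetry (p := p) (W := W) hs hr hc₂ hc
  have hclass := classicalForm_sub_mem (W := W) (s := s) (r := r) (c₁ := c₁) (c₂ := c₂)
    (a := (b s ^ 2)⁻¹ • a) (b := (b s)⁻¹ • b) (by omega)
    (fun k hk => by
      rw [Pi.smul_apply, smul_eq_mul, ha k (by omega),
        inv_mul_cancel_left₀ (pow_ne_zero 2 hbs)])
    (fun k hk => by
      by_cases h : k = s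
      · subst h
        simp [hbs]
      · simp [hb k h (by omega), h])
  have hw₁u : w₁ - normalField (initialTerms p s r c₁ c₂) (y p ^ s) ∈
      fieldOrd p s W (r - s + 1) := by
    have h : ∀ i, atZero ((w₁ - normalField (initialTerms p s r c₁ c₂) (y p ^ s)) i) =
        (classicalForm ((b s ^ 2)⁻¹ • a) ((b s)⁻¹ • b) -
          normalField (initialTerms 0 s r c₁ c₂) (y 0 ^ s)) i := by
      intro i
      rw [Pi.sub_apply, Pi.sub_apply, atZero_sub, hw₁ i, atZero_normalField, atZero_initialTerms,
        atZero_pow, atZero_y]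
    rw [mem_fieldOrd_iff] at hclass ⊢
    refine ⟨mem_serOrd_of_atZero (by omega) ?_, mem_serOrd_of_atZero (by omega) ?_⟩
    · rw [h]
      exact hclass.1
    · rw [h]
      exact hclass.2
  have hr' : r + 1 ∈ allowedExps s := by
    rintro ⟨k, hk1, hk2, hk3⟩
    exact hres ⟨k, hk1, hk2, by omega⟩
  -- The index `s² + 3s` equals `k (s + 1) + 2s` only for the excluded value `k = s`.
  have hr0 : s ^ 2 + 3 * s + 1 ∈ allowedExps s := by
    rintro ⟨k, hk1, hk2, hk3⟩
    have : k * (s + 1) = s * (s + 1) := by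
      have : s * (s + 1) = s ^ 2 + s := by ring
      omega
    exact hk2 (Nat.eq_of_mul_eq_mul_right (Nat.succ_pos s) this)
  have hinit : initialTerms p s r c₁ c₂ ∈ ySupported p (allowedExps s) :=
    add_mem (smul_mem_ySupported _ (y_pow_mem_ySupported hr0))
      (smul_mem_ySupported _ (y_pow_mem_ySupported hr'))
  obtain ⟨g₃, α₁, β₁, hg₃, h1, h2, h3, h4⟩ := exists_carries_initial hs (by omega) hr S hw₁u
  obtain ⟨g₄, α₂, β₂, t, ht, hg₄, k1, k2, k3, k4⟩ := exists_carries_extra hs (by omega) hr S h1 h3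
  have hα₁ : α₁ ∈ ySupported p (allowedExps s) := by
    have := add_mem h2 hinit
    rwa [sub_add_cancel] at this
  set E := r + s ^ 2 + s + 1 with hE
  have hty : t • y p ^ E ∈ ySupported p (allowedExps s) := by
    by_cases hEA : E ∈ allowedExps s
    · exact smul_mem_ySupported _ (y_pow_mem_ySupported hEA)
    -- If the extra index is itself resonant, its coefficient is already zero.
    · rw [ht, hα₁ _ (fun h => hEA (by simpa using h.2)), zero_smul]
      exact zero_mem _
  have hβadd : β₂ - y p ^ s = (β₂ - β₁) + (β₁ - y p ^ s) := by abel
  have hα₂add : α₂ = (α₂ - (α₁ - t • y p ^ E)) + (α₁ - t • y p ^ E) := by abel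
  obtain ⟨g₅, α, β, hg₅, l1, l2, l3, l4⟩ := exists_carries_final (α := α₂) (β := β₂) hs hr le_rfl S
    (by
      have := add_mem (ordIdeal_anti (by omega : r + 2 ≤ r + s ^ 2 + s + 2) k1)
        (sub_mem h1 (smul_mem_serOrd t (ordIdeal_anti (by omega : r + 2 ≤ E) (y_pow_mem E))))
      convert this using 1
      abel)
    (by
      rw [hα₂add]
      exact add_mem k2 (sub_mem hα₁ hty))
    (by
      rw [hα₂add, map_add, coeff_single_eq_zero k1 (by omega), map_sub, ← hE, ← ht, coeff_smul,
        coeff_y_pow]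
      simp)
    (by
      rw [hβadd]
      exact add_mem k3 h3)
    (by
      rw [hβadd]
      exact add_mem k4 h4)
  refine ⟨_, α, β, ((hg₂.comp hg₃).comp hg₄).comp hg₅, l2, l4, fun k hk => ?_, fun k hk => ?_⟩
  · have := coeff_single_eq_zero l1 (by omega : k < r + 2)
    rwa [map_sub, sub_eq_zero] at this
  · exact coeff_single_eq_zero l3 (by omega)

end Existence

end PNF

namespace PNF

/-! ### Translation into truncated normal forms. -/

noncomputable section Levels

variable {p : ℕ}

theorem coeff_embDomain_ofParam (f : ParamSeries p) (d : Fin p →₀ ℕ) :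
    coeff (d.embDomain Function.Embedding.inr) (ofParam f) = coeff d f :=
  coeff_embDomain_rename Function.Embedding.inr f d

theorem exists_embDomain_eq {d : Fin 2 ⊕ Fin p →₀ ℕ}
    (h : d (Sum.inl 0) = 0 ∧ d (Sum.inl 1) = 0) :
    ∃ d' : Fin p →₀ ℕ, d = d'.embDomain Function.Embedding.inr := by
  refine ⟨Finsupp.equivFunOnFinite.symm fun l => d (Sum.inr l), Finsupp.ext ?_⟩
  rintro (i | i)
  · rw [Finsupp.embDomain_of_notMem_range _ _ _ (by simp)]
    fin_cases i
    · exact h.1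
    · exact h.2
  · exact (Finsupp.embDomain_apply_self Function.Embedding.inr
      (Finsupp.equivFunOnFinite.symm fun l => d (Sum.inr l)) i).symm

theorem coeff_ofParam_eq_zero (f : ParamSeries p) {d : Fin 2 ⊕ Fin p →₀ ℕ}
    (h : ¬(d (Sum.inl 0) = 0 ∧ d (Sum.inl 1) = 0)) : coeff d (ofParam f) = 0 := by
  refine coeff_rename_eq_zero Sum.inr f ?_
  rintro ⟨d', rfl⟩
  refine h ⟨?_, ?_⟩ <;> exact Finsupp.mapDomain_of_notMem_range _ _ (by simp)

/-- The coefficient of `y ^ n` in the part of `f` free of `x`. -/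
def paramCoeff (n : ℕ) (f : StateSeries p) : ParamSeries p := fun d =>
  coeff (d.embDomain Function.Embedding.inr + Finsupp.single (Sum.inl 1) n) f

theorem coeff_paramCoeff (n : ℕ) (f : StateSeries p) (d : Fin p →₀ ℕ) :
    coeff d (paramCoeff n f) =
      coeff (d.embDomain Function.Embedding.inr + Finsupp.single (Sum.inl 1) n) f := rfl

theorem ofParam_paramCoeff (n : ℕ) (f : StateSeries p) : ofParam (paramCoeff n f) = yCoeff n f := by
  ext d
  rw [coeff_yCoeff]
  split_ifs with h
  · obtain ⟨d', rfl⟩ := exists_embDomain_eq h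
    rw [coeff_embDomain_ofParam, coeff_paramCoeff]
  · exact coeff_ofParam_eq_zero _ h

theorem constantCoeff_paramCoeff (n : ℕ) (f : StateSeries p) :
    constantCoeff (paramCoeff n f) = coeff (Finsupp.single (Sum.inl 1) n) f := by
  rw [← coeff_zero_eq_constantCoeff_apply, coeff_paramCoeff, Finsupp.embDomain_zero, zero_add]

theorem coeff_yCoeff_mul (n : ℕ) (f : StateSeries p) (d : Fin 2 ⊕ Fin p →₀ ℕ) :
    coeff d (yCoeff n f * y p ^ n) =
      if d (Sum.inl 0) = 0 ∧ d (Sum.inl 1) = n then coeff d f else 0 := by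
  rw [coeff_mul_y_pow, coeff_yCoeff]
  by_cases h0 : d (Sum.inl 0) = 0
  · by_cases h1 : d (Sum.inl 1) = n
    · have e : d - Finsupp.single (Sum.inl 1) n + Finsupp.single (Sum.inl 1) n = d :=
        tsub_add_cancel_of_le (by simp [h1])
      rw [if_pos h1.ge, if_pos (by simp [h0, h1]), e, if_pos ⟨h0, h1⟩]
    · rw [if_neg (c := _ ∧ _) fun h => h1 h.2]
      split_ifs with h3 h4
      · exact absurd h4.2 (by simp; omega)
      all_goals rfl
  · rw [if_neg (c := _ ∧ _) fun h => h0 h.1]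
    split_ifs with h3 h4
    · exact absurd h4.1 (by simp; omega)
    all_goals rfl

theorem coeff_sum_yCoeff (I : Finset ℕ) (f : StateSeries p) (d : Fin 2 ⊕ Fin p →₀ ℕ) :
    coeff d (∑ n ∈ I, yCoeff n f * y p ^ n) =
      if d (Sum.inl 0) = 0 ∧ d (Sum.inl 1) ∈ I then coeff d f else 0 := by
  rw [map_sum]
  simp only [coeff_yCoeff_mul]
  by_cases h0 : d (Sum.inl 0) = 0
  · simp [h0]
  · simp [h0]

theorem hamTerm_one_zero : hamTerm p 1 0 = ![0, -x p] := by
  funext i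
  fin_cases i
  · simp [hamTerm, const]
  · simp [hamTerm, const]

theorem hamTerm_neg_one (j : ℤ) (hj : -1 ≤ j) : hamTerm p (-1) j = ![y p ^ (j + 1).toNat, 0] := by
  have h : (j + 2 : ℝ) ≠ 0 := by
    have : (0 : ℝ) < j + 2 := by exact_mod_cast (by omega : 0 < j + 2)
    exact this.ne'
  funext i
  fin_cases i
  · have e : ((j : ℝ) - (-1 : ℤ) + 1) / (j + 2) = 1 := by
      rw [div_eq_one_iff_eq h]; push_cast; ring
    simp only [hamTerm, const, e, map_one, Fin.zero_eta, Matrix.cons_val_zero, neg_add_cancel,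
      Int.toNat_zero, pow_zero, one_mul, sub_neg_eq_add]
  · simp [hamTerm, const]

theorem eulerTerm_zero (k : ℕ) : eulerTerm p 0 k = ![x p * y p ^ k, y p ^ (k + 1)] := by
  funext i
  fin_cases i
  · simp [eulerTerm]
  · simp [eulerTerm]

/-- The Hamiltonian series of a parametric normal form. -/
def hamSeries (J : Finset ℕ) (a : ℤ → ParamSeries p) : StateSeries p :=
  ofParam (a (-1)) + ofParam (a 0) * y p + ∑ j ∈ J, ofParam (a j) * y p ^ (j + 1)

/-- The Eulerian series of a parametric normal form. -/
def eulerSeries (s : ℕ) (b : ℕ → ParamSeries p) : StateSeries p :=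
  y p ^ s + ∑ k ∈ Finset.range (s - 1), ofParam (b k) * y p ^ k

theorem levelForm_eq (s : ℕ) (J : Finset ℕ) (a : ℤ → ParamSeries p) (b : ℕ → ParamSeries p) :
    levelForm s J a b = normalField (hamSeries J a) (eulerSeries s b) := by
  have h1 : ∀ j : ℕ, hamTerm p (-1) j = ![y p ^ (j + 1), 0] := fun j => by
    rw [hamTerm_neg_one _ (by omega)]
    congr 2
  have h2 : hamTerm p (-1) 0 = ![y p, 0] := by simpa using h1 0
  have h3 : hamTerm p (-1) (-1) = ![1, 0] := by rw [hamTerm_neg_one _ le_rfl]; simp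
  have h4 : ∀ z : StateSeries p, ∑ k ∈ Finset.range (s - 1), ofParam (b k) * (z * y p ^ k) =
      z * ∑ k ∈ Finset.range (s - 1), ofParam (b k) * y p ^ k := fun z => by
    rw [Finset.mul_sum]
    exact Finset.sum_congr rfl fun _ _ => by ring
  funext i
  fin_cases i
  · simp only [levelForm, hamTerm_one_zero, eulerTerm_zero, h1, h2, h3, normalField, hamSeries,
      eulerSeries, Finset.sum_apply, Pi.add_apply, Pi.smul_apply, smul_eq_mul, Fin.zero_eta,
      Matrix.cons_val_zero, h4]
    ring
  · simp only [levelForm, hamTerm_one_zero, eulerTerm_zero, h1, h2, h3, normalField, pow_succ',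
      eulerSeries, Finset.sum_apply, Pi.add_apply, Pi.smul_apply, smul_eq_mul, Fin.mk_one,
      Matrix.cons_val_one, Matrix.cons_val_fin_one, mul_zero, Finset.sum_const_zero, h4]
    ring

/-- The power `y^n` in `α` belongs to `A^{-1}_{n-1}`. So `n = 0, 1` give `a_{-1}` and `a_0`, and the
degrees `2 ≤ n ≤ N` that survive truncation are the indices `1 ≤ j < N`. -/
theorem exists_levelForm {s e N : ℕ} {α β : StateSeries p}
    (hα : α ∈ ySupported p (allowedExps s \ {e + 1}))
    (hβ : β - y p ^ s ∈ ySupported p (eulerExps s)) :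
    TruncEq N (normalField α β) (levelForm s (unfoldingIndices s e N)
      (fun j => paramCoeff (j + 1).toNat α) (fun k => paramCoeff k (β - y p ^ s))) := by
  classical
  have hβe : eulerSeries s (fun k => paramCoeff k (β - y p ^ s)) = β := by
    rw [eulerSeries, ← eq_sub_iff_add_eq']
    simp only [ofParam_paramCoeff]
    ext d
    rw [coeff_sum_yCoeff]
    split_ifs with h
    · rfl
    · refine (hβ d fun h' => h ⟨h'.1, ?_⟩).symm
      have : d (Sum.inl 1) + 2 ≤ s := h'.2
      exact Finset.mem_range.2 (by omega)
  have hαe : hamSeries (unfoldingIndices s e N) (fun j => paramCoeff (j + 1).toNat α) =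
      ∑ n ∈ insert 0 (insert 1 ((unfoldingIndices s e N).image (· + 1))),
        yCoeff n α * y p ^ n := by
    rw [Finset.sum_insert, Finset.sum_insert, Finset.sum_image (by simp)]
    · simp only [hamSeries, ofParam_paramCoeff]
      have e1 : ∀ j : ℕ, ((j : ℤ) + 1).toNat = j + 1 := fun j => rfl
      simp only [e1]
      simp [add_assoc]
    · simp [unfoldingIndices]
    · simp
  have hdiff : ∀ d : Fin 2 ⊕ Fin p →₀ ℕ, d (Sum.inl 0) + d (Sum.inl 1) ≤ N →
      coeff d α = coeff d (hamSeries (unfoldingIndices s e N)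
        (fun j => paramCoeff (j + 1).toNat α)) := by
    intro d hd
    rw [hαe, coeff_sum_yCoeff]
    split_ifs with h
    · rfl
    · refine hα d fun h' => h ⟨h'.1, ?_⟩
      obtain ⟨h1, h2, h3⟩ := h'
      simp only [Finset.mem_insert, Finset.mem_image]
      rcases Nat.lt_or_ge (d (Sum.inl 1)) 2 with h4 | h4
      · omega
      · refine Or.inr (Or.inr ⟨d (Sum.inl 1) - 1, ?_, by omega⟩)
        simp only [unfoldingIndices, Finset.mem_filter, Finset.mem_Ico]
        refine ⟨⟨by omega, by omega⟩, fun h5 => h3 (Set.mem_singleton_iff.2 (by omega)), ?_⟩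
        rintro ⟨k, hk1, hk2, hk3⟩
        exact h2 ⟨k, hk1, hk2, by omega⟩
  intro i d hd
  rw [levelForm_eq, hβe]
  fin_cases i
  · change coeff d (x p * β + α) = coeff d (x p * β + _)
    rw [map_add, map_add, hdiff d hd]
  · rfl

theorem exists_isLevelForm {s r r₁ e N : ℕ} (hr₁ : r₁ ≤ r) {α₀ α β : StateSeries p}
    {w : PVectorField p} {g : StateTimeChange p} (hg : g.Carries w (normalField α β))
    (hα : α ∈ ySupported p (allowedExps s \ {e + 1}))
    (hβ : β - y p ^ s ∈ ySupported p (eulerExps s))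
    (hα₀ : ∀ k, k ≤ r + 1 → coeff (Finsupp.single (Sum.inl 1) k) α =
      coeff (Finsupp.single (Sum.inl 1) k) α₀)
    (hβ₀ : ∀ k, k ≤ s → coeff (Finsupp.single (Sum.inl 1) k) (β - y p ^ s) = 0)
    (h0 : ∀ k, k < r₁ + 1 → coeff (Finsupp.single (Sum.inl 1) k) α₀ = 0)
    (h1 : coeff (Finsupp.single (Sum.inl 1) (r₁ + 1)) α₀ ≠ 0) :
    ∃ u : PVectorField p, IsLevelForm s r₁ (unfoldingIndices s e N) u ∧ TransformsTo N w u := by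
  refine ⟨_, ⟨_, _, rfl, fun k hk => ?_, fun j hj hj' => ?_, ?_⟩, g, _, hg,
    exists_levelForm hα hβ⟩
  · rw [constantCoeff_paramCoeff]
    exact hβ₀ k (by omega)
  · rw [constantCoeff_paramCoeff, hα₀ _ (by omega)]
    exact h0 _ (by omega)
  · have e : ((r₁ : ℤ) + 1).toNat = r₁ + 1 := rfl
    rw [constantCoeff_paramCoeff, e, hα₀ _ (by omega)]
    exact h1

/-- Every deformation of a generalized saddle-node case has a parametric normal form. -/
theorem HasIndices.exists_isLevelForm {s r₁ e N : ℕ} {v : PVectorField 0}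
    (hv : HasIndices s r₁ e v) {w : PVectorField p} (hw : IsDeformation w v) :
    ∃ u : PVectorField p, IsLevelForm s r₁ (unfoldingIndices s e N) u ∧ TransformsTo N w u := by
  rcases hv with ⟨hne, ⟨hs, hr, g, a, b, hg, ⟨hbs, hb, hres⟩, ha, har⟩, rfl⟩ |
    ⟨h0, r₂, hr₂, ⟨hs, hr, hlt, g, a, b, hg, ⟨hbs, hb, hres⟩, ha, har, har₂⟩, rfl⟩
  · have hbs2 : b s ^ 2 ≠ 0 := pow_ne_zero 2 hbs
    obtain ⟨g', α, β, h1, h2, h3, h4, h5⟩ := exists_carries_completeForm (p := p) (c₁ := 0)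
      (c₂ := a r₁ / b s ^ 2) hs hr (div_ne_zero har hbs2) (Or.inl rfl)
      (fun h => har (hres r₁ le_rfl h)) hg hbs hb (fun k hk => by
        rcases hk.lt_or_eq with hk | rfl
        · simp [ha k hk, hk.ne]
        · simp; field_simp) hw
    refine PNF.exists_isLevelForm le_rfl h1 h2 h3 h4 h5 (fun k hk => ?_) ?_
    · simp [initialTerms, coeff_y_pow, hk.ne]
    · simp only [initialTerms, map_add, coeff_smul, coeff_y_pow]
      simp [har, hbs]
  · have hbs2 : b s ^ 2 ≠ 0 := pow_ne_zero 2 hbs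
    have e0 : s * (s + 1) + 2 * s = s ^ 2 + 3 * s := by ring
    rw [e0] at h0
    subst h0
    -- Now `r₂` plays the role of `r`, and the term of index `r₁ = s² + 3s` is carried along with
    -- coefficient `c₁`.
    obtain ⟨g', α, β, h1, h2, h3, h4, h5⟩ := exists_carries_completeForm (p := p)
      (c₁ := a (s ^ 2 + 3 * s) / b s ^ 2) (c₂ := a r₂ / b s ^ 2) hs (by omega)
      (div_ne_zero har₂ hbs2) (Or.inr ⟨hlt, hr₂⟩)
      (fun h => har₂ (hres r₂ le_rfl h)) hg hbs hb (fun k hk => by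
        rcases hk.lt_or_eq with hk | rfl
        · by_cases hk' : k = s ^ 2 + 3 * s
          · subst hk'
            simp [hlt.ne]; field_simp
          · simp [ha k hk hk', hk.ne, hk']
        · simp [hlt.ne']; field_simp) hw
    refine PNF.exists_isLevelForm hlt.le h1 h2 h3 h4 h5 (fun k hk => ?_) ?_
    · simp [initialTerms, coeff_y_pow, hk.ne, (hk.trans (by omega : s ^ 2 + 3 * s + 1 < r₂ + 1)).ne]
    · simp only [initialTerms, map_add, coeff_smul, coeff_y_pow]
      simp [hlt.ne, har, hbs]

end Levels

end PNF

namespace PNF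

/-! ### Column reduction of matrices with independent rows. -/

section LinearAlgebra

/-- Two surjections from a finite dimensional space differ by an automorphism. -/
theorem exists_linearEquiv_comp_eq {E F : Type*} [AddCommGroup E] [Module ℝ E]
    [FiniteDimensional ℝ E] [AddCommGroup F] [Module ℝ F] (S T : E →ₗ[ℝ] F)
    (hS : S.range = ⊤) (hT : T.range = ⊤) : ∃ L : E ≃ₗ[ℝ] E, ∀ v, S (L v) = T v := by
  obtain ⟨C, hC⟩ := S.ker.exists_isCompl
  obtain ⟨D, hD⟩ := T.ker.exists_isCompl
  have eS := LinearMap.equivProdOfSurjectiveOfIsCompl_apply (f := S)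
    (g := Submodule.projectionOnto _ _ hC) hS (Submodule.range_projectionOnto hC)
    (by rw [Submodule.ker_projectionOnto]; exact hC)
  have eT := LinearMap.equivProdOfSurjectiveOfIsCompl_apply (f := T)
    (g := Submodule.projectionOnto _ _ hD) hT (Submodule.range_projectionOnto hD)
    (by rw [Submodule.ker_projectionOnto]; exact hD)
  set PS := LinearMap.equivProdOfSurjectiveOfIsCompl S (Submodule.projectionOnto _ _ hC) hS
    (Submodule.range_projectionOnto hC) (by rw [Submodule.ker_projectionOnto]; exact hC)
  set PT := LinearMap.equivProdOfSurjectiveOfIsCompl T (Submodule.projectionOnto _ _ hD) hT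
    (Submodule.range_projectionOnto hD) (by rw [Submodule.ker_projectionOnto]; exact hD)
  have hfin : Module.finrank ℝ T.ker = Module.finrank ℝ S.ker := by
    have h1 := S.finrank_range_add_finrank_ker
    have h2 := T.finrank_range_add_finrank_ker
    rw [hS] at h1
    rw [hT] at h2
    omega
  let e := LinearEquiv.ofFinrankEq T.ker S.ker hfin
  -- Each surjection identifies `E` with `F` times its kernel. The kernels have equal dimension, and
  -- `L` matches the two splittings.
  refine ⟨PT.trans (((LinearEquiv.refl ℝ F).prodCongr e).trans PS.symm), fun v => ?_⟩
  have h := eS (PS.symm ((((LinearEquiv.refl ℝ F).prodCongr e)) (PT v)))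
  rw [LinearEquiv.apply_symm_apply] at h
  have h1 := congrArg Prod.fst h
  rw [eT] at h1
  exact h1.symm

/-- A matrix with independent rows is reduced to a coordinate projection by column operations. -/
theorem exists_isUnit_det_mul_eq {ι κ : Type*} [Fintype ι] [Fintype κ] [DecidableEq κ]
    (A : Matrix ι κ ℝ) (hA : A.rank = Fintype.card ι) (e : ι ↪ κ) :
    ∃ L : Matrix κ κ ℝ, L.det ≠ 0 ∧
      ∀ i k, ∑ j, A i j * L j k = if k = e i then 1 else 0 := by
  have hr : A.mulVecLin.range = ⊤ := by
    refine Submodule.eq_top_of_finrank_eq ?_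
    rw [Module.finrank_fintype_fun_eq_card]
    exact hA
  have hP : (LinearMap.funLeft ℝ ℝ e).range = ⊤ :=
    LinearMap.range_eq_top.2 (LinearMap.funLeft_surjective_of_injective ℝ ℝ e e.injective)
  obtain ⟨L, hL⟩ := exists_linearEquiv_comp_eq _ _ hr hP
  refine ⟨LinearMap.toMatrix' (L : (κ → ℝ) →ₗ[ℝ] κ → ℝ), ?_, fun i k => ?_⟩
  · rw [LinearMap.det_toMatrix']
    exact L.isUnit_det'.ne_zero
  · have := congrFun (hL (Pi.single k 1)) i
    simp only [Matrix.mulVecLin_apply, Matrix.mulVec, dotProduct, LinearMap.funLeft_apply,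
      Pi.single_apply] at this
    simp only [LinearMap.toMatrix'_apply]
    rw [← (by simp [eq_comm] : (if e i = k then (1 : ℝ) else 0) = if k = e i then 1 else 0), ← this]
    rfl

end LinearAlgebra

/-! ### A formal inverse function theorem for submersions. -/

noncomputable section Inverse

theorem mem_ordIdeal_two {σ : Type*} {f : MvPowerSeries σ ℝ} (h0 : constantCoeff f = 0)
    (h1 : ∀ i, coeff (Finsupp.single i 1) f = 0) : f ∈ ordIdeal (fun _ : σ => 1) 2 := by
  rw [mem_ordIdeal]
  intro d hd
  have hd' : d.degree < 2 := by
    rw [Finsupp.degree_eq_weight_one (R := ℕ)]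
    exact hd
  rcases (by omega : d.degree = 0 ∨ d.degree = 1) with h | h
  · rw [(Finsupp.degree_eq_zero_iff d).1 h]
    exact h0
  · have hd1 : d ∈ {d : σ →₀ ℕ | d.degree = 1} := h
    rw [← Finsupp.range_single_one] at hd1
    obtain ⟨i, rfl⟩ := hd1
    exact h1 i

/-- Formal inverse function theorem. -/
theorem exists_subst_eq_X {ι σ : Type*} [Fintype ι] [Fintype σ] [DecidableEq σ]
    (f : ι → MvPowerSeries σ ℝ) (hf : ∀ i, constantCoeff (f i) = 0)
    (hA : (Matrix.of fun i j => coeff (Finsupp.single j 1) (f i)).rank = Fintype.card ι)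
    (e : ι ↪ σ) :
    ∃ ψ : σ → MvPowerSeries σ ℝ, (∀ j, constantCoeff (ψ j) = 0) ∧
      (Matrix.of fun i j => coeff (Finsupp.single j 1) (ψ i)).det ≠ 0 ∧
      ∀ i, subst ψ (f i) = X (e i) := by
  classical
  set A : Matrix ι σ ℝ := Matrix.of fun i j => coeff (Finsupp.single j 1) (f i) with hAdef
  obtain ⟨L, hdet, hAL⟩ := exists_isUnit_det_mul_eq A hA e
  set O : ℕ → Ideal (MvPowerSeries σ ℝ) := ordIdeal (fun _ : σ => 1) with hO
  have hsmul : ∀ (c : ℝ) {g : MvPowerSeries σ ℝ} {k : ℕ}, g ∈ O k → c • g ∈ O k :=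
    fun c g k hg => by
      rw [smul_eq_C_mul]
      exact Ideal.mul_mem_left _ _ hg
  -- The linear part of the solution: `A L` is the coordinate projection along `e`, so only terms of
  -- order two remain to be corrected.
  set ψ₀ : σ → MvPowerSeries σ ℝ := fun j => ∑ k, L j k • X k with hψ₀
  have hψ₀1 : ∀ j, ψ₀ j ∈ O 1 := fun j =>
    Ideal.sum_mem _ fun k _ => hsmul _ (X_mem_ordIdeal (fun _ : σ => 1) k)
  set h : ι → MvPowerSeries σ ℝ := fun i => f i - ∑ j, A i j • X j with hh
  have hh2 : ∀ i, h i ∈ O 2 := fun i => by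
    refine mem_ordIdeal_two ?_ fun j => ?_
    · simp [hh, hf, smul_eq_C_mul]
    · simp only [hh, map_sub, map_sum, coeff_smul, coeff_X, Finsupp.single_left_inj one_ne_zero,
        mul_ite, mul_one, mul_zero, Finset.sum_ite_eq, Finset.mem_univ, if_true]
      simp [hAdef]
  have hfe : ∀ i, f i = ∑ j, A i j • X j + h i := fun i => by simp [hh]
  have hone : ∀ ψ : σ → MvPowerSeries σ ℝ, (∀ j, ψ j - ψ₀ j ∈ O 2) → ∀ j, ψ j ∈ O 1 :=
    fun ψ hψ j => by
      have := add_mem (ordIdeal_anti one_le_two (hψ j)) (hψ₀1 j)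
      rwa [sub_add_cancel] at this
  have hsub : ∀ ψ : σ → MvPowerSeries σ ℝ, (∀ j, ψ j ∈ O 1) → HasSubst ψ := fun ψ hψ =>
    hasSubst_of_constantCoeff_zero fun j => constantCoeff_eq_zero_of_mem (hψ j)
  have hval : ∀ ψ : σ → MvPowerSeries σ ℝ, (∀ j, ψ j ∈ O 1) → ∀ i,
      subst ψ (f i) = ∑ j, A i j • ψ j + subst ψ (h i) := by
    intro ψ hψ i
    have hs := hsub ψ hψ
    rw [hfe i, ← coe_substAlgHom hs, map_add, map_sum]
    simp only [map_smul, coe_substAlgHom, subst_X hs]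
  let F : (σ → MvPowerSeries σ ℝ) → ι → MvPowerSeries σ ℝ := fun ψ i => subst ψ (f i) - X (e i)
  have hF : ∀ ψ, (∀ j, ψ j - ψ₀ j ∈ O 2) → ∀ k, 2 ≤ k → ∀ δ : σ → MvPowerSeries σ ℝ,
      (∀ j, δ j ∈ O k) → ∀ i, F (ψ + δ) i - F ψ i - ∑ j, A i j • δ j ∈ O (k + 1) := by
    intro ψ hψ k hk δ hδ i
    have h1 := hone ψ hψ
    have h2 : ∀ j, (ψ + δ) j ∈ O 1 := fun j => add_mem (h1 j) (ordIdeal_anti (by omega) (hδ j))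
    have h3 := subst_sub_subst_mem (w := fun _ : σ => 1) (w' := fun _ : σ => 1) (k := k - 1)
      (hsub _ h2) (hsub _ h1) h2 h1 (fun j => by
        rw [Pi.add_apply, add_sub_cancel_left]
        exact ordIdeal_anti (by omega) (hδ j)) (hh2 i)
    simp only [F]
    rw [hval _ h2, hval _ h1]
    have e1 : ∑ j, A i j • (ψ + δ) j = ∑ j, A i j • ψ j + ∑ j, A i j • δ j := by
      simp [smul_add, Finset.sum_add_distrib]
    rw [e1]
    have := ordIdeal_anti (by omega : k + 1 ≤ 2 + (k - 1)) h3
    convert this using 1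
    abel
  let FU : ℕ → AddSubgroup (σ → MvPowerSeries σ ℝ) := fun k =>
    AddSubgroup.pi Set.univ fun _ => (O k).toAddSubgroup
  let FV : ℕ → AddSubgroup (ι → MvPowerSeries σ ℝ) := fun k =>
    AddSubgroup.pi Set.univ fun _ => (O k).toAddSubgroup
  have hFU : ∀ k δ, δ ∈ FU k ↔ ∀ j, δ j ∈ O k := fun k δ => by
    simp [FU, AddSubgroup.mem_pi]
  have hFV : ∀ k V, V ∈ FV k ↔ ∀ j, V j ∈ O k := fun k δ => by
    simp [FV, AddSubgroup.mem_pi]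
  have hlin : ∀ i, ∑ j, A i j • ψ₀ j = X (e i) := by
    intro i
    simp only [hψ₀, Finset.smul_sum, smul_smul]
    rw [Finset.sum_comm]
    simp only [← Finset.sum_smul, hAL, ite_smul, one_smul, zero_smul, Finset.sum_ite_eq',
      Finset.mem_univ, if_true]
  suffices hsol : ∃ ψ, ψ - ψ₀ ∈ FU 2 ∧ F ψ = 0 by
    obtain ⟨ψ, hψ, hFψ⟩ := hsol
    rw [hFU] at hψ
    refine ⟨ψ, fun j => constantCoeff_eq_zero_of_mem (hone ψ hψ j), ?_,
      fun i => sub_eq_zero.1 (congrFun hFψ i)⟩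
    convert hdet using 2
    ext i j
    have h1 : coeff (Finsupp.single j 1) (ψ i - ψ₀ i) = 0 :=
      mem_ordIdeal.1 (hψ i) _ (by simp [Finsupp.weight_single])
    rw [map_sub, sub_eq_zero] at h1
    rw [Matrix.of_apply, h1]
    simp only [hψ₀, map_sum, coeff_smul, coeff_X, Finsupp.single_left_inj one_ne_zero, mul_ite,
      mul_one, mul_zero, Finset.sum_ite_eq, Finset.mem_univ, if_true]
  refine exists_zero_of_step FU FV FV F ψ₀ 2 ?_ ?_ (fun _ => le_rfl) ?_ ?_ ?_ ?_
  · intro a b hab δ hδ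
    rw [hFU] at hδ ⊢
    exact fun j => ordIdeal_anti hab (hδ j)
  · intro u hu
    have hu' := fun k => (hFU _ _).1 (hu k)
    choose v hv _ using fun j => exists_limit (l := 0) (φ := fun k => k) monotone_id
      (fun k => le_rfl) (fun k => u k j) fun k => hu' k j
    exact ⟨v, fun k => (hFU _ _).2 fun j => hv j k⟩
  · intro V hV
    funext i
    exact eq_zero_of_mem_ordIdeal fun n =>
      ordIdeal_anti (Nat.le_add_left n 2) ((hFV _ _).1 (hV (2 + n) (Nat.le_add_right _ _)) i)
  · intro ψ hψ k hk δ hδ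
    rw [hFU] at hψ hδ
    rw [hFV]
    intro i
    have := add_mem (ordIdeal_anti (Nat.le_succ k) (hF ψ hψ k hk δ hδ i))
      (Ideal.sum_mem (O k) (t := Finset.univ) fun j _ => hsmul (A i j) (hδ j))
    rwa [sub_add_cancel] at this
  · intro ψ hψ k hk hFψ
    rw [hFU] at hψ
    rw [hFV] at hFψ
    -- The columns of `L` indexed by the image of `e` form a right inverse of `A`.
    set δ : σ → MvPowerSeries σ ℝ := fun j => -∑ m, L j (e m) • F ψ m with hδ
    have hδm : ∀ j, δ j ∈ O k := fun j =>
      neg_mem (Ideal.sum_mem _ fun m _ => hsmul _ (hFψ m))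
    refine ⟨δ, (hFU _ _).2 hδm, (hFV _ _).2 fun i => ?_⟩
    have h1 := hF ψ hψ k hk δ hδm i
    have e1 : ∑ j, A i j • δ j = -F ψ i := by
      simp only [hδ, smul_neg, Finset.sum_neg_distrib, Finset.smul_sum, smul_smul]
      rw [Finset.sum_comm]
      simp only [← Finset.sum_smul, hAL, ite_smul, one_smul, zero_smul, e.injective.eq_iff,
        Finset.sum_ite_eq', Finset.mem_univ, if_true]
    rwa [e1, sub_neg_eq_add, sub_add_cancel] at h1
  · rw [hFV]
    intro i
    simp only [F]
    rw [hval _ hψ₀1, hlin, add_sub_cancel_left]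
    exact subst_mem_ordIdeal (hsub _ hψ₀1) hψ₀1 (hh2 i)

end Inverse

end PNF

namespace PNF

/-! ### Action of reparametrizations on changes, truncations and normal forms. -/

noncomputable section Reparametrizations

variable {p : ℕ}

/-- The substitution defining `Reparametrization.apply`. -/
def substParam (ψ : Fin p → ParamSeries p) : Fin 2 ⊕ Fin p → StateSeries p :=
  Sum.elim (fun j => X (Sum.inl j)) fun l => ofParam (ψ l)

theorem constantCoeff_ofParam (f : ParamSeries p) :
    constantCoeff (ofParam f) = constantCoeff f := constantCoeff_rename _ f

theorem ofParam_add (f g : ParamSeries p) : ofParam (f + g) = ofParam f + ofParam g :=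
  map_add (rename Sum.inr) f g

theorem ofParam_C (c : ℝ) : ofParam (C c : ParamSeries p) = C c := rename_C _ c

theorem ofParam_X (l : Fin p) : ofParam (X l : ParamSeries p) = X (Sum.inr l) := rename_X _ l

theorem ofParam_eq_subst (f : ParamSeries p) :
    ofParam f = subst (fun l => X (Sum.inr l) : Fin p → StateSeries p) f :=
  rename_eq_subst Sum.inr f

theorem isParamSeries_ofParam (f : ParamSeries p) : IsParamSeries (ofParam f) := fun j => by
  ext d
  rw [coeff_pderiv, coeff_ofParam_eq_zero, zero_mul, map_zero]
  fin_cases j <;> simp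

theorem hasSubst_X_inr : HasSubst (fun l => X (Sum.inr l) : Fin p → StateSeries p) :=
  hasSubst_of_constantCoeff_zero fun _ => by simp

theorem pderiv_inr_ofParam (l : Fin p) (f : ParamSeries p) :
    pderiv ℝ (Sum.inr l) (ofParam f) = ofParam (pderiv ℝ l f) := by
  rw [ofParam_eq_subst, pderiv_subst (by simp), ofParam_eq_subst]
  rw [Finset.sum_eq_single l]
  · rw [pderiv_X_self, one_mul]
  · intro k _ hk
    rw [pderiv_X_of_ne (by simpa using hk), zero_mul]
  · simp

variable {ψ : Fin p → ParamSeries p}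

theorem constantCoeff_substParam (hψ : ∀ i, constantCoeff (ψ i) = 0) (i : Fin 2 ⊕ Fin p) :
    constantCoeff (substParam ψ i) = 0 := by
  rcases i with i | i
  · simp [substParam]
  · simpa [substParam, constantCoeff_ofParam] using hψ i

theorem hasSubst_substParam (hψ : ∀ i, constantCoeff (ψ i) = 0) : HasSubst (substParam ψ) :=
  hasSubst_of_constantCoeff_zero (constantCoeff_substParam hψ)

theorem subst_substParam_ofParam (hψ : ∀ i, constantCoeff (ψ i) = 0) (f : ParamSeries p) :
    subst (substParam ψ) (ofParam f) = ofParam (subst ψ f) := by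
  rw [ofParam_eq_subst, ofParam_eq_subst,
    subst_comp_subst_apply hasSubst_X_inr (hasSubst_substParam hψ),
    subst_comp_subst_apply (hasSubst_of_constantCoeff_zero hψ) hasSubst_X_inr]
  congr 1
  funext l
  rw [subst_X (hasSubst_substParam hψ)]
  exact ofParam_eq_subst _

theorem subst_extendParam_ofParam {Φ : PVectorField p} (hΦ : ∀ i, constantCoeff (Φ i) = 0)
    (f : ParamSeries p) : subst (extendParam Φ) (ofParam f) = ofParam f := by
  rw [ofParam_eq_subst, subst_comp_subst_apply hasSubst_X_inr (hasSubst_extendParam hΦ)]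
  congr 1
  funext l
  exact subst_X (hasSubst_extendParam hΦ) _

theorem pderiv_subst_substParam (hψ : ∀ i, constantCoeff (ψ i) = 0) (j : Fin 2)
    (f : StateSeries p) : pderiv ℝ (Sum.inl j) (subst (substParam ψ) f) =
      subst (substParam ψ) (pderiv ℝ (Sum.inl j) f) := by
  rw [pderiv_subst (constantCoeff_substParam hψ), Fintype.sum_sum_type]
  have h1 : ∀ l, pderiv ℝ (Sum.inl j) (substParam ψ (Sum.inr l)) = 0 := fun l =>
    isParamSeries_ofParam (ψ l) j
  simp only [h1, zero_mul, Finset.sum_const_zero, add_zero]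
  rw [Finset.sum_eq_single j]
  · change pderiv ℝ (Sum.inl j) (X (Sum.inl j)) * _ = _
    rw [pderiv_X_self, one_mul]
  · intro k _ hk
    change pderiv ℝ (Sum.inl j) (X (Sum.inl k)) * _ = _
    rw [pderiv_X_of_ne (by simpa using hk), zero_mul]
  · simp

theorem Reparametrization.apply_eq (ρ : Reparametrization p) (w : PVectorField p) (i : Fin 2) :
    ρ.apply w i = subst (substParam ρ.ψ) (w i) := rfl

/-- A change of variables in the new parameters. -/
def StateTimeChange.reparam (g : StateTimeChange p) (ρ : Reparametrization p) :
    StateTimeChange p where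
  Φ := ρ.apply g.Φ
  T := subst (substParam ρ.ψ) g.T
  Φ_zero i := by
    rw [ρ.apply_eq, constantCoeff_subst_of_zero (constantCoeff_substParam ρ.ψ_zero)]
    exact g.Φ_zero i
  Φ_inv := by
    have h := g.Φ_inv
    convert h using 2
    ext i j
    rw [Matrix.of_apply, Matrix.of_apply, ← constantCoeff_pderiv, ← constantCoeff_pderiv,
      ρ.apply_eq, pderiv_subst_substParam ρ.ψ_zero,
      constantCoeff_subst_of_zero (constantCoeff_substParam ρ.ψ_zero)]
  T_inv := by
    rw [constantCoeff_subst_of_zero (constantCoeff_substParam ρ.ψ_zero)]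
    exact g.T_inv

theorem StateTimeChange.Carries.reparam {g : StateTimeChange p} {w w' : PVectorField p}
    (h : g.Carries w w') (ρ : Reparametrization p) :
    (g.reparam ρ).Carries (ρ.apply w) (ρ.apply w') := by
  intro i
  have hs := hasSubst_substParam ρ.ψ_zero
  have h1 := congrArg (subst (substParam ρ.ψ)) (h i)
  rw [← coe_substAlgHom hs, map_sum, map_mul, coe_substAlgHom hs] at h1
  have hΦ' : ∀ i, constantCoeff (ρ.apply g.Φ i) = 0 := (g.reparam ρ).Φ_zero
  have e2 : subst (substParam ρ.ψ) (subst (extendParam g.Φ) (w i)) =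
      subst (extendParam (ρ.apply g.Φ)) (subst (substParam ρ.ψ) (w i)) := by
    rw [subst_comp_subst_apply (hasSubst_extendParam g.Φ_zero) hs,
      subst_comp_subst_apply hs (hasSubst_extendParam hΦ')]
    congr 1
    funext l
    rcases l with l | l
    · exact (subst_X (hasSubst_extendParam hΦ') _ :
        subst (extendParam (ρ.apply g.Φ)) (X (Sum.inl l) : StateSeries p) = _).symm
    · exact (subst_X hs _ : subst (substParam ρ.ψ) (X (Sum.inr l) : StateSeries p) = _).trans
        (subst_extendParam_ofParam hΦ' _).symm
  change _ = _ * subst (substParam ρ.ψ) (subst (extendParam g.Φ) (w i)) at h1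
  rw [e2] at h1
  refine Eq.trans (Finset.sum_congr rfl fun j _ => ?_) h1
  rw [subst_mul hs, ← pderiv_subst_substParam ρ.ψ_zero]
  rfl

/-- Weights 1 on the state variables and 0 on the parameters turn truncation into a congruence.
Reparametrization then respects it by the general estimate for substitutions. -/
theorem truncEq_iff {N : ℕ} {w w' : PVectorField p} : TruncEq N w w' ↔
    ∀ i, w i - w' i ∈ ordIdeal (Sum.elim 1 0 : Fin 2 ⊕ Fin p → ℕ) (N + 1) := by
  have h : ∀ m : Fin 2 ⊕ Fin p →₀ ℕ, Finsupp.weight (Sum.elim 1 0 : Fin 2 ⊕ Fin p → ℕ) m =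
      m (Sum.inl 0) + m (Sum.inl 1) := fun m => by
    rw [Finsupp.weight_eq_sum, Fintype.sum_sum_type, Fin.sum_univ_two]
    simp
  simp only [TruncEq, mem_ordIdeal, h, map_sub, sub_eq_zero, Nat.lt_succ_iff]

theorem TruncEq.reparam {N : ℕ} {w w' : PVectorField p} (h : TruncEq N w w')
    (ρ : Reparametrization p) : TruncEq N (ρ.apply w) (ρ.apply w') := by
  have hs := hasSubst_substParam ρ.ψ_zero
  rw [truncEq_iff] at h ⊢
  intro i
  have := subst_mem_ordIdeal (w' := Sum.elim 1 0) hs (fun l => ?_) (h i)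
  · rwa [← coe_substAlgHom hs, map_sub, coe_substAlgHom hs] at this
  · rcases l with l | l
    · exact X_mem_ordIdeal (Sum.elim 1 0 : Fin 2 ⊕ Fin p → ℕ) (Sum.inl l)
    · exact mem_ordIdeal_zero _

theorem TransformsTo.reparam {N : ℕ} {w u : PVectorField p} (h : TransformsTo N w u)
    (ρ : Reparametrization p) : TransformsTo N (ρ.apply w) (ρ.apply u) := by
  obtain ⟨g, w', h1, h2⟩ := h
  exact ⟨g.reparam ρ, ρ.apply w', h1.reparam ρ, h2.reparam ρ⟩

theorem Reparametrization.apply_levelForm (ρ : Reparametrization p) (s : ℕ) (J : Finset ℕ)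
    (a : ℤ → ParamSeries p) (b : ℕ → ParamSeries p) :
    ρ.apply (levelForm s J a b) =
      levelForm s J (fun j => subst ρ.ψ (a j)) fun k => subst ρ.ψ (b k) := by
  have hs := hasSubst_substParam ρ.ψ_zero
  have hx : subst (substParam ρ.ψ) (x p) = x p := subst_X hs _
  have hy : subst (substParam ρ.ψ) (y p) = y p := subst_X hs _
  have hα : subst (substParam ρ.ψ) (hamSeries J a) =
      hamSeries J fun j => subst ρ.ψ (a j) := by
    rw [hamSeries, ← coe_substAlgHom hs]
    simp only [map_add, map_mul, map_pow, map_sum, coe_substAlgHom, hy,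
      subst_substParam_ofParam ρ.ψ_zero]
    rfl
  have hβ : subst (substParam ρ.ψ) (eulerSeries s b) =
      eulerSeries s fun j => subst ρ.ψ (b j) := by
    rw [eulerSeries, ← coe_substAlgHom hs]
    simp only [map_add, map_mul, map_pow, map_sum, coe_substAlgHom, hy,
      subst_substParam_ofParam ρ.ψ_zero]
    rfl
  rw [levelForm_eq, levelForm_eq]
  funext i
  rw [ρ.apply_eq]
  fin_cases i
  · change subst (substParam ρ.ψ) (x p * eulerSeries s b + hamSeries J a) = _
    rw [← coe_substAlgHom hs, map_add, map_mul, coe_substAlgHom hs, hx, hα, hβ]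
    rfl
  · change subst (substParam ρ.ψ) (-x p + y p * eulerSeries s b) = _
    rw [← coe_substAlgHom hs, map_add, map_neg, map_mul, coe_substAlgHom hs, hx, hy, hβ]
    rfl

end Reparametrizations

end PNF

namespace PNF

/-! ### Non-degeneracy and the introduction of unfolding parameters. -/

noncomputable section Unfolding

variable {p : ℕ}

/-- The index set of the coefficients of a parametric normal form. -/
abbrev TermIndex (s : ℕ) (J : Finset ℕ) : Type := Fin (s - 1) ⊕ Fin 2 ⊕ Fin J.card

/-- The coefficients of a parametric normal form. -/
def termCoeff (s : ℕ) (J : Finset ℕ) (a : ℤ → ParamSeries p) (b : ℕ → ParamSeries p) :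
    TermIndex s J → ParamSeries p :=
  Sum.elim (fun k => b k) (Sum.elim ![a (-1), a 0] fun i => a (J.orderEmbOfFin rfl i))

/-- The terms of a parametric normal form. -/
def termField (p s : ℕ) (J : Finset ℕ) : TermIndex s J → PVectorField p :=
  Sum.elim (fun k => eulerTerm p 0 k) (Sum.elim ![hamTerm p (-1) (-1), hamTerm p (-1) 0]
    fun i => hamTerm p (-1) (J.orderEmbOfFin rfl i : ℕ))

/-- The index of the parameter in front of a term, counted from zero. -/
def termParam (s : ℕ) (J : Finset ℕ) : TermIndex s J → ℕ :=
  Sum.elim (fun k => k) (Sum.elim ![s - 1, s] fun i => i + s + 1)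

theorem sum_orderEmbOfFin {M : Type*} [AddCommMonoid M] (J : Finset ℕ) (f : ℕ → M) :
    ∑ i : Fin J.card, f (J.orderEmbOfFin rfl i) = ∑ j ∈ J, f j := by
  rw [← Finset.sum_coe_sort J, ← (J.orderIsoOfFin rfl).toEquiv.sum_comp]
  rfl

theorem levelForm_eq_sum (s : ℕ) (J : Finset ℕ) (a : ℤ → ParamSeries p) (b : ℕ → ParamSeries p) :
    levelForm s J a b = hamTerm p 1 0 + eulerTerm p 0 s +
      ∑ m, ofParam (termCoeff s J a b m) • termField p s J m := by
  rw [levelForm, Fintype.sum_sum_type, Fintype.sum_sum_type, Fin.sum_univ_two,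
    ← sum_orderEmbOfFin J fun j => ofParam (a j) • hamTerm p (-1) j, Finset.sum_range]
  simp only [termCoeff, termField, Sum.elim_inl, Sum.elim_inr, Matrix.cons_val_zero,
    Matrix.cons_val_one, Matrix.cons_val_fin_one]
  abel

theorem pderiv_inr_x (l : Fin p) : pderiv ℝ (Sum.inr l) (x p) = 0 := pderiv_X_of_ne (by simp)

theorem pderiv_inr_y (l : Fin p) : pderiv ℝ (Sum.inr l) (y p) = 0 := pderiv_X_of_ne (by simp)

theorem pderiv_inr_hamTerm (l : Fin p) (j k : ℤ) (i : Fin 2) :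
    pderiv ℝ (Sum.inr l) (hamTerm p j k i) = 0 := by
  have hC : ∀ c : ℝ, pderiv ℝ (Sum.inr l) (const p c) = 0 := fun c => pderiv_C
  fin_cases i <;>
    simp [hamTerm, Derivation.leibniz, Derivation.leibniz_pow, pderiv_inr_x, pderiv_inr_y, hC]

theorem pderiv_inr_eulerTerm (l : Fin p) (j k : ℤ) (i : Fin 2) :
    pderiv ℝ (Sum.inr l) (eulerTerm p j k i) = 0 := by
  fin_cases i <;>
    simp [eulerTerm, Derivation.leibniz, Derivation.leibniz_pow, pderiv_inr_x, pderiv_inr_y]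

theorem pderiv_inr_termField {s : ℕ} {J : Finset ℕ} (l : Fin p) (m : TermIndex s J) (i : Fin 2) :
    pderiv ℝ (Sum.inr l) (termField p s J m i) = 0 := by
  rcases m with m | m | m
  · exact pderiv_inr_eulerTerm _ _ _ _
  · fin_cases m <;> exact pderiv_inr_hamTerm _ _ _ _
  · exact pderiv_inr_hamTerm _ _ _ _

theorem atZero_ofParam (f : ParamSeries p) : atZero (ofParam f) = C (constantCoeff f) := by
  rw [atZero_eq_C fun d hd => coeff_ofParam_eq_zero f hd, constantCoeff_ofParam]

/-- The derivative of the normal form by `μ_l` at `μ = 0` is the image of the `l`-th column under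
the fixed linear map sending coefficients to terms, and a linear map does not increase dimension. -/
theorem rank_le_of_paramRank {s : ℕ} {J : Finset ℕ} (a : ℤ → ParamSeries p)
    (b : ℕ → ParamSeries p) :
    paramRank (levelForm s J a b) ≤ (Matrix.of fun (m : TermIndex s J) (l : Fin p) =>
      coeff (Finsupp.single l 1) (termCoeff s J a b m)).rank := by
  set A := Matrix.of fun (m : TermIndex s J) (l : Fin p) =>
      coeff (Finsupp.single l 1) (termCoeff s J a b m) with hA
  let T : (TermIndex s J → ℝ) →ₗ[ℝ] PVectorField 0 :=
    Fintype.linearCombination ℝ fun m i => atZero (termField p s J m i)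
  have h : ∀ l : Fin p, (fun i => atZero (pderiv ℝ (Sum.inr l) (levelForm s J a b i)) :
      PVectorField 0) = T (A.col l) := by
    intro l
    funext i
    rw [levelForm_eq_sum]
    simp only [Pi.add_apply, Finset.sum_apply, Pi.smul_apply, smul_eq_mul, map_add, map_sum,
      pderiv_inr_hamTerm, pderiv_inr_eulerTerm, Derivation.leibniz, pderiv_inr_termField,
      pderiv_inr_ofParam, mul_zero, zero_add, add_zero]
    simp only [T, Fintype.linearCombination_apply, Finset.sum_apply, Pi.smul_apply]
    rw [atZero_eq, ← coe_substAlgHom hasSubst_zeroParam, map_sum]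
    refine Finset.sum_congr rfl fun m _ => ?_
    rw [coe_substAlgHom, ← atZero_eq, atZero_mul, atZero_ofParam, constantCoeff_pderiv,
      smul_eq_C_mul, mul_comm]
    rfl
  rw [paramRank, Matrix.rank_eq_finrank_span_cols]
  have h2 : Set.range (fun l : Fin p => (fun i =>
      atZero (pderiv ℝ (Sum.inr l) (levelForm s J a b i)) : PVectorField 0)) =
      T '' Set.range A.col := by
    rw [← Set.range_comp]
    exact congrArg Set.range (funext h)
  rw [h2, ← Submodule.map_span]
  exact Submodule.finrank_map_le T _

theorem card_termIndex {s : ℕ} (hs : 1 ≤ s) (J : Finset ℕ) :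
    Fintype.card (TermIndex s J) = J.card + s + 1 := by
  simp only [TermIndex, Fintype.card_sum, Fintype.card_fin]
  omega

theorem termParam_lt {s : ℕ} (hs : 1 ≤ s) (J : Finset ℕ) (m : TermIndex s J) :
    termParam s J m < J.card + s + 1 := by
  rcases m with m | m | m
  · have := m.2
    simp only [termParam, Sum.elim_inl]
    omega
  · fin_cases m <;> simp [termParam]; omega
  · have := m.2
    simp only [termParam, Sum.elim_inr]
    omega

theorem termParam_injective {s : ℕ} (hs : 1 ≤ s) (J : Finset ℕ) :
    Function.Injective (termParam s J) := by
  rintro (m | m | m) (m' | m' | m') h <;> simp only [termParam, Sum.elim_inl, Sum.elim_inr] at h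
  · rw [Fin.ext h]
  · have := m.2
    fin_cases m' <;> simp at h <;> omega
  · have := m.2
    omega
  · have := m'.2
    fin_cases m <;> simp at h <;> omega
  · fin_cases m <;> fin_cases m' <;> simp at h ⊢ <;> omega
  · fin_cases m <;> simp at h <;> omega
  · have := m'.2
    omega
  · fin_cases m' <;> simp at h <;> omega
  · rw [Fin.ext (by omega : (m : ℕ) = m')]

/-- The unfolding parameters are introduced as new parameters. -/
theorem exists_reparametrization {s : ℕ} (hs : 1 ≤ s) {J : Finset ℕ} {a : ℤ → ParamSeries p}
    {b : ℕ → ParamSeries p} (h : paramRank (levelForm s J a b) = J.card + s + 1) :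
    J.card + s + 1 ≤ p ∧ ∃ ρ : Reparametrization p, ∀ m, ofParam (subst ρ.ψ (termCoeff s J a b m)) =
      const p (constantCoeff (termCoeff s J a b m)) + par p (termParam s J m + 1) := by
  have h1 := rank_le_of_paramRank (s := s) (J := J) a b
  set A := Matrix.of fun (m : TermIndex s J) (l : Fin p) =>
      coeff (Finsupp.single l 1) (termCoeff s J a b m) with hA
  have hcard := card_termIndex hs J
  have h2 := A.rank_le_card_height
  have h3 := A.rank_le_card_width
  rw [Fintype.card_fin] at h3
  have hp : J.card + s + 1 ≤ p := by omega
  -- Each term receives the parameter prescribed by the normal form; any parameters beyond the first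
  -- `n + s + 1` remain free.
  let e : TermIndex s J ↪ Fin p :=
    ⟨fun m => ⟨termParam s J m, (termParam_lt hs J m).trans_le hp⟩,
      fun m m' hm => termParam_injective hs J (Fin.mk.inj hm)⟩
  have hA' : A = Matrix.of fun (m : TermIndex s J) (l : Fin p) => coeff (Finsupp.single l 1)
      (termCoeff s J a b m - C (constantCoeff (termCoeff s J a b m))) := by
    classical
    ext m l
    simp [hA, coeff_C]
  obtain ⟨ψ, hψ0, hψ1, hψ⟩ := exists_subst_eq_X
    -- The constants are split off to apply the inverse function theorem at the origin; they return
    -- as the `α_j`.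
    (fun m => termCoeff s J a b m - C (constantCoeff (termCoeff s J a b m)))
    (fun m => by simp) (by rw [← hA']; omega) e
  refine ⟨hp, ⟨ψ, hψ0, hψ1⟩, fun m => ?_⟩
  have hs' : HasSubst ψ := hasSubst_of_constantCoeff_zero hψ0
  have h4 := hψ m
  rw [← coe_substAlgHom hs', map_sub, coe_substAlgHom, subst_C_real hs', sub_eq_iff_eq_add] at h4
  have hpar : par p (termParam s J m + 1) = X (Sum.inr (e m)) := by
    have := (termParam_lt hs J m).trans_le hp
    rw [par, dif_pos ⟨by omega, by omega⟩]
    rfl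
  change ofParam (subst ψ _) = _
  rw [h4, ofParam_add, ofParam_X, ofParam_C, hpar, add_comm]
  rfl

theorem parametricNormalForm_eq {s : ℕ} {J : Finset ℕ} {α : ℕ → ℝ}
    {a : ℤ → ParamSeries p} {b : ℕ → ParamSeries p}
    (hb : ∀ k < s - 1, ofParam (b k) = par p (k + 1)) (ha : ofParam (a (-1)) = par p s)
    (ha0 : ofParam (a 0) = par p (s + 1))
    (haJ : ∀ i : Fin J.card, ofParam (a (J.orderEmbOfFin rfl i)) =
      const p (α (J.orderEmbOfFin rfl i)) + par p ((i + 1) + s + 1)) :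
    parametricNormalForm p s J α = levelForm s J a b := by
  rw [levelForm_eq, hamSeries, eulerSeries, ha, ha0,
    ← sum_orderEmbOfFin J fun j => ofParam (a j) * y p ^ (j + 1)]
  have hB : ∑ k ∈ Finset.range (s - 1), ofParam (b k) * y p ^ k =
      ∑ k ∈ Finset.range (s - 1), par p (k + 1) * y p ^ k :=
    Finset.sum_congr rfl fun k hk => by rw [hb k (Finset.mem_range.1 hk)]
  rw [hB]
  simp only [haJ]
  funext i
  fin_cases i
  · simp only [parametricNormalForm, normalField, Fin.zero_eta, Matrix.cons_val_zero, mul_add,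
      Finset.mul_sum, mul_left_comm (x p), mul_assoc]
    ring
  · simp only [parametricNormalForm, normalField, Fin.mk_one, Matrix.cons_val_one,
      Matrix.cons_val_fin_one, mul_add, Finset.mul_sum, mul_left_comm (y p), pow_succ']
    ring

theorem parametricNormalForm_eq_add (s : ℕ) (J : Finset ℕ) (α : ℕ → ℝ) :
    parametricNormalForm p s J α = hamPart p s J α + eulerPart p s := by
  have h1 : ∀ j : ℕ, hamTerm p (-1) j = ![y p ^ (j + 1), 0] := fun j => by
    rw [hamTerm_neg_one _ (by omega)]
    congr 2
  have h2 : hamTerm p (-1) 0 = ![y p, 0] := by simpa using h1 0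
  have h3 : hamTerm p (-1) (-1) = ![1, 0] := by rw [hamTerm_neg_one _ le_rfl]; simp
  funext i
  fin_cases i
  · simp only [parametricNormalForm, hamPart, eulerPart, hamTerm_one_zero, eulerTerm_zero, h1, h2,
      h3, Finset.sum_apply, Pi.add_apply, Pi.smul_apply, smul_eq_mul, Fin.zero_eta,
      Matrix.cons_val_zero, mul_assoc]
    ring
  · simp only [parametricNormalForm, hamPart, eulerPart, hamTerm_one_zero, eulerTerm_zero, h1, h2,
      h3, Finset.sum_apply, Pi.add_apply, Pi.smul_apply, smul_eq_mul, Fin.mk_one,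
      Matrix.cons_val_one, Matrix.cons_val_fin_one, mul_zero, Finset.sum_const_zero]
    ring

/-- The universal unfolding of a non-degenerate perturbation. -/
theorem IsNonDegenerate.exists_unfolding {s r₁ N : ℕ} (hs : 1 ≤ s) (hr₁ : 2 * s < r₁)
    {J : Finset ℕ} {w : PVectorField p} (h : IsNonDegenerate s r₁ N J w) :
    ∃ (ρ : Reparametrization p) (α : ℕ → ℝ), J.card + s + 1 ≤ p ∧ (∀ j ∈ J, j < r₁ → α j = 0) ∧
      α r₁ ≠ 0 ∧ TransformsTo N (ρ.apply w) (parametricNormalForm p s J α) := by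
  obtain ⟨u, ⟨a, b, rfl, hb, ha, har⟩, hT, hrank⟩ := h
  obtain ⟨hp, ρ, hρ⟩ := exists_reparametrization hs hrank
  refine ⟨ρ, fun j => constantCoeff (a j), hp, fun j _ hj => ha j (by omega) (by omega), har, ?_⟩
  have h0 : const p 0 = 0 := map_zero _
  rw [parametricNormalForm_eq (a := fun j => subst ρ.ψ (a j)) (b := fun j => subst ρ.ψ (b j)),
    ← ρ.apply_levelForm]
  · exact hT.reparam ρ
  · intro k hk
    have := hρ (Sum.inl ⟨k, hk⟩)
    simpa only [termCoeff, termParam, Sum.elim_inl, hb k hk, h0, zero_add] using this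
  · have := hρ (Sum.inr (Sum.inl 0))
    have e : s - 1 + 1 = s := by omega
    simpa only [termCoeff, termParam, Sum.elim_inl, Sum.elim_inr, Matrix.cons_val_zero,
      ha (-1) le_rfl (by omega), h0, zero_add, e] using this
  · have := hρ (Sum.inr (Sum.inl 1))
    simpa only [termCoeff, termParam, Sum.elim_inl, Sum.elim_inr, Matrix.cons_val_one,
      Matrix.cons_val_fin_one, ha 0 (by omega) (by omega), h0, zero_add] using this
  · intro i
    have := hρ (Sum.inr (Sum.inr i))
    rw [show (i : ℕ) + 1 + s + 1 = i + s + 1 + 1 by ring]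
    exact this

theorem HasIndices.mem_unfoldingIndices {s r₁ e N : ℕ} (hN : r₁ < N) {v : PVectorField 0}
    (hv : HasIndices s r₁ e v) :
    1 ≤ s ∧ 2 * s < r₁ ∧ r₁ ∈ unfoldingIndices s e N := by
  rcases hv with ⟨hne, ⟨hs, hr, g, a, b, hg, ⟨hbs, hb, hres⟩, ha, har⟩, rfl⟩ |
    ⟨h0, r₂, hr₂, ⟨hs, hr, hlt, g, a, b, hg, ⟨hbs, hb, hres⟩, ha, har, har₂⟩, rfl⟩
  · refine ⟨hs, hr, ?_⟩
    simp only [unfoldingIndices, Finset.mem_filter, Finset.mem_Ico]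
    exact ⟨⟨by omega, hN⟩, by omega, fun h => har (hres r₁ le_rfl h)⟩
  · refine ⟨hs, hr, ?_⟩
    simp only [unfoldingIndices, Finset.mem_filter, Finset.mem_Ico]
    exact ⟨⟨by omega, hN⟩, by omega, fun h => har (hres r₁ hlt.le h)⟩

end Unfolding

end PNF

/-- Both choices of `J` are served by one argument: non-degeneracy already supplies a normal form
with index set `J`, and the reparametrization works for an arbitrary finite set. -/
theorem mainTheorem1 (s r₁ e N p : ℕ) (hN : r₁ < N)
    (v : PVectorField 0) (hBT : PNF.IsBogdanovTakens v) (hv : PNF.HasIndices s r₁ e v)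
    (w : PVectorField p) (hw : PNF.IsDeformation w v) :
    (∃ u : PVectorField p, PNF.IsLevelForm s r₁ (PNF.unfoldingIndices s e N) u ∧
      PNF.TransformsTo N w u) ∧
    ∀ J : Finset ℕ,
      (J = PNF.unfoldingIndices s e N ∨ J = (PNF.unfoldingIndices s e N).erase (2 * s)) →
      PNF.IsNonDegenerate s r₁ N J w →
      ∃ (ρ : PNF.Reparametrization p) (α : ℕ → ℝ),
        J.card + s + 1 ≤ p ∧
        (∀ j ∈ J, j < r₁ → α j = 0) ∧ r₁ ∈ J ∧ α r₁ ≠ 0 ∧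
        PNF.TransformsTo N (ρ.apply w) (PNF.parametricNormalForm p s J α) ∧
        PNF.parametricNormalForm p s J α = PNF.hamPart p s J α + PNF.eulerPart p s := by
  obtain ⟨hs, hr, hmem⟩ := hv.mem_unfoldingIndices hN
  refine ⟨hv.exists_isLevelForm hw, fun J hJ hnd => ?_⟩
  obtain ⟨ρ, α, h1, h2, h3, h4⟩ := hnd.exists_unfolding hs hr
  refine ⟨ρ, α, h1, h2, ?_, h3, h4, PNF.parametricNormalForm_eq_add s J α⟩
  rcases hJ with rfl | rfl
  · exact hmem
  -- Erasing `2s` keeps `r₁`, because `2s < r₁`.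
  · exact Finset.mem_erase.2 ⟨hr.ne', hmem⟩
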